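/- **Setting.** For $p\ge 0$ let $\mathcal M_p$ be the set of Borel probability measures on $[0,\infty)$ with finite moment of order $p$; a probability density belongs to $\mathcal M_p$ if the measure it defines does. For $s=m+\theta$ with $m\in\mathbb N$ and $0<\theta\le 1$, let $\mathcal F_s$ be the class of functions $\varphi\in C^m([0,\infty))$ with $\varphi(0)=\varphi'(0)=0$ whose $m$-th derivative is Hölder continuous of order $\theta$ on $[0,\infty)$. In what follows $p=2+\delta$. Let $0<\gamma<1$ and $\sigma>0$, and let $\mu_\sigma$ be the law of $\sigma Y$, where $Y$ is a real random variable. A trade between agents with wealths $w,w_*\ge 0$ and market returns $\eta,\eta_*$ gives $$w'=(1-\gamma)w+\gamma w_*+\eta w,\qquad w_*'=(1-\gamma)w_*+\gamma w+\eta_* w_* ,$$ and takes place only if $w'\ge 0$ and $w'_*\ge 0$. A weak solution of the Boltzmann equation with parameters $\gamma,\sigma$ and initial density $f_0$ is a family of probability densities $f(\cdot,t)\in\mathcal M_p$, $t\ge 0$, such that for every $\varphi\in\mathcal F_p$ the function $t\mapsto\int_0^\infty\varphi(w) f(w,t)\,dw$ is $C^1$ on $[0,\infty)$, tends to $\int_0^\infty\varphi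 f_0\,dw$ as $t\to 0^+$, and satisfies for every $t>0$ $$\frac{d}{dt}\int_0^\infty \varphi(w) f(w,t)\,dw=\int_{\mathbb R^2}\int_{[0,\infty)^2}\mathbf 1_{\{w'\ge 0,\;w'_*\ge 0\}}\big(\varphi(w')-\varphi(w)\big)f(w,t)f(w_*,t)\,dw\,dw_*\,\mu_\sigma(d\eta)\,\mu_\sigma(d\eta_*).$$ For $m\in\mathbb R$ and $\lambda>0$, a weak solution of the Fokker–Planck equation $$\partial_\tau g=\frac{\lambda}{2}\,\partial_w^2(w^2g)+\partial_w\big((w-m)g\big)$$ with initial density $f_0$ is a family of probability densities $g(\cdot,\tau)\in\mathcal M_p$, $\tau\ge 0$, such that for every $\varphi\in\mathcal F_p$ the function $\tau\mapsto\int_0^\infty\varphi(w) g(w,\tau)\,dw$ is $C^1$ on $[0,\infty)$, tends to $\int_0^\infty\varphi f_0\,dw$ as $\tau\to0^+$, and satisfies for every $\tau>0$ $$\frac{d}{d\tau}\int_0^\infty \varphi(w) g(w,\tau)\,dw=\int_0^\infty\Big[(m-w)\varphi'(w)+\frac\lambda2 w^2\varphi''(w)\Big]g(w,\tau)\,dw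 .$$ **Theorem.** Let $0<\delta<\alpha$ and $\lambda>0$. Let $f_0$ be a probability density on $[0,\infty)$ with $\int_0^\infty w^{2+\delta}f_0(w)\,dw<\infty$, and put $m=\int_0^\infty w f_0(w)\,dw$. Let $Y$ be a symmetric real random variable of unit variance that has a density and satisfies $E|Y|^{2+\alpha}<\infty$. Let $\gamma_n\in(0,1)$ and $\sigma_n>0$ satisfy $\gamma_n\to 0$ and $\sigma_n^2=\lambda\gamma_n$, and for each $n$ let $f_n$ be a weak solution of the Boltzmann equation with parameters $\gamma_n,\sigma_n$ and initial density $f_0$. Put $g_n(w,\tau)=f_n(w,t)$ with $\tau=\gamma_n t$. Then there are a subsequence $(g_{n_j})_j$ and probability densities $g(\cdot,\tau)$, $\tau\ge 0$, such that $g_{n_j}(\cdot,\tau)$ converges to $g(\cdot,\tau)$ weakly in the sense of measures for every $\tau\ge 0$. Moreover $g$ is a weak solution of the Fokker–Planck equation with initial density $f_0$ and with this $m$, and it conserves the mean wealth: $\int_0^\infty w\,g(w,\tau)\,dw=m$ for every $\tau\ge0$. -/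

import Mathlib

open MeasureTheory ProbabilityTheory Set Filter Topology
open scoped NNReal

noncomputable section

/-- `ν` is a probability density on `[0, ∞)` with finite moment of order `p`, seen as a measure:
a Borel probability measure carried by `[0, ∞)`, absolutely continuous with respect to Lebesgue
measure, with `∫ |w| ^ p dν < ∞`. -/
structure IsWealthDensity (p : ℝ) (ν : ProbabilityMeasure ℝ) : Prop where
  support : (ν : Measure ℝ) (Iio 0) = 0
  hasDensity : (ν : Measure ℝ) ≪ volume
  moment : Integrable (fun w : ℝ => |w| ^ p) (ν : Measure ℝ)

/-- The class `𝓕_s` of test functions on `[0, ∞)`: `φ(0) = φ'(0) = 0`, and the derivative of order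
`m` of `φ` is Hölder continuous of order `θ` on `[0, ∞)`, where `s = m + θ` with `m` an integer and
`0 < θ ≤ 1`. Only the values of `φ` on `[0, ∞)` matter; derivatives at `0` are one-sided. -/
def IsTestFunction (s : ℝ) (φ : ℝ → ℝ) : Prop :=
  φ 0 = 0 ∧ derivWithin φ (Ici 0) 0 = 0 ∧
    ∃ (m : ℕ) (θ C : ℝ≥0), 0 < θ ∧ θ ≤ 1 ∧ (m : ℝ) + (θ : ℝ) = s ∧
      ContDiffOn ℝ m φ (Ici 0) ∧ HolderOnWith C θ (iteratedDerivWithin m φ (Ici 0)) (Ici 0)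

/-- Wealth after a trade of an agent with wealth `w` who meets an agent with wealth `v`:
`w' = (1 - γ) w + γ v + η w`. -/
def postTrade (γ w v η : ℝ) : ℝ := (1 - γ) * w + γ * v + η * w

/-- Indicator of the trades without debts: both post-trade wealths are nonnegative. -/
def noDebt (γ w v η ζ : ℝ) : ℝ :=
  if 0 ≤ postTrade γ w v η ∧ 0 ≤ postTrade γ v w ζ then 1 else 0

/-- The Boltzmann collision operator in weak form, `(Q(f, f), φ)`, for the trade coefficient `γ` and
the law `μ` of the market returns `η`, `η_*`:
`∫∫∫∫ 1{w' ≥ 0} 1{w_*' ≥ 0} (φ(w') - φ(w)) f(dw) f(dw_*) μ(dη) μ(dη_*)`. The integration variable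
is `x = ((w, w_*), (η, η_*))`. -/
def boltzmannWeak (γ : ℝ) (μ : Measure ℝ) (f : Measure ℝ) (φ : ℝ → ℝ) : ℝ :=
  ∫ x : (ℝ × ℝ) × (ℝ × ℝ),
    noDebt γ x.1.1 x.1.2 x.2.1 x.2.2 * (φ (postTrade γ x.1.1 x.1.2 x.2.1) - φ x.1.1)
      ∂((f.prod f).prod (μ.prod μ))

/-- The Fokker-Planck operator `(κ/2) ∂²_w (w² g) + ∂_w ((w - m) g)` in weak form:
`∫ ((m - w) φ'(w) + (κ/2) w² φ''(w)) g(dw)`, for `g` carried by `[0, ∞)`. -/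
def fokkerPlanckWeak (κ m : ℝ) (g : Measure ℝ) (φ : ℝ → ℝ) : ℝ :=
  ∫ w, ((m - w) * derivWithin φ (Ici 0) w
    + κ / 2 * w ^ 2 * iteratedDerivWithin 2 φ (Ici 0) w) ∂g

/-- `f` is a weak solution, of class `C¹` in time with values in the probability densities with
finite moment of order `p`, of `∂_t f = A f` with initial datum `f₀`; the operator `A` is given in
weak form, `A ν φ = (A ν, φ)`. Only the times `t ≥ 0` matter. -/
structure IsWeakSolution (p : ℝ) (A : Measure ℝ → (ℝ → ℝ) → ℝ)
    (f₀ : ProbabilityMeasure ℝ) (f : ℝ → ProbabilityMeasure ℝ) : Prop where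
  density : ∀ t, 0 ≤ t → IsWealthDensity p (f t)
  smooth : ∀ φ, IsTestFunction p φ →
    ContDiffOn ℝ 1 (fun t => ∫ w, φ w ∂(f t : Measure ℝ)) (Ici 0)
  equation : ∀ φ, IsTestFunction p φ → ∀ t, 0 < t →
    HasDerivAt (fun s => ∫ w, φ w ∂(f s : Measure ℝ)) (A (f t : Measure ℝ) φ) t
  initial : ∀ φ, IsTestFunction p φ →
    Tendsto (fun t => ∫ w, φ w ∂(f t : Measure ℝ)) (𝓝[>] 0) (𝓝 (∫ w, φ w ∂(f₀ : Measure ℝ)))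

end

/-!
On the slow time scale `τ = γ t` a single trade changes the wealth `w` by a drift of size `γ` and a
centred fluctuation of variance `lam * γ * w ^ 2`, so a second order Taylor expansion of a test
function turns the collision operator, divided by `γ`, into the Fokker-Planck operator. The solution
of the limit equation is obtained by compactness; its uniqueness is not needed.

*Consistency.* The expansion is made for smooth test functions that vanish near `0` and are affine
near `∞` (`IsNice`). A trade is excluded by the no-debt condition only if one of the returns is at
least `1 / 2` in modulus. The cost of this, like the Taylor remainder, is controlled by the moment of
order `q = min p 3` of the returns, which is of size `γ ^ (q / 2)`, hence negligible against `γ`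
(`IsNice.abs_boltzmannWeak_sub_le`). The drift that appears contains the mean of the solution itself.

*Bounds.* The moment of order `p` grows at most exponentially in `τ`, uniformly along the sequence
(`boltzmannWeak_rpow_le`, `IsWeakSolution.moment_le`). To keep a density in the limit, absolute
continuity is propagated in the quantitative form `f A ≤ K |A| + ε`. For fixed returns and a fixed
partner a trade is an affine map of `w`, with Jacobian `1 - γ + η`. The term of the inverse Jacobian
that is linear in `η` averages to zero, and so `K` grows only at a rate proportional to `γ`
(`IsBump.boltzmannWeak_le`, `IsWeakSolution.measure_le`).

*Compactness.* These facts are collected in `IsFokkerPlanckApprox`. Tightness and a diagonal argument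
give convergence at rational times, and equicontinuity in time, tested on bump functions, gives it at
all times (`IsFokkerPlanckApprox.exists_subseq`). The limit is a curve of densities that solves the
limit equation for nice functions (`IsMeanFieldCurve`).

*The limit equation.* The limit measures do not charge `0`, and so the equation passes to pointwise
limits of test functions on `(0, ∞)` (`IsMeanFieldCurve.equation_of_tendsto`). Approximation of the
function `w` shows that the mean is conserved (`IsMeanFieldCurve.integral_id`), which makes the drift
linear. Approximation of the second derivative of a test function of the class `𝓕_p` gives the
equation for the whole class. For `w ^ p` it shows that the moment of order `p` is continuous in
time; this provides the uniform integrability that makes the right-hand side continuous in time for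
every test function, so that the solution is of class `C¹` (`IsMeanFieldCurve.isWeakSolution`).
-/

section SmoothTestFunctions

open scoped ContDiff

/-! ### Test functions -/

/-- The test functions used along the sequence of Boltzmann solutions: smooth functions on the
line that vanish on a neighbourhood of `(-∞, 0]` and are affine near `+∞`. -/
structure IsNice (φ : ℝ → ℝ) : Prop where
  smooth : ContDiff ℝ ∞ φ
  zero_near : ∃ a > 0, ∀ x ≤ a, φ x = 0
  affine_far : ∃ b, ∀ x ≥ b, deriv (deriv φ) x = 0

/-- Splitting of the order of a test function: the integer part is `⌈p⌉ - 1`, so that the Hölder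
exponent lies in `(0, 1]`. -/
theorem exists_nat_add_holder_exponent {p : ℝ} (hp : 2 < p) :
    ∃ (j : ℕ) (θ : ℝ≥0), 0 < θ ∧ θ ≤ 1 ∧ ((j + 2 : ℕ) : ℝ) + θ = p := by
  obtain ⟨j, hj⟩ : ∃ j : ℕ, ⌈p⌉₊ = j + 3 := by
    have : 2 < ⌈p⌉₊ := Nat.lt_ceil.2 (by exact_mod_cast hp)
    exact ⟨⌈p⌉₊ - 3, by omega⟩
  have h1 : p ≤ j + 3 := by
    have := Nat.le_ceil p
    rw [hj] at this
    exact_mod_cast this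
  have h2 : (j : ℝ) + 2 < p := by
    have : j + 2 < ⌈p⌉₊ := by omega
    exact_mod_cast Nat.lt_ceil.1 this
  obtain ⟨θ, hθ⟩ : ∃ θ : ℝ≥0, (θ : ℝ) = p - (j + 2) := ⟨⟨p - (j + 2), by linarith⟩, rfl⟩
  refine ⟨j, θ, ?_, ?_, ?_⟩
  · rw [← NNReal.coe_pos, hθ]; linarith
  · rw [← NNReal.coe_le_coe, hθ, NNReal.coe_one]; linarith
  · rw [hθ]; push_cast; ring

theorem holderOnWith_of_abs_sub_le {u : ℝ → ℝ} {s : Set ℝ} {C θ : ℝ≥0}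
    (h : ∀ x ∈ s, ∀ y ∈ s, |u x - u y| ≤ C * |x - y| ^ (θ : ℝ)) : HolderOnWith C θ u s := by
  intro x hx y hy
  rw [edist_dist, edist_dist, Real.dist_eq, Real.dist_eq,
    ENNReal.ofReal_rpow_of_nonneg (abs_nonneg _) θ.coe_nonneg, ← ENNReal.ofReal_coe_nnreal,
    ← ENNReal.ofReal_mul C.coe_nonneg]
  exact ENNReal.ofReal_le_ofReal (h x hx y hy)

theorem abs_sub_le_rpow_of_bounded_of_lipschitz {u : ℝ → ℝ} {B L : ℝ} (hB : ∀ x, |u x| ≤ B)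
    (hL : ∀ x y, |u x - u y| ≤ L * |x - y|) {θ : ℝ} (hθ : 0 ≤ θ) (hθ1 : θ ≤ 1) (x y : ℝ) :
    |u x - u y| ≤ (2 * B + L) * |x - y| ^ θ := by
  have hB0 : 0 ≤ B := (abs_nonneg _).trans (hB 0)
  have hL0 : 0 ≤ L := by simpa using (abs_nonneg _).trans (hL 0 1)
  rcases le_total |x - y| 1 with h | h
  · have h1 : |x - y| ≤ |x - y| ^ θ := by
      simpa using Real.rpow_le_rpow_of_exponent_ge_of_imp (abs_nonneg (x - y)) h hθ1
        (fun h0 h2 => by simp at h2)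
    have := hL x y
    have h3 : 0 ≤ |x - y| ^ θ := by positivity
    nlinarith
  · have h1 : 1 ≤ |x - y| ^ θ := Real.one_le_rpow h hθ
    have h2 : |u x - u y| ≤ 2 * B := by
      have := abs_sub (u x) (u y)
      have := hB x
      have := hB y
      linarith
    nlinarith

theorem HasCompactSupport.exists_bound_lipschitz {u : ℝ → ℝ} (hu : ContDiff ℝ ∞ u)
    (hc : HasCompactSupport u) :
    ∃ B L : ℝ, 0 ≤ B ∧ 0 ≤ L ∧ (∀ x, |u x| ≤ B) ∧ ∀ x y, |u x - u y| ≤ L * |x - y| := by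
  obtain ⟨B, hB⟩ := hc.exists_bound_of_continuous hu.continuous
  obtain ⟨L, hL⟩ := hu.lipschitzWith_of_hasCompactSupport hc (by simp)
  refine ⟨B, L, (norm_nonneg _).trans (hB 0), L.2, hB, fun x y => ?_⟩
  simpa [Real.dist_eq] using hL.dist_le_mul x y

theorem HasCompactSupport.iteratedDeriv_real {u : ℝ → ℝ} (hc : HasCompactSupport u) (n : ℕ) :
    HasCompactSupport (iteratedDeriv n u) := by
  induction n with
  | zero => simpa using hc
  | succ n ih => rw [iteratedDeriv_succ]; exact ih.deriv

namespace IsNice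

variable {φ : ℝ → ℝ}

theorem hasDerivAt (h : IsNice φ) (x : ℝ) : HasDerivAt φ (deriv φ x) x :=
  ((h.smooth.differentiable (by simp)) x).hasDerivAt

theorem smooth_deriv (h : IsNice φ) : ContDiff ℝ ∞ (deriv φ) := by
  simpa using h.smooth.iterate_deriv 1

theorem smooth_deriv_deriv (h : IsNice φ) : ContDiff ℝ ∞ (deriv (deriv φ)) := by
  simpa using h.smooth.iterate_deriv 2

theorem hasDerivAt_deriv (h : IsNice φ) (x : ℝ) : HasDerivAt (deriv φ) (deriv (deriv φ) x) x :=
  ((h.smooth_deriv.differentiable (by simp)) x).hasDerivAt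

theorem deriv_zero_near (h : IsNice φ) : ∃ a > 0, ∀ x < a, deriv φ x = 0 := by
  obtain ⟨a, ha, h0⟩ := h.zero_near
  refine ⟨a, ha, fun x hx => ?_⟩
  have : φ =ᶠ[𝓝 x] fun _ => 0 := by
    filter_upwards [Iio_mem_nhds hx] with y hy using h0 y (le_of_lt hy)
  rw [this.deriv_eq]; simp

theorem deriv_deriv_zero_near (h : IsNice φ) : ∃ a > 0, ∀ x < a, deriv (deriv φ) x = 0 := by
  obtain ⟨a, ha, h0⟩ := h.deriv_zero_near
  refine ⟨a, ha, fun x hx => ?_⟩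
  have : deriv φ =ᶠ[𝓝 x] fun _ => 0 := by
    filter_upwards [Iio_mem_nhds hx] with y hy using h0 y hy
  rw [this.deriv_eq]; simp

theorem hasCompactSupport_deriv_deriv (h : IsNice φ) : HasCompactSupport (deriv (deriv φ)) := by
  obtain ⟨a, -, ha⟩ := h.deriv_deriv_zero_near
  obtain ⟨b, hb⟩ := h.affine_far
  refine HasCompactSupport.intro (K := Icc a b) isCompact_Icc fun x hx => ?_
  by_cases hxa : x < a
  · exact ha x hxa
  · refine hb x ?_
    by_contra hxb
    exact hx ⟨not_lt.1 hxa, le_of_lt (not_le.1 hxb)⟩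

/-- The second derivative is bounded and Lipschitz, the first derivative is bounded. -/
theorem exists_bounds (h : IsNice φ) : ∃ B : ℝ, 0 ≤ B ∧ (∀ x, |deriv φ x| ≤ B) ∧
    (∀ x, |deriv (deriv φ) x| ≤ B) ∧ (∀ x y, |φ x - φ y| ≤ B * |x - y|) ∧
    ∀ κ : ℝ, 0 ≤ κ → κ ≤ 1 → ∀ x y,
      |deriv (deriv φ) x - deriv (deriv φ) y| ≤ B * |x - y| ^ κ := by
  obtain ⟨B, L, hB0, hL0, hB, hL⟩ :=
    h.hasCompactSupport_deriv_deriv.exists_bound_lipschitz h.smooth_deriv_deriv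
  obtain ⟨b, hb⟩ := h.affine_far
  obtain ⟨a, ha, ha0⟩ := h.deriv_zero_near
  obtain ⟨D, hD⟩ := (isCompact_Icc (a := min 0 b) (b := max b 0)).exists_bound_of_continuousOn
    h.smooth_deriv.continuous.continuousOn
  have hD' : ∀ x, |deriv φ x| ≤ D := by
    have hD0 : 0 ≤ D := (norm_nonneg _).trans (hD 0 ⟨min_le_left _ _, le_max_right _ _⟩)
    intro x
    rcases le_total x (max b 0) with h1 | h1
    · rcases le_total (min 0 b) x with h2 | h2
      · exact hD x ⟨h2, h1⟩
      · rw [ha0 x (lt_of_le_of_lt (h2.trans (min_le_left _ _)) ha)]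
        simpa using hD0
    · have h3 : deriv φ x = deriv φ (max b 0) := by
        have := (convex_Ici (max b 0)).norm_image_sub_le_of_norm_hasDerivWithin_le
          (f := deriv φ) (f' := deriv (deriv φ)) (C := 0)
          (fun y _ => (h.hasDerivAt_deriv y).hasDerivWithinAt)
          (fun y hy => by rw [hb y ((le_max_left _ _).trans hy)]; simp)
          (self_mem_Ici) (show x ∈ Ici (max b 0) from h1)
        simp only [zero_mul, norm_le_zero_iff, sub_eq_zero] at this
        exact this
      rw [h3]
      exact hD _ ⟨(min_le_left _ _).trans (le_max_right _ _), le_rfl⟩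
  have hD0 : 0 ≤ D := (abs_nonneg _).trans (hD' 0)
  refine ⟨2 * B + L + D, by positivity, fun x => (hD' x).trans (by linarith),
    fun x => (hB x).trans (by linarith), fun x y => ?_, fun κ h0 h1 x y => ?_⟩
  · have := convex_univ.norm_image_sub_le_of_norm_hasDerivWithin_le
          (f := φ) (f' := deriv φ) (C := D) (s := univ)
          (fun y _ => (h.hasDerivAt y).hasDerivWithinAt)
          (fun y hy => hD' y) (mem_univ y) (mem_univ x)
    simp only [Real.norm_eq_abs] at this
    refine this.trans ?_
    gcongr
    linarith
  · refine (abs_sub_le_rpow_of_bounded_of_lipschitz hB hL h0 h1 x y).trans ?_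
    exact mul_le_mul_of_nonneg_right (by linarith) (by positivity)

theorem map_zero (h : IsNice φ) : φ 0 = 0 := by
  obtain ⟨a, ha, h0⟩ := h.zero_near
  exact h0 0 ha.le

theorem continuous (h : IsNice φ) : Continuous φ := h.smooth.continuous

/-- All derivatives from the second order on have compact support, hence they are Hölder continuous
of every order. -/
theorem isTestFunction (h : IsNice φ) {p : ℝ} (hp : 2 < p) : IsTestFunction p φ := by
  have hu : UniqueDiffOn ℝ (Ici (0 : ℝ)) := uniqueDiffOn_Ici 0
  refine ⟨h.map_zero, ?_, ?_⟩
  · rw [(h.hasDerivAt 0).hasDerivWithinAt.derivWithin (hu 0 self_mem_Ici)]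
    obtain ⟨a, ha, h0⟩ := h.deriv_zero_near
    exact h0 0 ha
  · obtain ⟨j, θ, hθ, hθ1, hj⟩ := exists_nat_add_holder_exponent hp
    have hsm : ContDiff ℝ ∞ (iteratedDeriv (j + 2) φ) := by
      rw [iteratedDeriv_eq_iterate]; exact h.smooth.iterate_deriv _
    have hcs : HasCompactSupport (iteratedDeriv (j + 2) φ) := by
      rw [iteratedDeriv_succ', iteratedDeriv_succ']
      exact h.hasCompactSupport_deriv_deriv.iteratedDeriv_real j
    obtain ⟨B, L, hB0, hL0, hB, hL⟩ := hcs.exists_bound_lipschitz hsm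
    obtain ⟨C, hC⟩ : ∃ C : ℝ≥0, (C : ℝ) = 2 * B + L := ⟨⟨2 * B + L, by positivity⟩, rfl⟩
    refine ⟨j + 2, θ, C, hθ, hθ1, hj, (contDiff_infty.1 h.smooth _).contDiffOn, ?_⟩
    refine holderOnWith_of_abs_sub_le fun x hx y hy => ?_
    have hcd : ∀ z, ContDiffAt ℝ ((j + 2 : ℕ) : WithTop ℕ∞) φ z := fun z =>
      (contDiff_infty.1 h.smooth _).contDiffAt
    rw [iteratedDerivWithin_eq_iteratedDeriv hu (hcd x) hx,
      iteratedDerivWithin_eq_iteratedDeriv hu (hcd y) hy, hC]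
    exact abs_sub_le_rpow_of_bounded_of_lipschitz hB hL θ.coe_nonneg (by exact_mod_cast hθ1) x y

end IsNice

theorem abs_rpow_sub_rpow_le {x y θ : ℝ} (hx : 0 ≤ x) (hy : 0 ≤ y) (h0 : 0 ≤ θ) (h1 : θ ≤ 1) :
    |x ^ θ - y ^ θ| ≤ |x - y| ^ θ := by
  wlog h : y ≤ x generalizing x y
  · rw [abs_sub_comm, abs_sub_comm x]
    exact this hy hx (le_of_not_ge h)
  rw [abs_of_nonneg (sub_nonneg.2 (Real.rpow_le_rpow hy h h0)), abs_of_nonneg (sub_nonneg.2 h)]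
  have := Real.rpow_add_le_add_rpow hy (sub_nonneg.2 h) h0 h1
  rw [add_sub_cancel] at this
  linarith

/-- The function whose integral is the moment of order `p` is itself a test function, since the
derivative of order `m` is a multiple of `w ^ θ`. -/
theorem isTestFunction_rpow {p : ℝ} (hp : 2 < p) : IsTestFunction p (fun w => w ^ p) := by
  have hu : UniqueDiffOn ℝ (Ici (0 : ℝ)) := uniqueDiffOn_Ici 0
  refine ⟨Real.zero_rpow (by linarith), ?_, ?_⟩
  · rw [(Real.hasDerivAt_rpow_const (Or.inr (by linarith))).hasDerivWithinAt.derivWithin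
      (hu 0 self_mem_Ici), Real.zero_rpow (by linarith), mul_zero]
  · obtain ⟨j, θ, hθ, hθ1, hj⟩ := exists_nat_add_holder_exponent hp
    have hle : ((j + 2 : ℕ) : ℝ) ≤ p := by rw [← hj]; simp
    have hcd : ContDiff ℝ ((j + 2 : ℕ) : WithTop ℕ∞) (fun w : ℝ => w ^ p) :=
      Real.contDiff_rpow_const_of_le hle
    obtain ⟨C, hC⟩ : ∃ C : ℝ≥0, (C : ℝ) = |(descPochhammer ℝ (j + 2)).eval p| :=
      ⟨⟨_, abs_nonneg _⟩, rfl⟩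
    refine ⟨j + 2, θ, C, hθ, hθ1, hj, hcd.contDiffOn, ?_⟩
    refine holderOnWith_of_abs_sub_le fun x hx y hy => ?_
    rw [iteratedDerivWithin_eq_iteratedDeriv hu hcd.contDiffAt hx,
      iteratedDerivWithin_eq_iteratedDeriv hu hcd.contDiffAt hy, iteratedDeriv_eq_iterate,
      Real.iter_deriv_rpow_const, Real.iter_deriv_rpow_const,
      show p - ((j + 2 : ℕ) : ℝ) = θ by rw [← hj]; ring, ← mul_sub, abs_mul, hC]
    gcongr
    exact abs_rpow_sub_rpow_le hx hy θ.coe_nonneg (by exact_mod_cast hθ1)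

/-- What the limit equation uses about a test function of order `p > 2`: it is of class `C²` on
`[0, ∞)`, and its second derivative grows at most like `w ^ (p - 2)`. -/
theorem IsTestFunction.regularity {p : ℝ} (hp : 2 < p) {φ : ℝ → ℝ} (h : IsTestFunction p φ) :
    ContinuousOn (iteratedDerivWithin 2 φ (Ici 0)) (Ici 0) ∧
    (∀ x ∈ Ici (0 : ℝ), HasDerivWithinAt φ (derivWithin φ (Ici 0) x) (Ici 0) x) ∧
    (∀ x ∈ Ici (0 : ℝ), HasDerivWithinAt (derivWithin φ (Ici 0))
      (iteratedDerivWithin 2 φ (Ici 0) x) (Ici 0) x) ∧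
    ∃ C : ℝ, 0 ≤ C ∧ ∀ x ∈ Ici (0 : ℝ),
      |iteratedDerivWithin 2 φ (Ici 0) x| ≤ C * (1 + x ^ (p - 2)) := by
  have hu : UniqueDiffOn ℝ (Ici (0 : ℝ)) := uniqueDiffOn_Ici 0
  obtain ⟨-, -, m, θ, C, hθ, hθ1, hm, hcd, hh⟩ := h
  have hθ1' : (θ : ℝ) ≤ 1 := by exact_mod_cast hθ1
  have hm2 : 2 ≤ m := by
    have : (1 : ℝ) < m := by linarith
    have : 1 < m := by exact_mod_cast this
    omega
  have hder : ∀ j < m, ∀ x ∈ Ici (0 : ℝ), HasDerivWithinAt (iteratedDerivWithin j φ (Ici 0))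
      (iteratedDerivWithin (j + 1) φ (Ici 0) x) (Ici 0) x := by
    intro j hj x hx
    rw [iteratedDerivWithin_succ]
    exact ((hcd.differentiableOn_iteratedDerivWithin (by exact_mod_cast hj) hu) x hx).hasDerivWithinAt
  -- the Hölder bound for the top derivative is integrated down to the second derivative
  have hgrow : ∀ k, k + 2 ≤ m → ∃ D : ℝ, 0 ≤ D ∧ ∀ x ∈ Ici (0 : ℝ),
      |iteratedDerivWithin (m - k) φ (Ici 0) x| ≤ D * (1 + x ^ ((θ : ℝ) + k)) := by
    intro k
    induction k with
    | zero =>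
      intro _
      refine ⟨|iteratedDerivWithin m φ (Ici 0) 0| + C, by positivity, fun x hx => ?_⟩
      have h1 := hh.dist_le hx (self_mem_Ici)
      rw [Real.dist_eq, Real.dist_eq, sub_zero, abs_of_nonneg (show (0:ℝ) ≤ x from hx)] at h1
      have h2 : 0 ≤ x ^ (θ : ℝ) := Real.rpow_nonneg hx _
      have h3 := abs_sub_abs_le_abs_sub (iteratedDerivWithin m φ (Ici 0) x)
        (iteratedDerivWithin m φ (Ici 0) 0)
      simp only [Nat.sub_zero, Nat.cast_zero, add_zero]
      nlinarith [abs_nonneg (iteratedDerivWithin m φ (Ici 0) 0), C.coe_nonneg]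
    | succ k ih =>
      intro hk
      obtain ⟨D, hD0, hD⟩ := ih (by omega)
      set u := iteratedDerivWithin (m - (k + 1)) φ (Ici 0) with hu_def
      refine ⟨|u 0| + 2 * D, by positivity, fun x hx => ?_⟩
      have hx0 : (0 : ℝ) ≤ x := hx
      have h1 := (convex_Icc 0 x).norm_image_sub_le_of_norm_hasDerivWithin_le
        (f := u) (f' := iteratedDerivWithin (m - k) φ (Ici 0))
        (C := D * (1 + x ^ ((θ : ℝ) + k))) (fun y hy => by
          have := hder (m - (k + 1)) (by omega) y hy.1
          rw [show m - (k + 1) + 1 = m - k by omega] at this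
          exact this.mono Icc_subset_Ici_self)
        (fun y hy => (hD y hy.1).trans (by
          have := Real.rpow_le_rpow hy.1 hy.2 (show 0 ≤ (θ : ℝ) + k by positivity)
          gcongr))
        (left_mem_Icc.2 hx0) (right_mem_Icc.2 hx0)
      rw [sub_zero, Real.norm_eq_abs, Real.norm_eq_abs, abs_of_nonneg hx0] at h1
      have h3 := abs_sub_abs_le_abs_sub (u x) (u 0)
      have hpow : x ^ ((θ : ℝ) + (k + 1 : ℕ)) = x ^ ((θ : ℝ) + k) * x := by
        push_cast
        rw [← add_assoc, Real.rpow_add_one' hx0 (by positivity)]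
      have h4 : x ≤ 1 + x ^ ((θ : ℝ) + (k + 1 : ℕ)) := by
        rcases le_total x 1 with h | h
        · have := Real.rpow_nonneg hx0 ((θ : ℝ) + (k + 1 : ℕ)); linarith
        · have := Real.rpow_le_rpow_of_exponent_le h
            (show (1 : ℝ) ≤ (θ : ℝ) + (k + 1 : ℕ) by
              push_cast; linarith [θ.coe_nonneg, k.cast_nonneg (α := ℝ)])
          rw [Real.rpow_one] at this; linarith
      have h5 : 0 ≤ x ^ ((θ : ℝ) + (k + 1 : ℕ)) := Real.rpow_nonneg hx0 _
      have h6 : D * (1 + x ^ ((θ : ℝ) + k)) * x ≤ 2 * D * (1 + x ^ ((θ : ℝ) + (k + 1 : ℕ))) := by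
        calc D * (1 + x ^ ((θ : ℝ) + k)) * x = D * (x + x ^ ((θ : ℝ) + (k + 1 : ℕ))) := by
              rw [hpow]; ring
          _ ≤ D * (2 * (1 + x ^ ((θ : ℝ) + (k + 1 : ℕ)))) := by gcongr; linarith
          _ = _ := by ring
      have h7 : |u 0| ≤ |u 0| * (1 + x ^ ((θ : ℝ) + (k + 1 : ℕ))) :=
        le_mul_of_one_le_right (abs_nonneg _) (by linarith)
      linarith
  refine ⟨?_, ?_, ?_, ?_⟩
  · exact hcd.continuousOn_iteratedDerivWithin (by exact_mod_cast hm2) hu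
  · intro x hx
    simpa [iteratedDerivWithin_zero, iteratedDerivWithin_one] using hder 0 (by omega) x hx
  · intro x hx
    have := hder 1 (by omega) x hx
    rwa [show iteratedDerivWithin 1 φ (Ici 0) = derivWithin φ (Ici 0) by
      ext y; rw [iteratedDerivWithin_one]] at this
  · obtain ⟨D, hD0, hD⟩ := hgrow (m - 2) (by omega)
    refine ⟨D, hD0, fun x hx => ?_⟩
    have := hD x hx
    rwa [show m - (m - 2) = 2 by omega, Nat.cast_sub hm2,
      show (θ : ℝ) + ((m : ℝ) - (2 : ℕ)) = p - 2 by push_cast; rw [← hm]; ring] at this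

/-! ### Auxiliary real analysis -/

/-- Taylor's formula of first order, with the constant that results from two applications of the
mean value inequality. -/
theorem abs_taylor_one_le {f f' f'' : ℝ → ℝ} {x y B : ℝ} (h1 : ∀ z, HasDerivAt f (f' z) z)
    (h2 : ∀ z, HasDerivAt f' (f'' z) z) (hB : ∀ z ∈ uIcc x y, |f'' z| ≤ B) :
    |f y - f x - f' x * (y - x)| ≤ B * (y - x) ^ 2 := by
  have hB0 : 0 ≤ B := (abs_nonneg _).trans (hB x left_mem_uIcc)
  have h3 : ∀ z ∈ uIcc x y, |f' z - f' x| ≤ B * |y - x| := fun z hz => by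
    have := (convex_uIcc x y).norm_image_sub_le_of_norm_hasDerivWithin_le
      (fun z _ => (h2 z).hasDerivWithinAt) hB left_mem_uIcc hz
    refine this.trans ?_
    gcongr
    exact abs_sub_left_of_mem_uIcc hz
  have := (convex_uIcc x y).norm_image_sub_le_of_norm_hasDerivWithin_le
    (f := fun z => f z - f' x * z) (f' := fun z => f' z - f' x)
    (fun z _ => ((h1 z).sub
      (((hasDerivAt_id z).const_mul (f' x)).congr_deriv (mul_one _))).hasDerivWithinAt)
    h3 left_mem_uIcc right_mem_uIcc
  rw [Real.norm_eq_abs, Real.norm_eq_abs, mul_assoc, abs_mul_abs_self] at this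
  calc _ = |f y - f' x * y - (f x - f' x * x)| := by congr 1; ring
    _ ≤ _ := this
    _ = _ := by ring

/-- Differential form of Grönwall's lemma, with zero as the barrier. -/
theorem nonpos_of_deriv_le_mul {z z' : ℝ → ℝ} {c T : ℝ} (hc : ContinuousOn z (Ici 0))
    (hd : ∀ t, 0 < t → HasDerivAt z (z' t) t) (h : ∀ t, 0 < t → t ≤ T → z' t ≤ c * z t)
    (h0 : z 0 ≤ 0) {t : ℝ} (ht : 0 ≤ t) (htT : t ≤ T) : z t ≤ 0 := by
  have hder : ∀ s, 0 < s → HasDerivAt (fun s => Real.exp (-c * s) * z s)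
      (Real.exp (-c * s) * (z' s - c * z s)) s := fun s hs => by
    have h1 : HasDerivAt (fun s => Real.exp (-c * s)) (Real.exp (-c * s) * (-c * 1)) s :=
      ((hasDerivAt_id s).const_mul (-c)).exp
    exact (h1.mul (hd s hs)).congr_deriv (by ring)
  have hanti : AntitoneOn (fun s => Real.exp (-c * s) * z s) (Icc 0 T) := by
    refine antitoneOn_of_deriv_nonpos (convex_Icc 0 T) ?_ ?_ ?_
    · exact (by fun_prop : Continuous fun s => Real.exp (-c * s)).continuousOn.mul
        (hc.mono Icc_subset_Ici_self)
    · rw [interior_Icc]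
      exact fun s hs => (hder s hs.1).differentiableAt.differentiableWithinAt
    · rw [interior_Icc]
      intro s hs
      rw [(hder s hs.1).deriv]
      exact mul_nonpos_of_nonneg_of_nonpos (Real.exp_pos _).le
        (sub_nonpos.2 (h s hs.1 hs.2.le))
  have := hanti ⟨le_rfl, ht.trans htT⟩ ⟨ht, htT⟩ ht
  simp only [mul_zero, Real.exp_zero, one_mul] at this
  exact nonpos_of_mul_nonpos_right (this.trans h0) (Real.exp_pos _)

theorem rpow_le_one_add_rpow {x r s : ℝ} (hx : 0 ≤ x) (hr : 0 ≤ r) (hrs : r ≤ s) :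
    x ^ r ≤ 1 + x ^ s := by
  rcases le_total x 1 with h | h
  · have := Real.rpow_le_one hx h hr
    have := Real.rpow_nonneg hx s
    linarith
  · have := Real.rpow_le_rpow_of_exponent_le h hrs
    linarith

theorem add_rpow_le_two_rpow_mul {x y r : ℝ} (hx : 0 ≤ x) (hy : 0 ≤ y) (hr : 0 ≤ r) :
    (x + y) ^ r ≤ 2 ^ r * (x ^ r + y ^ r) := by
  have h : x + y ≤ 2 * max x y := by
    have := le_max_left x y
    have := le_max_right x y
    linarith
  have h1 := Real.rpow_nonneg hx r
  have h2 := Real.rpow_nonneg hy r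
  calc (x + y) ^ r ≤ (2 * max x y) ^ r := Real.rpow_le_rpow (by positivity) h hr
    _ = 2 ^ r * (max x y) ^ r := Real.mul_rpow (by norm_num) (by positivity)
    _ ≤ 2 ^ r * (x ^ r + y ^ r) := by
      gcongr
      rcases max_choice x y with h | h <;> rw [h] <;> linarith

/-! ### Comparison of measures through bump functions -/

theorem IsNice.of_zero_outside {φ : ℝ → ℝ} (hs : ContDiff ℝ ∞ φ) {a b : ℝ} (ha : 0 < a)
    (h0 : ∀ x ≤ a, φ x = 0) (h1 : ∀ x ≥ b, φ x = 0) : IsNice φ := by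
  refine ⟨hs, ⟨a, ha, h0⟩, b + 1, fun x hx => ?_⟩
  have h2 : ∀ y > b, deriv φ y = 0 := fun y hy => by
    have : φ =ᶠ[𝓝 y] fun _ => 0 := by
      filter_upwards [Ioi_mem_nhds hy] with z hz using h1 z (le_of_lt hz)
    rw [this.deriv_eq]; simp
  have : deriv φ =ᶠ[𝓝 x] fun _ => 0 := by
    filter_upwards [Ioi_mem_nhds (show b < x by linarith)] with z hz using h2 z hz
  rw [this.deriv_eq]; simp

/-- Smooth compactly supported bump functions on `(0, ∞)`. -/
structure IsBump (φ : ℝ → ℝ) : Prop where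
  nice : IsNice φ
  compact : HasCompactSupport φ
  mem_Icc : ∀ x, φ x ∈ Icc (0 : ℝ) 1

theorem exists_isBump {K U : Set ℝ} (hK : IsCompact K) (hU : IsOpen U) (hKU : K ⊆ U)
    (hK0 : K ⊆ Ioi 0) :
    ∃ φ, IsBump φ ∧ (∀ x ∈ K, φ x = 1) ∧ ∀ x ∉ U, φ x = 0 := by
  obtain ⟨a, ha, haK⟩ : ∃ a > 0, ∀ x ∈ K, a < x := by
    rcases K.eq_empty_or_nonempty with rfl | hne
    · exact ⟨1, one_pos, by simp⟩
    · obtain ⟨m, hm, hmin⟩ := hK.exists_isLeast hne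
      have : 0 < m := hK0 hm
      exact ⟨m / 2, by linarith, fun x hx => by have := hmin hx; linarith⟩
  obtain ⟨b, hb⟩ := hK.bddAbove
  obtain ⟨f, hf0, hf1, hf⟩ := exists_contMDiffMap_zero_one_of_isClosed (n := ⊤)
    (modelWithCornersSelf ℝ ℝ) (s := (U ∩ Ioo a (b + 1))ᶜ) (t := K)
    (hU.inter isOpen_Ioo).isClosed_compl hK.isClosed (by
      rw [disjoint_compl_left_iff_subset]
      exact fun x hx => ⟨hKU hx, haK x hx, by have := hb hx; linarith⟩)
  have h0 : ∀ x, x ∉ U ∩ Ioo a (b + 1) → f x = 0 := fun x hx => hf0 hx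
  refine ⟨f, ⟨?_, ?_, hf⟩, fun x hx => hf1 hx, fun x hx => h0 x fun h => hx h.1⟩
  · exact IsNice.of_zero_outside (b := b + 1) f.contMDiff.contDiff ha
      (fun x hx => h0 x fun h => not_lt.2 hx h.2.1) (fun x hx => h0 x fun h => not_lt.2 hx h.2.2)
  · exact HasCompactSupport.intro (K := Icc a (b + 1)) isCompact_Icc fun x hx =>
      h0 x fun h => hx ⟨h.2.1.le, h.2.2.le⟩

/-- An inequality between two measures that is tested on bump functions passes to all sets. -/
theorem measure_le_of_forall_isBump {ν ρ : Measure ℝ} [IsFiniteMeasure ν] [ρ.OuterRegular]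
    [IsFiniteMeasureOnCompacts ρ] (hν : ν (Iic 0) = 0) {ε : ENNReal}
    (h : ∀ φ, IsBump φ → ∫⁻ x, ENNReal.ofReal (φ x) ∂ν ≤ ∫⁻ x, ENNReal.ofReal (φ x) ∂ρ + ε)
    {A : Set ℝ} (hA : MeasurableSet A) : ν A ≤ ρ A + ε := by
  have hA' : ν A = ν (A ∩ Ioi 0) := by
    refine le_antisymm ?_ (measure_mono inter_subset_left)
    calc ν A ≤ ν ((A ∩ Ioi 0) ∪ Iic 0) := measure_mono fun x hx => by
          by_cases h0 : 0 < x
          · exact Or.inl ⟨hx, h0⟩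
          · exact Or.inr (not_lt.1 h0)
      _ ≤ ν (A ∩ Ioi 0) + ν (Iic 0) := measure_union_le _ _
      _ = _ := by rw [hν, add_zero]
  rw [hA']
  refine le_of_forall_lt fun r hr => ?_
  obtain ⟨K, hKA, hK, hrK⟩ := (hA.inter measurableSet_Ioi).exists_lt_isCompact hr
  refine hrK.trans_le ((?_ : ν K ≤ ρ K + ε).trans (by
    gcongr; exact hKA.trans inter_subset_left))
  refine ENNReal.le_of_forall_pos_le_add fun η hη _ => ?_
  obtain ⟨U, hKU, hU, hUlt⟩ := K.exists_isOpen_lt_add (μ := ρ) hK.measure_lt_top.ne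
    (ε := η) (by exact_mod_cast hη.ne')
  obtain ⟨φ, hφ, h1, h0⟩ := exists_isBump hK hU hKU (hKA.trans inter_subset_right)
  have hK1 : ν K ≤ ∫⁻ x, ENNReal.ofReal (φ x) ∂ν := by
    rw [← lintegral_indicator_one hK.measurableSet]
    refine lintegral_mono fun x => ?_
    by_cases hx : x ∈ K
    · simp [hx, h1 x hx]
    · simp [hx]
  have hU1 : ∫⁻ x, ENNReal.ofReal (φ x) ∂ρ ≤ ρ U := by
    rw [← lintegral_indicator_one hU.measurableSet]
    refine lintegral_mono fun x => ?_
    by_cases hx : x ∈ U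
    · simp [hx, (hφ.mem_Icc x).2]
    · simp [hx, h0 x hx]
  calc ν K ≤ ρ U + ε := hK1.trans ((h φ hφ).trans (by gcongr))
    _ ≤ ρ K + η + ε := by gcongr
    _ = ρ K + ε + η := by ring

/-! ### Weak convergence and unbounded integrands -/

/-- Weak convergence passes to integrals of a continuous function `h` dominated by a uniformly
integrable `ψ`. -/
theorem tendsto_integral_of_uniform_tail {ι : Type*} {l : Filter ι} {ν : ι → ProbabilityMeasure ℝ}
    {ν₀ : ProbabilityMeasure ℝ} (hν : Tendsto ν l (𝓝 ν₀)) {h ψ : ℝ → ℝ} (hc : Continuous h)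
    (hle : ∀ x, |h x| ≤ ψ x)
    (hi : ∀ᶠ i in l, Integrable ψ (ν i : Measure ℝ)) (hi0 : Integrable ψ (ν₀ : Measure ℝ))
    (htail : ∀ ε > 0, ∃ R : ℝ, (∀ᶠ i in l, ∫ x, max (ψ x - R) 0 ∂(ν i : Measure ℝ) ≤ ε) ∧
      ∫ x, max (ψ x - R) 0 ∂(ν₀ : Measure ℝ) ≤ ε) :
    Tendsto (fun i => ∫ x, h x ∂(ν i : Measure ℝ)) l (𝓝 (∫ x, h x ∂(ν₀ : Measure ℝ))) := by
  rw [Metric.tendsto_nhds]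
  intro ε hε
  obtain ⟨R, hR, hR0⟩ := htail (ε / 4) (by linarith)
  -- truncation of `h` at height `R ∨ 0`; the error is at most `(ψ - R)⁺`
  set S := max R 0 with hS
  have hS0 : 0 ≤ S := le_max_right _ _
  set k : ℝ → ℝ := fun x => max (-S) (min (h x) S) with hk
  have hkc : Continuous k := by fun_prop
  have hkb : ∀ x, |k x| ≤ S := fun x =>
    abs_le.2 ⟨le_max_left _ _, max_le (by linarith) (min_le_right _ _)⟩
  have herr : ∀ x, |h x - k x| ≤ max (ψ x - R) 0 := fun x => by
    have h1 := abs_le.1 (hle x)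
    have hRS : R ≤ S := le_max_left _ _
    have hRS' : S = R ∨ S = 0 := max_choice _ _
    simp only [hk]
    rcases le_total (h x) S with h2 | h2
    · rw [min_eq_left h2]
      rcases le_total (-S) (h x) with h3 | h3
      · rw [max_eq_right h3]; simp
      · rw [max_eq_left h3, abs_of_nonpos (by linarith)]
        refine le_trans ?_ (le_max_left _ _); linarith
    · rw [min_eq_right h2, max_eq_right (by linarith), abs_of_nonneg (by linarith)]
      refine le_trans ?_ (le_max_left _ _); linarith
  have key : ∀ (μ : Measure ℝ) [IsProbabilityMeasure μ], Integrable ψ μ →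
      |∫ x, h x ∂μ - ∫ x, k x ∂μ| ≤ ∫ x, max (ψ x - R) 0 ∂μ := by
    intro μ _ hψ
    have hhi : Integrable h μ := hψ.mono' hc.aestronglyMeasurable (Eventually.of_forall hle)
    have hki : Integrable k μ := (integrable_const S).mono' hkc.aestronglyMeasurable
      (Eventually.of_forall hkb)
    rw [← integral_sub hhi hki]
    exact (abs_integral_le_integral_abs).trans
      (integral_mono (hhi.sub hki).abs ((hψ.sub (integrable_const R)).pos_part) herr)
  have hlim := (ProbabilityMeasure.tendsto_iff_forall_integral_tendsto.1 hν)
    (BoundedContinuousFunction.ofNormedAddCommGroup k hkc S hkb)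
  rw [Metric.tendsto_nhds] at hlim
  filter_upwards [hlim (ε / 4) (by linarith), hR, hi] with i h1 h2 h3
  simp only [BoundedContinuousFunction.coe_ofNormedAddCommGroup, Real.dist_eq] at h1 ⊢
  have h4 := abs_le.1 (key (ν i) h3)
  have h5 := abs_le.1 (key ν₀ hi0)
  have h6 := abs_lt.1 h1
  rw [abs_lt]
  constructor <;> linarith [h4.1, h4.2, h5.1, h5.2, h6.1, h6.2]

/-- Weak convergence with bounded moments of order `p` passes to the integrals of continuous
functions of growth at most `|x| ^ (p / 2)`. -/
theorem tendsto_integral_of_moment_bound {ι : Type*} {l : Filter ι}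
    {ν : ι → ProbabilityMeasure ℝ} {ν₀ : ProbabilityMeasure ℝ} (hν : Tendsto ν l (𝓝 ν₀))
    {p B D : ℝ} {h : ℝ → ℝ} (hc : Continuous h) (hD : ∀ x, h x ^ 2 ≤ D * (1 + |x| ^ p))
    (hi : ∀ᶠ i in l, Integrable (fun x => |x| ^ p) (ν i : Measure ℝ) ∧
      ∫ x, |x| ^ p ∂(ν i : Measure ℝ) ≤ B)
    (hi0 : Integrable (fun x => |x| ^ p) (ν₀ : Measure ℝ) ∧ ∫ x, |x| ^ p ∂(ν₀ : Measure ℝ) ≤ B) :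
    Tendsto (fun i => ∫ x, h x ∂(ν i : Measure ℝ)) l (𝓝 (∫ x, h x ∂(ν₀ : Measure ℝ))) := by
  have hD0 : 0 ≤ D := by
    have h1 := (sq_nonneg _).trans (hD 0)
    by_contra h2
    have : 0 ≤ |(0 : ℝ)| ^ p := by positivity
    nlinarith
  have hB0 : 0 ≤ B := le_trans (integral_nonneg fun x => by positivity) hi0.2
  have hI : ∀ (μ : Measure ℝ) [IsProbabilityMeasure μ], Integrable (fun x => |x| ^ p) μ →
      Integrable (fun x => |h x|) μ := fun μ _ hμ => by
    refine (((integrable_const (1 : ℝ)).add hμ).const_mul D |>.add (integrable_const 1)).mono'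
      hc.abs.aestronglyMeasurable (Eventually.of_forall fun x => ?_)
    simp only [Pi.add_apply, Real.norm_eq_abs, abs_abs]
    have := hD x
    nlinarith [sq_abs (h x), sq_nonneg (|h x| - 1)]
  -- Chebyshev's inequality in the form `(|h| - R)⁺ ≤ h ^ 2 / R`
  have htl : ∀ R > 0, ∀ (μ : Measure ℝ) [IsProbabilityMeasure μ],
      Integrable (fun x => |x| ^ p) μ ∧ ∫ x, |x| ^ p ∂μ ≤ B →
      ∫ x, max (|h x| - R) 0 ∂μ ≤ D * (1 + B) / R := by
    intro R hR μ _ hμ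
    calc ∫ x, max (|h x| - R) 0 ∂μ ≤ ∫ x, D / R * (1 + |x| ^ p) ∂μ := by
          refine integral_mono ((hI μ hμ.1).sub (integrable_const R)).pos_part
            (((integrable_const (1 : ℝ)).add hμ.1).const_mul _) fun x => ?_
          have h1 : 0 ≤ |x| ^ p := by positivity
          refine max_le ?_ (by positivity)
          rw [div_mul_eq_mul_div, le_div_iff₀ hR]
          have := hD x
          nlinarith [sq_abs (h x), sq_nonneg (|h x| - R), abs_nonneg (h x)]
      _ = D / R * (1 + ∫ x, |x| ^ p ∂μ) := by
          rw [integral_const_mul, integral_add (integrable_const _) hμ.1]; simp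
      _ ≤ D / R * (1 + B) := by have := hμ.2; gcongr
      _ = _ := by ring
  refine tendsto_integral_of_uniform_tail hν hc (fun x => le_rfl)
    (hi.mono fun i h => hI _ h.1) (hI _ hi0.1) fun ε hε => ?_
  have hR : 0 < D * (1 + B) / ε + 1 := by positivity
  have hle : D * (1 + B) / (D * (1 + B) / ε + 1) ≤ ε := by
    rw [div_le_iff₀ hR]
    have : ε * (D * (1 + B) / ε + 1) = D * (1 + B) + ε := by field_simp
    linarith
  exact ⟨_, hi.mono fun i h => (htl _ hR _ h).trans hle, (htl _ hR _ hi0).trans hle⟩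

/-- If the integrals of a nonnegative continuous `ψ` converge along a weakly convergent family,
then so do those of every continuous function dominated by a multiple of `ψ`. -/
theorem tendsto_integral_of_tendsto_dominating {ι : Type*} {l : Filter ι}
    {ν : ι → ProbabilityMeasure ℝ} {ν₀ : ProbabilityMeasure ℝ} (hν : Tendsto ν l (𝓝 ν₀))
    {h ψ : ℝ → ℝ} (hc : Continuous h) (hψc : Continuous ψ) (hle : ∀ x, |h x| ≤ ψ x)
    (hi : ∀ᶠ i in l, Integrable ψ (ν i : Measure ℝ)) (hi0 : Integrable ψ (ν₀ : Measure ℝ))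
    (hψ : Tendsto (fun i => ∫ x, ψ x ∂(ν i : Measure ℝ)) l (𝓝 (∫ x, ψ x ∂(ν₀ : Measure ℝ)))) :
    Tendsto (fun i => ∫ x, h x ∂(ν i : Measure ℝ)) l (𝓝 (∫ x, h x ∂(ν₀ : Measure ℝ))) := by
  have hψ0 : ∀ x, 0 ≤ ψ x := fun x => (abs_nonneg _).trans (hle x)
  refine tendsto_integral_of_uniform_tail hν hc hle hi hi0 fun ε hε => ?_
  have h1 : Tendsto (fun n : ℕ => ∫ x, max (ψ x - n) 0 ∂(ν₀ : Measure ℝ)) atTop (𝓝 0) := by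
    have : Tendsto (fun n : ℕ => ∫ x, max (ψ x - n) 0 ∂(ν₀ : Measure ℝ)) atTop
        (𝓝 (∫ _, (0 : ℝ) ∂(ν₀ : Measure ℝ))) := by
      refine tendsto_integral_of_dominated_convergence ψ
        (fun n => ((hψc.sub continuous_const).max continuous_const).aestronglyMeasurable) hi0
        (fun n => Eventually.of_forall fun x => ?_) (Eventually.of_forall fun x => ?_)
      · rw [Real.norm_eq_abs, abs_of_nonneg (le_max_right _ _)]
        exact max_le (by linarith [n.cast_nonneg (α := ℝ)]) (hψ0 x)
      · refine tendsto_const_nhds.congr' ?_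
        obtain ⟨N, hN⟩ := exists_nat_ge (ψ x)
        filter_upwards [eventually_ge_atTop N] with n hn
        have : (N : ℝ) ≤ n := by exact_mod_cast hn
        rw [max_eq_right (by linarith)]
    simpa using this
  obtain ⟨n, hn⟩ := (h1.eventually (gt_mem_nhds hε)).exists
  -- `(ψ - n)⁺ = ψ - min ψ n`, and `min ψ n` is bounded and continuous
  have hmin : ∀ (μ : Measure ℝ) [IsProbabilityMeasure μ], Integrable ψ μ →
      ∫ x, max (ψ x - n) 0 ∂μ = ∫ x, ψ x ∂μ - ∫ x, min (ψ x) n ∂μ := fun μ _ hμ => by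
    rw [← integral_sub hμ (show Integrable (fun x => min (ψ x) (n : ℝ)) μ from
      hμ.inf (integrable_const _))]
    congr 1 with x
    rcases le_total (ψ x) n with h | h
    · rw [max_eq_right (by linarith), min_eq_left h, sub_self]
    · rw [max_eq_left (by linarith), min_eq_right h]
  have hb : ∀ x, ‖min (ψ x) (n : ℝ)‖ ≤ n := fun x => by
    rw [Real.norm_eq_abs, abs_of_nonneg (le_min (hψ0 x) n.cast_nonneg)]
    exact min_le_right _ _
  have hlim := (ProbabilityMeasure.tendsto_iff_forall_integral_tendsto.1 hν)
    (BoundedContinuousFunction.ofNormedAddCommGroup _ (hψc.min continuous_const) (n : ℝ) hb)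
  simp only [BoundedContinuousFunction.coe_ofNormedAddCommGroup] at hlim
  have h2 := hψ.sub hlim
  rw [← hmin ν₀ hi0] at h2
  refine ⟨n, ?_, hn.le⟩
  filter_upwards [h2.eventually (gt_mem_nhds hn), hi] with i h3 h4
  rw [hmin _ h4]
  exact h3.le

/-- Fatou's lemma for moments along a weakly convergent sequence. -/
theorem moment_le_of_tendsto {ν : ℕ → ProbabilityMeasure ℝ} {ν₀ : ProbabilityMeasure ℝ}
    (hν : Tendsto ν atTop (𝓝 ν₀)) {p B : ℝ} (hp : 0 ≤ p)
    (hi : ∀ i, Integrable (fun x => |x| ^ p) (ν i : Measure ℝ) ∧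
      ∫ x, |x| ^ p ∂(ν i : Measure ℝ) ≤ B) :
    Integrable (fun x => |x| ^ p) (ν₀ : Measure ℝ) ∧ ∫ x, |x| ^ p ∂(ν₀ : Measure ℝ) ≤ B := by
  have hc : Continuous fun x : ℝ => |x| ^ p := continuous_abs.rpow_const fun x => Or.inr hp
  have hB0 : 0 ≤ B := le_trans (integral_nonneg fun x => by positivity) (hi 0).2
  have h1 : ∫⁻ x, ENNReal.ofReal (|x| ^ p) ∂(ν₀ : Measure ℝ) ≤ ENNReal.ofReal B := by
    refine (lintegral_le_liminf_lintegral_of_forall_isOpen_measure_le_liminf_measure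
      (μs := fun i => (ν i : Measure ℝ)) hc (fun x => by positivity) fun G hG =>
      ProbabilityMeasure.le_liminf_measure_open_of_tendsto hν hG).trans ?_
    refine liminf_le_of_le (by isBoundedDefault) fun b hb => ?_
    obtain ⟨i, h⟩ := hb.exists
    refine h.trans ?_
    rw [← ofReal_integral_eq_lintegral_ofReal (hi i).1 (Eventually.of_forall fun x => by positivity)]
    exact ENNReal.ofReal_le_ofReal (hi i).2
  have h2 : Integrable (fun x => |x| ^ p) (ν₀ : Measure ℝ) := by
    refine ⟨hc.aestronglyMeasurable, ?_⟩
    rw [hasFiniteIntegral_iff_ofReal (Eventually.of_forall fun x => by positivity)]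
    exact h1.trans_lt ENNReal.ofReal_lt_top
  refine ⟨h2, ?_⟩
  rw [← ofReal_integral_eq_lintegral_ofReal h2 (Eventually.of_forall fun x => by positivity)] at h1
  exact (ENNReal.ofReal_le_ofReal_iff hB0).1 h1

/-! ### Pointwise estimates for a single trade -/

theorem postTrade_eq (γ w v η : ℝ) : postTrade γ w v η = w + (γ * (v - w) + η * w) := by
  unfold postTrade; ring

/-- If `γ ≤ 1 / 4` and `|η| < 1 / 2`, the coefficient `1 - γ + η` of `w` is positive. -/
theorem postTrade_nonneg {γ w v η : ℝ} (hγ : 0 ≤ γ) (hγ' : γ ≤ 1 / 4) (hw : 0 ≤ w) (hv : 0 ≤ v)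
    (hη : |η| < 1 / 2) : 0 ≤ postTrade γ w v η := by
  have := abs_lt.1 hη
  unfold postTrade
  nlinarith [mul_nonneg hγ hv]

/-- A trade either takes place, or one of the two returns is at least `1 / 2` in modulus. -/
theorem noDebt_cases {γ w v : ℝ} (hγ : 0 ≤ γ) (hγ' : γ ≤ 1 / 4) (hw : 0 ≤ w) (hv : 0 ≤ v)
    (η ζ : ℝ) : (noDebt γ w v η ζ = 1 ∧ 0 ≤ postTrade γ w v η) ∨
      (noDebt γ w v η ζ = 0 ∧ (1 / 2 ≤ |η| ∨ 1 / 2 ≤ |ζ|)) := by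
  by_cases h : 0 ≤ postTrade γ w v η ∧ 0 ≤ postTrade γ v w ζ
  · exact Or.inl ⟨if_pos h, h.1⟩
  · refine Or.inr ⟨if_neg h, ?_⟩
    by_contra hc
    push Not at hc
    exact h ⟨postTrade_nonneg hγ hγ' hw hv hc.1, postTrade_nonneg hγ hγ' hv hw hc.2⟩

theorem measurable_noDebt (γ : ℝ) : Measurable fun x : (ℝ × ℝ) × (ℝ × ℝ) =>
    noDebt γ x.1.1 x.1.2 x.2.1 x.2.2 := by
  unfold noDebt postTrade
  refine Measurable.ite ?_ measurable_const measurable_const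
  exact (measurableSet_le measurable_const (by fun_prop :
      Measurable fun x : (ℝ × ℝ) × (ℝ × ℝ) => (1 - γ) * x.1.1 + γ * x.1.2 + x.2.1 * x.1.1)).inter
    (measurableSet_le measurable_const (by fun_prop :
      Measurable fun x : (ℝ × ℝ) × (ℝ × ℝ) => (1 - γ) * x.1.2 + γ * x.1.1 + x.2.2 * x.1.2))

theorem noDebt_nonneg (γ w v η ζ : ℝ) : 0 ≤ noDebt γ w v η ζ := by
  unfold noDebt; split_ifs <;> norm_num

theorem noDebt_le_one (γ w v η ζ : ℝ) : noDebt γ w v η ζ ≤ 1 := by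
  unfold noDebt; split_ifs <;> norm_num

theorem one_le_two_rpow_mul {y r : ℝ} (hr : 0 ≤ r) (hy : 1 / 2 ≤ |y|) : 1 ≤ 2 ^ r * |y| ^ r := by
  rw [← Real.mul_rpow (by norm_num) (abs_nonneg y)]
  exact Real.one_le_rpow (by linarith) hr

theorem abs_increment_le {γ w v η : ℝ} (hγ : 0 ≤ γ) (hw : 0 ≤ w) (hv : 0 ≤ v) :
    |γ * (v - w) + η * w| ≤ (w + v) * (γ + |η|) := by
  have h1 : |v - w| ≤ w + v := abs_le.2 ⟨by linarith, by linarith⟩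
  calc |γ * (v - w) + η * w| ≤ |γ * (v - w)| + |η * w| := abs_add_le _ _
    _ = γ * |v - w| + |η| * w := by rw [abs_mul, abs_mul, abs_of_nonneg hγ, abs_of_nonneg hw]
    _ ≤ γ * (w + v) + |η| * (w + v) := by gcongr; linarith
    _ = _ := by ring

/-- Taylor's formula of second order for a function whose second derivative is Hölder continuous of
order `κ`. -/
theorem IsNice.abs_taylor_two_le {φ : ℝ → ℝ} (h : IsNice φ) {B κ : ℝ} (hκ : 0 ≤ κ)
    (hB : ∀ x y, |deriv (deriv φ) x - deriv (deriv φ) y| ≤ B * |x - y| ^ κ) (hB0 : 0 ≤ B)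
    (w x : ℝ) :
    |φ (w + x) - φ w - deriv φ w * x - 1 / 2 * deriv (deriv φ) w * x ^ 2| ≤
      B * |x| ^ κ * x ^ 2 := by
  have hsq : ∀ z, HasDerivAt (fun z => 1 / 2 * deriv (deriv φ) w * (z - w) ^ 2)
      (deriv (deriv φ) w * (z - w)) z := fun z => by
    have := (((hasDerivAt_id z).sub_const w).pow 2).const_mul (1 / 2 * deriv (deriv φ) w)
    refine this.congr_deriv ?_
    simp; ring
  have hln : ∀ z, HasDerivAt (fun z => deriv (deriv φ) w * (z - w)) (deriv (deriv φ) w) z :=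
    fun z => (((hasDerivAt_id z).sub_const w).const_mul _).congr_deriv (mul_one _)
  have := abs_taylor_one_le (x := w) (y := w + x) (B := B * |x| ^ κ)
    (fun z => (h.hasDerivAt z).sub (hsq z)) (fun z => (h.hasDerivAt_deriv z).sub (hln z))
    (fun z hz => (hB z w).trans (by
      have := abs_sub_left_of_mem_uIcc hz
      rw [add_sub_cancel_left] at this
      gcongr))
  refine (le_of_eq ?_).trans (this.trans (le_of_eq ?_))
  · simp only [Pi.sub_apply]; congr 1; ring
  · ring

/-- One trade changes a nice function by its second order Taylor polynomial in the return, up to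
an error that is of higher order in `(γ, η, ζ)`; this includes the effect of the trades that are
ruled out by the no-debt condition. -/
theorem IsNice.abs_trade_sub_le {φ : ℝ → ℝ} (h : IsNice φ) {q : ℝ} (hq : 2 < q) (hq3 : q ≤ 3) :
    ∃ C : ℝ, 0 ≤ C ∧ ∀ γ w v η ζ : ℝ, 0 ≤ γ → γ ≤ 1 / 4 → 0 ≤ w → 0 ≤ v →
      |noDebt γ w v η ζ * (φ (postTrade γ w v η) - φ w) -
        (γ * (deriv φ w * (v - w)) + deriv φ w * w * η
          + 1 / 2 * (deriv (deriv φ) w * w ^ 2) * η ^ 2)| ≤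
      C * ((1 + w + v) ^ q * (γ ^ 2 + γ * |η| + |η| ^ q + |ζ| ^ q)) := by
  obtain ⟨B, hB0, hB1, hB2, -, hBh⟩ := h.exists_bounds
  refine ⟨B * (4 * 2 ^ q), by positivity, fun γ w v η ζ hγ hγ' hw hv => ?_⟩
  set s := 1 + w + v with hs
  have hs1 : 1 ≤ s := by linarith
  have hsq : s ^ 2 ≤ s ^ q := by
    have := Real.rpow_le_rpow_of_exponent_le hs1 hq.le
    rwa [Real.rpow_two] at this
  have h2q : (4 : ℝ) ≤ 2 ^ q := by
    have := Real.rpow_le_rpow_of_exponent_le (show (1 : ℝ) ≤ 2 by norm_num) hq.le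
    rw [Real.rpow_two] at this; linarith
  have hηq : 0 ≤ |η| ^ q := by positivity
  have hζq : 0 ≤ |ζ| ^ q := by positivity
  have hγη : 0 ≤ γ * |η| := by positivity
  have hws : w ≤ s := by linarith
  have hvw : |v - w| ≤ s := abs_le.2 ⟨by linarith, by linarith⟩
  have hx := abs_increment_le (η := η) hγ hw hv
  rcases noDebt_cases hγ hγ' hw hv η ζ with ⟨h1, -⟩ | ⟨h0, hlarge⟩
  · rw [h1, one_mul, postTrade_eq]
    set x := γ * (v - w) + η * w with hxdef
    have hT := h.abs_taylor_two_le (κ := q - 2) (by linarith) (hBh _ (by linarith) (by linarith))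
      hB0 w x
    have hxq : |x| ^ (q - 2) * x ^ 2 ≤ s ^ q * (2 ^ q * (γ ^ 2 + |η| ^ q)) := by
      have e1 : |x| ^ (q - 2) * x ^ 2 = |x| ^ q := by
        rw [← sq_abs, ← Real.rpow_two, ← Real.rpow_add' (abs_nonneg x) (by linarith)]
        congr 1; ring
      have e2 : |x| ≤ s * (γ + |η|) := hx.trans (by gcongr; linarith)
      have e3 : γ ^ q ≤ γ ^ 2 := by
        have := Real.rpow_le_rpow_of_exponent_ge_of_imp hγ (by linarith : γ ≤ 1) hq.le
          (fun _ h => by linarith)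
        rwa [Real.rpow_two] at this
      rw [e1]
      calc |x| ^ q ≤ (s * (γ + |η|)) ^ q := Real.rpow_le_rpow (abs_nonneg _) e2 (by linarith)
        _ = s ^ q * (γ + |η|) ^ q := Real.mul_rpow (by linarith) (by positivity)
        _ ≤ s ^ q * (2 ^ q * (γ ^ q + |η| ^ q)) := by
          gcongr
          exact add_rpow_le_two_rpow_mul hγ (abs_nonneg _) (by linarith)
        _ ≤ _ := by gcongr
    have hmix : |1 / 2 * deriv (deriv φ) w * (x ^ 2 - w ^ 2 * η ^ 2)| ≤
        B * (s ^ q * (γ ^ 2 + γ * |η|)) := by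
      have e1 : x ^ 2 - w ^ 2 * η ^ 2 = γ ^ 2 * (v - w) ^ 2 + 2 * γ * (v - w) * w * η := by
        rw [hxdef]; ring
      have e2 : |x ^ 2 - w ^ 2 * η ^ 2| ≤ 2 * (s ^ 2 * (γ ^ 2 + γ * |η|)) := by
        rw [e1]
        calc |γ ^ 2 * (v - w) ^ 2 + 2 * γ * (v - w) * w * η|
            ≤ |γ ^ 2 * (v - w) ^ 2| + |2 * γ * (v - w) * w * η| := abs_add_le _ _
          _ = γ ^ 2 * |v - w| ^ 2 + 2 * γ * |v - w| * w * |η| := by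
            simp only [abs_mul, abs_pow, abs_of_nonneg hγ, abs_of_nonneg hw, abs_two]
          _ ≤ γ ^ 2 * s ^ 2 + 2 * γ * s * s * |η| := by gcongr
          _ ≤ _ := by nlinarith [mul_nonneg (sq_nonneg γ) (sq_nonneg s)]
      rw [abs_mul, abs_mul, abs_of_pos (by norm_num : (0 : ℝ) < 1 / 2)]
      calc 1 / 2 * |deriv (deriv φ) w| * |x ^ 2 - w ^ 2 * η ^ 2|
          ≤ 1 / 2 * B * (2 * (s ^ 2 * (γ ^ 2 + γ * |η|))) := by
            gcongr
            exact hB2 w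
        _ = B * (s ^ 2 * (γ ^ 2 + γ * |η|)) := by ring
        _ ≤ _ := by gcongr
    have hdec : φ (w + x) - φ w - (γ * (deriv φ w * (v - w)) + deriv φ w * w * η
          + 1 / 2 * (deriv (deriv φ) w * w ^ 2) * η ^ 2) =
        (φ (w + x) - φ w - deriv φ w * x - 1 / 2 * deriv (deriv φ) w * x ^ 2) +
          1 / 2 * deriv (deriv φ) w * (x ^ 2 - w ^ 2 * η ^ 2) := by
      rw [hxdef]; ring
    rw [hdec]
    refine (abs_add_le _ _).trans ((add_le_add hT hmix).trans ?_)
    have hsq0 : 0 ≤ s ^ q := by positivity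
    calc B * |x| ^ (q - 2) * x ^ 2 + B * (s ^ q * (γ ^ 2 + γ * |η|))
        = B * (|x| ^ (q - 2) * x ^ 2) + B * (s ^ q * (γ ^ 2 + γ * |η|)) := by ring
      _ ≤ B * (s ^ q * (2 ^ q * (γ ^ 2 + |η| ^ q))) + B * (s ^ q * (γ ^ 2 + γ * |η|)) := by gcongr
      _ = B * (s ^ q * (2 ^ q * (γ ^ 2 + |η| ^ q) + (γ ^ 2 + γ * |η|))) := by ring
      _ ≤ B * (s ^ q * (4 * 2 ^ q * (γ ^ 2 + γ * |η| + |η| ^ q + |ζ| ^ q))) := by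
        gcongr
        have e1 := mul_le_mul_of_nonneg_right h2q (sq_nonneg γ)
        have e2 := mul_le_mul_of_nonneg_right h2q hγη
        have e3 := mul_le_mul_of_nonneg_right h2q hηq
        have e4 := mul_le_mul_of_nonneg_right h2q hζq
        linarith [sq_nonneg γ]
      _ = _ := by ring
  -- an excluded trade: some return is at least `1 / 2`, so the Taylor polynomial itself is an error
  · rw [h0, zero_mul, zero_sub, abs_neg]
    have hpoly : γ + |η| + η ^ 2 ≤ 3 * 2 ^ q * (|η| ^ q + |ζ| ^ q) := by
      have e3 := mul_nonneg (by linarith : (0 : ℝ) ≤ 2 ^ q) hζq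
      have e4 := mul_nonneg (by linarith : (0 : ℝ) ≤ 2 ^ q) hηq
      by_cases hη : 1 / 2 ≤ |η|
      · have e1 : (2 * |η|) ^ (2 : ℕ) ≤ 2 ^ q * |η| ^ q := by
          rw [← Real.mul_rpow (by norm_num) (abs_nonneg η), ← Real.rpow_two]
          exact Real.rpow_le_rpow_of_exponent_le (by linarith) hq.le
        rw [mul_pow, sq_abs] at e1
        have e2 : |η| ≤ 2 * η ^ 2 := by nlinarith [sq_abs η]
        linarith
      · have e1 := one_le_two_rpow_mul (show 0 ≤ q by linarith) (hlarge.resolve_left hη)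
        have e2 : |η| ≤ 1 / 2 := (not_le.1 hη).le
        have e5 : η ^ 2 ≤ 1 / 4 := by nlinarith [sq_abs η, abs_nonneg η]
        linarith
    calc |γ * (deriv φ w * (v - w)) + deriv φ w * w * η
          + 1 / 2 * (deriv (deriv φ) w * w ^ 2) * η ^ 2|
        ≤ |γ * (deriv φ w * (v - w))| + |deriv φ w * w * η|
          + |1 / 2 * (deriv (deriv φ) w * w ^ 2) * η ^ 2| := abs_add_three _ _ _
      _ = γ * (|deriv φ w| * |v - w|) + |deriv φ w| * w * |η|
          + 1 / 2 * (|deriv (deriv φ) w| * w ^ 2) * η ^ 2 := by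
        simp only [abs_mul, abs_pow, abs_of_nonneg hγ, abs_of_nonneg hw, sq_abs,
          abs_of_pos (by norm_num : (0 : ℝ) < 1 / 2)]
      _ ≤ γ * (B * s ^ 2) + B * s ^ 2 * |η| + 1 * (B * s ^ 2) * η ^ 2 := by
        have := hB1 w
        have := hB2 w
        have hss : s ≤ s ^ 2 := by nlinarith
        gcongr
        · exact hvw.trans hss
        · exact hws.trans hss
        · norm_num
      _ = B * (s ^ 2 * (γ + |η| + η ^ 2)) := by ring
      _ ≤ B * (s ^ q * (3 * 2 ^ q * (|η| ^ q + |ζ| ^ q))) := by gcongr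
      _ ≤ B * (s ^ q * (4 * 2 ^ q * (γ ^ 2 + γ * |η| + |η| ^ q + |ζ| ^ q))) := by
        refine mul_le_mul_of_nonneg_left (mul_le_mul_of_nonneg_left ?_ (by positivity)) hB0
        have e1 : 0 ≤ 2 ^ q * (|η| ^ q + |ζ| ^ q) := by positivity
        have e2 : 0 ≤ 4 * 2 ^ q * (γ ^ 2 + γ * |η|) := by positivity
        linarith
      _ = _ := by ring

/-- Bound for the remainder in the first order expansion of `w ^ p` along a trade, divided by
`(w + v) ^ p`; here `y` stands for the modulus of the return. -/
theorem two_add_rpow_mul_le {p γ y : ℝ} (hp : 2 < p) (hγ : 0 ≤ γ) (hγ' : γ ≤ 1) (hy : 0 ≤ y) :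
    (2 + y) ^ (p - 2) * (2 * (γ ^ 2 + y ^ 2)) ≤ 3 ^ (p - 2) * 4 * (γ + y ^ 2 + y ^ p) := by
  have h3 : (0 : ℝ) ≤ 3 ^ (p - 2) := by positivity
  have hyp : 0 ≤ y ^ p := by positivity
  rcases le_total y 1 with h | h
  · have e1 : (2 + y) ^ (p - 2) ≤ 3 ^ (p - 2) :=
      Real.rpow_le_rpow (by positivity) (by linarith) (by linarith)
    have e2 : 2 * (γ ^ 2 + y ^ 2) ≤ 4 * (γ + y ^ 2 + y ^ p) := by nlinarith [sq_nonneg y]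
    rw [mul_assoc]
    exact mul_le_mul e1 e2 (by positivity) h3
  · have e4 : (2 + y) ^ (p - 2) ≤ 3 ^ (p - 2) * y ^ (p - 2) := by
      rw [← Real.mul_rpow (by norm_num) hy]
      exact Real.rpow_le_rpow (by positivity) (by linarith) (by linarith)
    have e5 : y ^ (p - 2) * y ^ 2 = y ^ p := by
      rw [← Real.rpow_two, ← Real.rpow_add' hy (by linarith)]
      congr 1; ring
    have e6 : 2 * (γ ^ 2 + y ^ 2) ≤ 4 * y ^ 2 := by nlinarith
    calc (2 + y) ^ (p - 2) * (2 * (γ ^ 2 + y ^ 2))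
        ≤ 3 ^ (p - 2) * y ^ (p - 2) * (4 * y ^ 2) := mul_le_mul e4 e6 (by positivity) (by positivity)
      _ = 3 ^ (p - 2) * 4 * (y ^ (p - 2) * y ^ 2) := by ring
      _ = 3 ^ (p - 2) * 4 * y ^ p := by rw [e5]
      _ ≤ _ := by
        refine mul_le_mul_of_nonneg_left ?_ (by positivity)
        linarith [sq_nonneg y]

/-- The gain of the moment of order `p` in one trade. -/
theorem trade_rpow_sub_le {p : ℝ} (hp : 2 < p) :
    ∃ C : ℝ, 0 ≤ C ∧ ∀ γ w v η ζ : ℝ, 0 ≤ γ → γ ≤ 1 / 4 → 0 ≤ w → 0 ≤ v →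
      noDebt γ w v η ζ * (postTrade γ w v η ^ p - w ^ p) ≤
        p * w ^ p * η + C * ((w + v) ^ p * (γ + η ^ 2 + ζ ^ 2 + |η| ^ p)) := by
  refine ⟨p + p * (p - 1) * (3 ^ (p - 2) * 4) + 2 * p, by
    have : 0 < p - 1 := by linarith
    positivity, fun γ w v η ζ hγ hγ' hw hv => ?_⟩
  set S := w + v with hS
  have hS0 : 0 ≤ S := by positivity
  have hSp : 0 ≤ S ^ p := Real.rpow_nonneg hS0 _
  have hwS : w ^ p ≤ S ^ p := Real.rpow_le_rpow hw (by linarith) (by linarith)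
  have hwp : 0 ≤ w ^ p := Real.rpow_nonneg hw _
  have hηp : 0 ≤ |η| ^ p := by positivity
  have hp0 : 0 ≤ p * (p - 1) * (3 ^ (p - 2) * 4) := by
    have : 0 < p - 1 := by linarith
    positivity
  have hx := abs_increment_le (η := η) hγ hw hv
  rcases noDebt_cases hγ hγ' hw hv η ζ with ⟨h1, hpos⟩ | ⟨h0, hlarge⟩
  · rw [h1, one_mul]
    rw [postTrade_eq] at hpos ⊢
    set x := γ * (v - w) + η * w with hxdef
    have hT := abs_taylor_one_le (f := fun z => z ^ p) (f' := fun z => p * z ^ (p - 1))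
      (f'' := fun z => p * ((p - 1) * z ^ (p - 1 - 1))) (x := w) (y := w + x)
      (B := p * ((p - 1) * (S * (2 + |η|)) ^ (p - 2)))
      (fun z => Real.hasDerivAt_rpow_const (Or.inr (by linarith)))
      (fun z => (Real.hasDerivAt_rpow_const (Or.inr (by linarith))).const_mul p)
      (fun z hz => by
        have hz0 : 0 ≤ z := (le_min hw hpos).trans hz.1
        have hz1 : z ≤ S * (2 + |η|) := by
          refine hz.2.trans (max_le ?_ ?_)
          · nlinarith [abs_nonneg η]
          · have := le_abs_self x
            nlinarith [abs_nonneg η]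
        rw [show p - 1 - 1 = p - 2 by ring, abs_of_nonneg (by
          have := Real.rpow_nonneg hz0 (p - 2)
          have : 0 < p - 1 := by linarith
          positivity)]
        have := Real.rpow_le_rpow hz0 hz1 (show 0 ≤ p - 2 by linarith)
        have : 0 ≤ p - 1 := by linarith
        gcongr)
    have hT' := (abs_le.1 hT).2
    simp only [add_sub_cancel_left] at hT'
    have hlin : p * w ^ (p - 1) * x ≤ p * w ^ p * η + p * (γ * S ^ p) := by
      have e1 : w ^ (p - 1) * w = w ^ p := by
        rw [← Real.rpow_add_one' hw (by linarith)]; congr 1; ring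
      have e2 : w ^ (p - 1) * (v - w) ≤ S ^ p := by
        have e3 : S ^ (p - 1) * S = S ^ p := by
          rw [← Real.rpow_add_one' hS0 (by linarith)]; congr 1; ring
        rw [← e3]
        have e4 : w ^ (p - 1) ≤ S ^ (p - 1) := Real.rpow_le_rpow hw (by linarith) (by linarith)
        calc w ^ (p - 1) * (v - w) ≤ w ^ (p - 1) * S :=
              mul_le_mul_of_nonneg_left (by linarith) (Real.rpow_nonneg hw _)
          _ ≤ _ := by gcongr
      have e5 : p * w ^ (p - 1) * x = p * (w ^ (p - 1) * w) * η +
          p * (γ * (w ^ (p - 1) * (v - w))) := by rw [hxdef]; ring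
      rw [e5, e1]
      gcongr
    have hquad : (S * (2 + |η|)) ^ (p - 2) * x ^ 2 ≤
        S ^ p * (3 ^ (p - 2) * 4 * (γ + η ^ 2 + |η| ^ p)) := by
      have e1 : x ^ 2 ≤ S ^ 2 * (2 * (γ ^ 2 + η ^ 2)) := by
        have : x ^ 2 ≤ (S * (γ + |η|)) ^ 2 := sq_le_sq' (by
          have := (abs_le.1 hx).1; linarith) ((le_abs_self x).trans hx)
        refine this.trans ?_
        rw [mul_pow]
        gcongr
        nlinarith [sq_nonneg (γ - |η|), sq_abs η]
      have e2 : S ^ (p - 2) * S ^ 2 = S ^ p := by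
        rw [← Real.rpow_two, ← Real.rpow_add' hS0 (by linarith)]; congr 1; ring
      have e3 := two_add_rpow_mul_le hp hγ (by linarith) (abs_nonneg η)
      rw [sq_abs] at e3
      calc (S * (2 + |η|)) ^ (p - 2) * x ^ 2
          ≤ (S * (2 + |η|)) ^ (p - 2) * (S ^ 2 * (2 * (γ ^ 2 + η ^ 2))) := by gcongr
        _ = (S ^ (p - 2) * S ^ 2) * ((2 + |η|) ^ (p - 2) * (2 * (γ ^ 2 + η ^ 2))) := by
          rw [Real.mul_rpow hS0 (by positivity)]; ring
        _ ≤ _ := by rw [e2]; exact mul_le_mul_of_nonneg_left e3 hSp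
    have hpp : 0 ≤ p * (p - 1) := by nlinarith
    have hquad' := mul_le_mul_of_nonneg_left hquad hpp
    have hc1 : 0 ≤ S ^ p * (γ + η ^ 2 + ζ ^ 2 + |η| ^ p) := by positivity
    have hc2 : S ^ p * (γ + η ^ 2 + |η| ^ p) ≤ S ^ p * (γ + η ^ 2 + ζ ^ 2 + |η| ^ p) := by
      refine mul_le_mul_of_nonneg_left ?_ hSp
      linarith [sq_nonneg ζ]
    have hc3 : γ * S ^ p ≤ S ^ p * (γ + η ^ 2 + ζ ^ 2 + |η| ^ p) := by
      rw [mul_comm]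
      refine mul_le_mul_of_nonneg_left ?_ hSp
      linarith [sq_nonneg ζ, sq_nonneg η]
    have hc4 := mul_le_mul_of_nonneg_left hc2 hp0
    have hc5 := mul_le_mul_of_nonneg_left hc3 (show 0 ≤ p by linarith)
    have hc6 : 0 ≤ 2 * p * (S ^ p * (γ + η ^ 2 + ζ ^ 2 + |η| ^ p)) := by positivity
    linarith
  · rw [h0, zero_mul]
    have e1 : |η| ≤ 2 * (γ + η ^ 2 + ζ ^ 2 + |η| ^ p) := by
      by_cases hη : 1 / 2 ≤ |η|
      · nlinarith [sq_abs η, sq_nonneg ζ]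
      · nlinarith [sq_abs ζ, sq_nonneg η, hlarge.resolve_left hη]
    have e2 : 0 ≤ γ + η ^ 2 + ζ ^ 2 + |η| ^ p := by positivity
    have e3 : -(p * S ^ p * |η|) ≤ p * w ^ p * η := by
      have : |p * w ^ p * η| ≤ p * S ^ p * |η| := by
        rw [abs_mul, abs_of_nonneg (by positivity)]
        gcongr
      exact (abs_le.1 this).1
    have e4 : p * S ^ p * |η| ≤ 2 * p * (S ^ p * (γ + η ^ 2 + ζ ^ 2 + |η| ^ p)) := by
      calc p * S ^ p * |η| ≤ p * S ^ p * (2 * (γ + η ^ 2 + ζ ^ 2 + |η| ^ p)) := by gcongr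
        _ = _ := by ring
    have e5 : 0 ≤ (p + p * (p - 1) * (3 ^ (p - 2) * 4)) *
        (S ^ p * (γ + η ^ 2 + ζ ^ 2 + |η| ^ p)) := by positivity
    linarith

/-- Loss and gain of a bump function in one trade; returns of modulus at least `1 / 2` are
estimated crudely. -/
theorem IsBump.trade_sub_le {φ : ℝ → ℝ} (h : IsBump φ) {γ w v : ℝ} (hγ : 0 ≤ γ)
    (hγ' : γ ≤ 1 / 4) (hw : 0 ≤ w) (hv : 0 ≤ v) {q : ℝ} (hq : 0 ≤ q) (η ζ : ℝ) :
    noDebt γ w v η ζ * (φ (postTrade γ w v η) - φ w) ≤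
      (if |η| < 1 / 2 then φ (postTrade γ w v η) else 0) - φ w
        + 2 ^ q * (2 * |η| ^ q + |ζ| ^ q) := by
  have hη : 0 ≤ 2 ^ q * |η| ^ q := by positivity
  have hζ : 0 ≤ 2 ^ q * |ζ| ^ q := by positivity
  have h1 := h.mem_Icc (postTrade γ w v η)
  have h2 := h.mem_Icc w
  rcases noDebt_cases hγ hγ' hw hv η ζ with ⟨h3, -⟩ | ⟨h3, h4⟩
  · rw [h3]
    split_ifs with h5
    · linarith
    · have := one_le_two_rpow_mul hq (not_lt.1 h5)
      linarith [h1.2]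
  · rw [h3]
    have h6 : 1 ≤ 2 ^ q * |η| ^ q + 2 ^ q * |ζ| ^ q := by
      rcases h4 with h4 | h4
      · linarith [one_le_two_rpow_mul hq h4]
      · linarith [one_le_two_rpow_mul hq h4]
    split_ifs with h5 <;> linarith [h1.1, h2.2]

/-! ### Estimates for the collision operator -/

theorem integrable_abs_rpow_of_le {μ : Measure ℝ} [IsFiniteMeasure μ] {p r : ℝ} (hr : 0 ≤ r)
    (hrp : r ≤ p) (h : Integrable (fun x => |x| ^ p) μ) : Integrable (fun x => |x| ^ r) μ := by
  refine ((integrable_const (1 : ℝ)).add h).mono'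
    (continuous_abs.rpow_const fun x => Or.inr hr).aestronglyMeasurable
    (Eventually.of_forall fun x => ?_)
  rw [Real.norm_eq_abs, abs_of_nonneg (by positivity)]
  exact rpow_le_one_add_rpow (abs_nonneg x) hr hrp

theorem integrable_id_of_moment {μ : Measure ℝ} [IsFiniteMeasure μ] {p : ℝ} (hp : 1 ≤ p)
    (h : Integrable (fun x => |x| ^ p) μ) : Integrable (fun x : ℝ => x) μ := by
  have := integrable_abs_rpow_of_le zero_le_one hp h
  simp only [Real.rpow_one] at this
  exact (integrable_norm_iff continuous_id.aestronglyMeasurable).1 this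

theorem integrable_sq_of_moment {μ : Measure ℝ} [IsFiniteMeasure μ] {p : ℝ} (hp : 2 ≤ p)
    (h : Integrable (fun x => |x| ^ p) μ) : Integrable (fun x : ℝ => x ^ 2) μ := by
  have := integrable_abs_rpow_of_le zero_le_two hp h
  simpa only [Real.rpow_two, sq_abs] using this

theorem ae_nonneg_of_measure_Iio {f : Measure ℝ} (h : f (Iio 0) = 0) : ∀ᵐ w ∂f, 0 ≤ w := by
  rw [ae_iff]
  simpa [Iio_def] using h

theorem ae_nonneg_collision {f μ : Measure ℝ} [IsProbabilityMeasure f] [IsProbabilityMeasure μ]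
    (h : f (Iio 0) = 0) :
    ∀ᵐ x : (ℝ × ℝ) × (ℝ × ℝ) ∂((f.prod f).prod (μ.prod μ)), 0 ≤ x.1.1 ∧ 0 ≤ x.1.2 := by
  have h0 := ae_nonneg_of_measure_Iio h
  have h1 : ∀ᵐ y : ℝ × ℝ ∂(f.prod f), 0 ≤ y.1 ∧ 0 ≤ y.2 :=
    (Measure.quasiMeasurePreserving_fst.ae h0).and (Measure.quasiMeasurePreserving_snd.ae h0)
  exact Measure.quasiMeasurePreserving_fst.ae h1

theorem integrable_one_add_moments {f : Measure ℝ} [IsProbabilityMeasure f] {p : ℝ}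
    (hf : Integrable (fun x => |x| ^ p) f) :
    Integrable (fun y : ℝ × ℝ => 1 + |y.1| ^ p + |y.2| ^ p) (f.prod f) :=
  ((integrable_const (1 : ℝ)).add (hf.comp_fst f)).add (hf.comp_snd f)

theorem integral_one_add_moments {f : Measure ℝ} [IsProbabilityMeasure f] {p : ℝ}
    (hf : Integrable (fun x => |x| ^ p) f) :
    ∫ y : ℝ × ℝ, (1 + |y.1| ^ p + |y.2| ^ p) ∂(f.prod f) = 1 + 2 * ∫ x, |x| ^ p ∂f := by
  rw [integral_add ((integrable_const (1 : ℝ)).fun_add (hf.comp_fst f)) (hf.comp_snd f),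
    integral_add (integrable_const (1 : ℝ)) (hf.comp_fst f),
    integral_fun_fst (fun x => |x| ^ p), integral_fun_snd (fun x => |x| ^ p)]
  simp
  ring

theorem one_add_add_rpow_le {w v q p : ℝ} (hw : 0 ≤ w) (hv : 0 ≤ v) (hp : 0 ≤ p) (hqp : q ≤ p) :
    (1 + w + v) ^ q ≤ 4 ^ p * (1 + |w| ^ p + |v| ^ p) := by
  rw [abs_of_nonneg hw, abs_of_nonneg hv]
  have h2 : (1 : ℝ) ≤ 2 ^ p := Real.one_le_rpow (by norm_num) hp
  have hvp := Real.rpow_nonneg hv p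
  calc (1 + w + v) ^ q ≤ (1 + w + v) ^ p := Real.rpow_le_rpow_of_exponent_le (by linarith) hqp
    _ ≤ 2 ^ p * ((1 + w) ^ p + v ^ p) := add_rpow_le_two_rpow_mul (by positivity) hv hp
    _ ≤ 2 ^ p * (2 ^ p * (1 ^ p + w ^ p) + 2 ^ p * v ^ p) := by
      gcongr
      · exact add_rpow_le_two_rpow_mul zero_le_one hw hp
      · exact le_mul_of_one_le_left hvp h2
    _ = 4 ^ p * (1 + w ^ p + v ^ p) := by
      rw [Real.one_rpow, show (4 : ℝ) = 2 * 2 by norm_num,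
        Real.mul_rpow (by norm_num) (by norm_num)]
      ring

section

variable {f μ : Measure ℝ} [IsProbabilityMeasure f] [IsProbabilityMeasure μ]

theorem integral_fst_return (u : ℝ → ℝ) : ∫ y : ℝ × ℝ, u y.1 ∂(μ.prod μ) = ∫ x, u x ∂μ := by
  rw [integral_fun_fst u]; simp

theorem integral_snd_return (u : ℝ → ℝ) : ∫ y : ℝ × ℝ, u y.2 ∂(μ.prod μ) = ∫ x, u x ∂μ := by
  rw [integral_fun_snd u]; simp

/-- Consistency of the collision operator with the Fokker-Planck operator, on nice functions. The
drift involves the mean of `f` itself. -/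
theorem IsNice.abs_boltzmannWeak_sub_le {φ : ℝ → ℝ} (h : IsNice φ) {p q : ℝ} (hq : 2 < q)
    (hq3 : q ≤ 3) (hqp : q ≤ p) :
    ∃ C : ℝ, 0 ≤ C ∧ ∀ (f μ : Measure ℝ) [IsProbabilityMeasure f] [IsProbabilityMeasure μ] (γ : ℝ),
      0 ≤ γ → γ ≤ 1 / 4 → f (Iio 0) = 0 → Integrable (fun x => |x| ^ p) f →
      Integrable (fun x => |x| ^ p) μ → ∫ x, x ∂μ = 0 →
      |boltzmannWeak γ μ f φ - (γ * ((∫ w, w ∂f) * ∫ w, deriv φ w ∂f - ∫ w, w * deriv φ w ∂f)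
        + 1 / 2 * (∫ x, x ^ 2 ∂μ) * ∫ w, w ^ 2 * deriv (deriv φ) w ∂f)| ≤
      C * ((γ ^ 2 + γ * ∫ x, |x| ∂μ + 2 * ∫ x, |x| ^ q ∂μ) * (1 + 2 * ∫ x, |x| ^ p ∂f)) := by
  obtain ⟨C, hC0, hC⟩ := h.abs_trade_sub_le hq hq3
  obtain ⟨B, hB0, hB1, hB2, -, -⟩ := h.exists_bounds
  refine ⟨C * 4 ^ p, by positivity, fun f μ _ _ γ hγ hγ' hf0 hf hμ hμ0 => ?_⟩
  have hc1 : Continuous (deriv φ) := h.smooth_deriv.continuous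
  have hc2 : Continuous (deriv (deriv φ)) := h.smooth_deriv_deriv.continuous
  have hfid := integrable_id_of_moment (by linarith) hf
  have hfsq := integrable_sq_of_moment (by linarith) hf
  have hμid := integrable_id_of_moment (by linarith) hμ
  have hμsq := integrable_sq_of_moment (by linarith) hμ
  have hμq := integrable_abs_rpow_of_le (by linarith) hqp hμ
  have hd1 : Integrable (deriv φ) f := (integrable_const B).mono' hc1.aestronglyMeasurable
    (Eventually.of_forall hB1)
  have hwd1 : Integrable (fun w => w * deriv φ w) f := by
    refine (hfid.abs.const_mul B).mono' (continuous_id.mul hc1).aestronglyMeasurable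
      (Eventually.of_forall fun w => ?_)
    rw [norm_mul, mul_comm]
    exact mul_le_mul_of_nonneg_right (hB1 w) (norm_nonneg _)
  have hwd2 : Integrable (fun w => w ^ 2 * deriv (deriv φ) w) f := by
    refine (hfsq.const_mul B).mono' ((continuous_pow 2).mul hc2).aestronglyMeasurable
      (Eventually.of_forall fun w => ?_)
    rw [norm_mul, mul_comm, norm_pow, Real.norm_eq_abs, Real.norm_eq_abs, sq_abs]
    exact mul_le_mul_of_nonneg_right (hB2 w) (sq_nonneg w)
  -- the three terms of the second order expansion, each a product of a function of the wealths
  -- and a function of the returns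
  have hA1 : Integrable (fun y : ℝ × ℝ => γ * (deriv φ y.1 * (y.2 - y.1))) (f.prod f) := by
    have := ((hd1.mul_prod hfid).sub (hwd1.comp_fst f)).const_mul γ
    refine this.congr (Eventually.of_forall fun y => ?_)
    simp only [Pi.sub_apply]; ring
  have hA2 : Integrable (fun y : ℝ × ℝ => deriv φ y.1 * y.1) (f.prod f) :=
    (hwd1.comp_fst f).congr (Eventually.of_forall fun y => mul_comm _ _)
  have hA3 : Integrable (fun y : ℝ × ℝ => 1 / 2 * (deriv (deriv φ) y.1 * y.1 ^ 2)) (f.prod f) :=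
    ((hwd2.comp_fst f).const_mul (1 / 2)).congr (Eventually.of_forall fun y => by
      simp only; ring)
  have hI1 : ∫ y : ℝ × ℝ, γ * (deriv φ y.1 * (y.2 - y.1)) ∂(f.prod f) =
      γ * ((∫ w, w ∂f) * ∫ w, deriv φ w ∂f - ∫ w, w * deriv φ w ∂f) := by
    rw [integral_const_mul]
    congr 1
    have e1 : ∀ y : ℝ × ℝ, deriv φ y.1 * (y.2 - y.1) = deriv φ y.1 * y.2 - y.1 * deriv φ y.1 :=
      fun y => by ring
    simp_rw [e1]
    rw [integral_sub (hd1.mul_prod hfid) (hwd1.comp_fst f),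
      integral_prod_mul (deriv φ) (fun v => v),
      integral_fst_return (fun w => w * deriv φ w), mul_comm]
  have hI3 : ∫ y : ℝ × ℝ, 1 / 2 * (deriv (deriv φ) y.1 * y.1 ^ 2) ∂(f.prod f) =
      1 / 2 * ∫ w, w ^ 2 * deriv (deriv φ) w ∂f := by
    rw [integral_const_mul, integral_fst_return (fun w => deriv (deriv φ) w * w ^ 2)]
    simp_rw [mul_comm]
  set X := (f.prod f).prod (μ.prod μ) with hX
  have hT1 := hA1.mul_prod (integrable_const (1 : ℝ) (μ := μ.prod μ))
  have hT2 := hA2.mul_prod (hμid.comp_fst μ)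
  have hT3 := hA3.mul_prod (hμsq.comp_fst μ)
  have hE : Integrable (fun y : ℝ × ℝ => γ ^ 2 + γ * |y.1| + |y.1| ^ q + |y.2| ^ q) (μ.prod μ) :=
    (((integrable_const _).add ((hμid.abs.comp_fst μ).const_mul γ)).add (hμq.comp_fst μ)).add
      (hμq.comp_snd μ)
  have hIE : ∫ y : ℝ × ℝ, (γ ^ 2 + γ * |y.1| + |y.1| ^ q + |y.2| ^ q) ∂(μ.prod μ) =
      γ ^ 2 + γ * ∫ x, |x| ∂μ + 2 * ∫ x, |x| ^ q ∂μ := by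
    rw [integral_add (((integrable_const _).fun_add ((hμid.abs.comp_fst μ).const_mul γ)).fun_add
      (hμq.comp_fst μ)) (hμq.comp_snd μ),
      integral_add ((integrable_const _).fun_add ((hμid.abs.comp_fst μ).const_mul γ))
      (hμq.comp_fst μ), integral_add (integrable_const _) ((hμid.abs.comp_fst μ).const_mul γ),
      integral_const_mul, integral_fst_return (fun x => |x|),
      integral_fst_return (fun x => |x| ^ q), integral_snd_return (fun x => |x| ^ q)]
    simp
    ring
  set F : (ℝ × ℝ) × (ℝ × ℝ) → ℝ := fun x =>
    noDebt γ x.1.1 x.1.2 x.2.1 x.2.2 * (φ (postTrade γ x.1.1 x.1.2 x.2.1) - φ x.1.1) with hF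
  set T : (ℝ × ℝ) × (ℝ × ℝ) → ℝ := fun x =>
    γ * (deriv φ x.1.1 * (x.1.2 - x.1.1)) * 1 + deriv φ x.1.1 * x.1.1 * x.2.1
      + 1 / 2 * (deriv (deriv φ) x.1.1 * x.1.1 ^ 2) * x.2.1 ^ 2 with hT
  have hTi : Integrable T X := (hT1.add hT2).add hT3
  have hIT : ∫ x, T x ∂X = γ * ((∫ w, w ∂f) * ∫ w, deriv φ w ∂f - ∫ w, w * deriv φ w ∂f)
        + 1 / 2 * (∫ x, x ^ 2 ∂μ) * ∫ w, w ^ 2 * deriv (deriv φ) w ∂f := by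
    rw [hT, integral_add (hT1.fun_add hT2) hT3, integral_add hT1 hT2,
      integral_prod_mul (fun y : ℝ × ℝ => γ * (deriv φ y.1 * (y.2 - y.1))) (fun _ => (1 : ℝ)),
      integral_prod_mul (fun y : ℝ × ℝ => deriv φ y.1 * y.1) (fun y : ℝ × ℝ => y.1),
      integral_prod_mul (fun y : ℝ × ℝ => 1 / 2 * (deriv (deriv φ) y.1 * y.1 ^ 2))
        (fun y : ℝ × ℝ => y.1 ^ 2), hI1, hI3, integral_fst_return (fun x => x), hμ0,
      integral_fst_return (fun x => x ^ 2)]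
    simp
    ring
  have hFm : AEStronglyMeasurable F X := by
    refine ((measurable_noDebt γ).mul ?_).aestronglyMeasurable
    have hφ := h.continuous.measurable
    unfold postTrade
    fun_prop
  have hG : Integrable (fun x : (ℝ × ℝ) × (ℝ × ℝ) => (C * 4 ^ p) *
      ((1 + |x.1.1| ^ p + |x.1.2| ^ p) * (γ ^ 2 + γ * |x.2.1| + |x.2.1| ^ q + |x.2.2| ^ q))) X :=
    ((integrable_one_add_moments hf).mul_prod hE).const_mul _
  have hbound : ∀ᵐ x ∂X, ‖F x - T x‖ ≤ (C * 4 ^ p) *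
      ((1 + |x.1.1| ^ p + |x.1.2| ^ p) * (γ ^ 2 + γ * |x.2.1| + |x.2.1| ^ q + |x.2.2| ^ q)) := by
    filter_upwards [ae_nonneg_collision (μ := μ) hf0] with x hx
    have h1 := hC γ x.1.1 x.1.2 x.2.1 x.2.2 hγ hγ' hx.1 hx.2
    have h2 := one_add_add_rpow_le (q := q) (p := p) hx.1 hx.2 (by linarith) hqp
    rw [Real.norm_eq_abs, hF, hT]
    simp only [mul_one]
    refine h1.trans ?_
    rw [mul_assoc, ← mul_assoc (4 ^ p)]
    have : 0 ≤ γ ^ 2 + γ * |x.2.1| + |x.2.1| ^ q + |x.2.2| ^ q := by positivity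
    gcongr
  have hFT : Integrable (fun x => F x - T x) X :=
    hG.mono' (hFm.sub hTi.aestronglyMeasurable) hbound
  have hFi : Integrable F X := by
    refine (hFT.add hTi).congr (Eventually.of_forall fun x => ?_)
    simp
  rw [← hIT, show boltzmannWeak γ μ f φ = ∫ x, F x ∂X from rfl, ← integral_sub hFi hTi]
  refine (norm_integral_le_of_norm_le hG hbound).trans (le_of_eq ?_)
  rw [integral_const_mul, integral_prod_mul (fun y : ℝ × ℝ => 1 + |y.1| ^ p + |y.2| ^ p)
    (fun y : ℝ × ℝ => γ ^ 2 + γ * |y.1| + |y.1| ^ q + |y.2| ^ q), integral_one_add_moments hf, hIE]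
  ring

/-- The collision operator increases the moment of order `p` at a rate proportional to the
moment itself. -/
theorem boltzmannWeak_rpow_le {p : ℝ} (hp : 2 < p) :
    ∃ C : ℝ, 0 ≤ C ∧ ∀ (f μ : Measure ℝ) [IsProbabilityMeasure f] [IsProbabilityMeasure μ] (γ : ℝ),
      0 ≤ γ → γ ≤ 1 / 4 → f (Iio 0) = 0 → Integrable (fun x => |x| ^ p) f →
      Integrable (fun x => |x| ^ p) μ → ∫ x, x ∂μ = 0 →
      boltzmannWeak γ μ f (fun w => w ^ p) ≤
        C * ((γ + 2 * ∫ x, x ^ 2 ∂μ + ∫ x, |x| ^ p ∂μ) * ∫ w, |w| ^ p ∂f) := by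
  obtain ⟨C, hC0, hC⟩ := trade_rpow_sub_le hp
  refine ⟨C * (2 ^ p * 2), by positivity, fun f μ _ _ γ hγ hγ' hf0 hf hμ hμ0 => ?_⟩
  have hμid := integrable_id_of_moment (by linarith) hμ
  have hμsq := integrable_sq_of_moment (by linarith) hμ
  have hM : Integrable (fun y : ℝ × ℝ => |y.1| ^ p + |y.2| ^ p) (f.prod f) :=
    (hf.comp_fst f).add (hf.comp_snd f)
  have hIM : ∫ y : ℝ × ℝ, (|y.1| ^ p + |y.2| ^ p) ∂(f.prod f) = 2 * ∫ w, |w| ^ p ∂f := by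
    rw [integral_add (hf.comp_fst f) (hf.comp_snd f), integral_fst_return (fun x => |x| ^ p),
      integral_snd_return (fun x => |x| ^ p)]
    ring
  have hE : Integrable (fun y : ℝ × ℝ => γ + y.1 ^ 2 + y.2 ^ 2 + |y.1| ^ p) (μ.prod μ) :=
    (((integrable_const _).add (hμsq.comp_fst μ)).add (hμsq.comp_snd μ)).add (hμ.comp_fst μ)
  have hIE : ∫ y : ℝ × ℝ, (γ + y.1 ^ 2 + y.2 ^ 2 + |y.1| ^ p) ∂(μ.prod μ) =
      γ + 2 * ∫ x, x ^ 2 ∂μ + ∫ x, |x| ^ p ∂μ := by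
    rw [integral_add (((integrable_const _).fun_add (hμsq.comp_fst μ)).fun_add (hμsq.comp_snd μ))
      (hμ.comp_fst μ), integral_add ((integrable_const _).fun_add (hμsq.comp_fst μ))
      (hμsq.comp_snd μ), integral_add (integrable_const _) (hμsq.comp_fst μ),
      integral_fst_return (fun x => x ^ 2), integral_snd_return (fun x => x ^ 2),
      integral_fst_return (fun x => |x| ^ p)]
    simp
    ring
  have hA : Integrable (fun y : ℝ × ℝ => p * |y.1| ^ p) (f.prod f) := (hf.comp_fst f).const_mul p
  have hT1 := hA.mul_prod (hμid.comp_fst μ)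
  have hT2 := (hM.mul_prod hE).const_mul (C * 2 ^ p)
  set X := (f.prod f).prod (μ.prod μ) with hX
  have hRHS : ∫ x : (ℝ × ℝ) × (ℝ × ℝ), (p * |x.1.1| ^ p * x.2.1 + C * 2 ^ p *
      ((|x.1.1| ^ p + |x.1.2| ^ p) * (γ + x.2.1 ^ 2 + x.2.2 ^ 2 + |x.2.1| ^ p))) ∂X =
      C * (2 ^ p * 2) * ((γ + 2 * ∫ x, x ^ 2 ∂μ + ∫ x, |x| ^ p ∂μ) * ∫ w, |w| ^ p ∂f) := by
    rw [integral_add hT1 hT2, integral_const_mul,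
      integral_prod_mul (fun y : ℝ × ℝ => p * |y.1| ^ p) (fun y : ℝ × ℝ => y.1),
      integral_fst_return (fun x => x), hμ0,
      integral_prod_mul (fun y : ℝ × ℝ => |y.1| ^ p + |y.2| ^ p)
        (fun y : ℝ × ℝ => γ + y.1 ^ 2 + y.2 ^ 2 + |y.1| ^ p), hIM, hIE]
    ring
  rw [← hRHS]
  unfold boltzmannWeak
  by_cases hi : Integrable (fun x : (ℝ × ℝ) × (ℝ × ℝ) => noDebt γ x.1.1 x.1.2 x.2.1 x.2.2 *
    ((fun w => w ^ p) (postTrade γ x.1.1 x.1.2 x.2.1) - (fun w => w ^ p) x.1.1)) X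
  · refine integral_mono_ae hi (hT1.add hT2) ?_
    filter_upwards [ae_nonneg_collision (μ := μ) hf0] with x hx
    refine (hC γ x.1.1 x.1.2 x.2.1 x.2.2 hγ hγ' hx.1 hx.2).trans ?_
    have h1 := add_rpow_le_two_rpow_mul (r := p) hx.1 hx.2 (by linarith)
    simp only [abs_of_nonneg hx.1, abs_of_nonneg hx.2]
    rw [mul_assoc C, ← mul_assoc (2 ^ p)]
    have : 0 ≤ γ + x.2.1 ^ 2 + x.2.2 ^ 2 + |x.2.1| ^ p := by positivity
    gcongr
  · -- the Bochner integral of a non-integrable function is zero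
    rw [integral_undef hi, hRHS]
    have : 0 ≤ ∫ x, x ^ 2 ∂μ := integral_nonneg fun x => sq_nonneg x
    have : 0 ≤ ∫ x, |x| ^ p ∂μ := integral_nonneg fun x => by positivity
    have : 0 ≤ ∫ x, |x| ^ p ∂f := integral_nonneg fun x => by positivity
    positivity

/-! ### Propagation of absolute continuity in one collision -/

/-- If `f A ≤ K |A| + ε` for all sets, the same holds for functions with values in `[0, 1]`. -/
theorem integral_le_of_measure_le {g : ℝ → ℝ} {K ε : ℝ} (hK : 0 ≤ K) (hε : 0 ≤ ε)
    (hf : ∀ A, MeasurableSet A → f A ≤ ENNReal.ofReal K * volume A + ENNReal.ofReal ε)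
    (hg : Continuous g) (hgi : Integrable g) (hg01 : ∀ x, g x ∈ Icc (0 : ℝ) 1) :
    ∫ x, g x ∂f ≤ K * (∫ x, g x) + ε := by
  have hgf : Integrable g f := (integrable_const (1 : ℝ)).mono' hg.aestronglyMeasurable
    (Eventually.of_forall fun x => by
      rw [Real.norm_eq_abs, abs_of_nonneg (hg01 x).1]; exact (hg01 x).2)
  have hI0 : 0 ≤ ∫ x, g x := integral_nonneg fun x => (hg01 x).1
  rw [← ENNReal.ofReal_le_ofReal_iff (by positivity), ENNReal.ofReal_add (by positivity) hε,
    ENNReal.ofReal_mul hK,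
    ofReal_integral_eq_lintegral_ofReal hgf (Eventually.of_forall fun x => (hg01 x).1),
    ofReal_integral_eq_lintegral_ofReal hgi (Eventually.of_forall fun x => (hg01 x).1),
    lintegral_eq_lintegral_meas_lt _ (Eventually.of_forall fun x => (hg01 x).1)
      hg.aemeasurable,
    lintegral_eq_lintegral_meas_lt _ (Eventually.of_forall fun x => (hg01 x).1)
      hg.aemeasurable]
  have hmeas : Measurable fun t : ℝ => volume {a | t < g a} :=
    Antitone.measurable fun s t hst => measure_mono fun x hx => lt_of_le_of_lt hst hx
  calc ∫⁻ t in Ioi (0 : ℝ), f {a | t < g a}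
      ≤ ∫⁻ t in Ioi (0 : ℝ), (ENNReal.ofReal K * volume {a | t < g a} +
          (Iio (1 : ℝ)).indicator (fun _ => ENNReal.ofReal ε) t) := by
        refine lintegral_mono fun t => ?_
        by_cases ht : t < 1
        · rw [indicator_of_mem (show t ∈ Iio (1 : ℝ) from ht)]
          exact hf _ (measurableSet_lt measurable_const hg.measurable)
        · have : {a | t < g a} = ∅ := by
            ext a
            simp only [mem_ofPred_eq, mem_empty_iff_false, iff_false, not_lt]
            exact (hg01 a).2.trans (not_lt.1 ht)
          simp [this]
    _ = ENNReal.ofReal K * (∫⁻ t in Ioi (0 : ℝ), volume {a | t < g a}) + ENNReal.ofReal ε := by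
        rw [lintegral_add_left (hmeas.const_mul _), lintegral_const_mul _ hmeas,
          lintegral_indicator_const measurableSet_Iio, Measure.restrict_apply measurableSet_Iio,
          Iio_inter_Ioi, Real.volume_Ioo]
        simp

/-- A measure with `f A ≤ K |A| + ε` has an image of the same kind under an affine map, with `K`
divided by the slope. -/
theorem integral_comp_affine_le {g : ℝ → ℝ} {K ε : ℝ} (hK : 0 ≤ K) (hε : 0 ≤ ε)
    (hf : ∀ A, MeasurableSet A → f A ≤ ENNReal.ofReal K * volume A + ENNReal.ofReal ε)
    (hg : Continuous g) (hgi : HasCompactSupport g) (hg01 : ∀ x, g x ∈ Icc (0 : ℝ) 1)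
    {a : ℝ} (ha : 0 < a) (b : ℝ) :
    ∫ x, g (a * x + b) ∂f ≤ K * (a⁻¹ * ∫ x, g x) + ε := by
  have h1 : Integrable fun x => g (a * x + b) :=
    (((hg.integrable_of_hasCompactSupport hgi).comp_add_right b).comp_mul_left' ha.ne')
  refine (integral_le_of_measure_le hK hε hf (by fun_prop) h1 (fun x => hg01 _)).trans
    (le_of_eq ?_)
  rw [Measure.integral_comp_mul_left (fun y => g (y + b)), integral_add_right_eq_self,
    abs_of_pos (inv_pos.2 ha), smul_eq_mul]

/-- The Jacobian of a trade in the wealth of the agent; its linear part in `η` averages out against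
centred returns. -/
theorem inv_one_add_le {γ η : ℝ} (hγ' : γ ≤ 1 / 4) (hη : |η| < 1 / 2) :
    (1 - γ + η)⁻¹ ≤ 1 + γ - η + 8 * (γ ^ 2 + η ^ 2) := by
  have h := abs_lt.1 hη
  rw [inv_le_iff_one_le_mul₀ (by linarith)]
  have h1 : 1 ≤ (1 + γ - η + 4 * (η - γ) ^ 2) * (1 - γ + η) := by
    have e1 : 0 ≤ (η - γ) ^ 2 * (3 + 4 * (η - γ)) := mul_nonneg (sq_nonneg _) (by linarith)
    linarith
  refine h1.trans (mul_le_mul_of_nonneg_right ?_ (by linarith))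
  nlinarith [sq_nonneg (γ + η)]

/-- One collision preserves the property `f A ≤ K |A| + ε`, up to an increase of the constants
that is proportional to `γ`, respectively of higher order. -/
theorem IsBump.boltzmannWeak_le {φ : ℝ → ℝ} (h : IsBump φ) {p q γ K ε : ℝ} (hp : 2 < p)
    (hq : 0 ≤ q) (hqp : q ≤ p) (hγ : 0 ≤ γ) (hγ' : γ ≤ 1 / 4) (hf0 : f (Iio 0) = 0)
    (hμ : Integrable (fun x => |x| ^ p) μ) (hμ0 : ∫ x, x ∂μ = 0) (hK : 0 ≤ K) (hε : 0 ≤ ε)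
    (hf : ∀ A, MeasurableSet A → f A ≤ ENNReal.ofReal K * volume A + ENNReal.ofReal ε) :
    boltzmannWeak γ μ f φ ≤ -∫ w, φ w ∂f
      + K * (1 + γ + 8 * (γ ^ 2 + ∫ x, x ^ 2 ∂μ)) * (∫ w, φ w) + ε
      + 3 * 2 ^ q * ∫ x, |x| ^ q ∂μ := by
  have hc := h.nice.continuous
  have hμid := integrable_id_of_moment (by linarith) hμ
  have hμsq := integrable_sq_of_moment (by linarith) hμ
  have hμq := integrable_abs_rpow_of_le hq hqp hμ
  have habs : ∀ x, |φ x| ≤ 1 := fun x => by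
    rw [abs_of_nonneg (h.mem_Icc x).1]; exact (h.mem_Icc x).2
  have hφf : Integrable φ f := (integrable_const (1 : ℝ)).mono' hc.aestronglyMeasurable
    (Eventually.of_forall habs)
  have hI0 : 0 ≤ ∫ x, φ x := integral_nonneg fun x => (h.mem_Icc x).1
  set X := (f.prod f).prod (μ.prod μ) with hX
  set H : (ℝ × ℝ) × (ℝ × ℝ) → ℝ := fun x =>
    if |x.2.1| < 1 / 2 then φ (postTrade γ x.1.1 x.1.2 x.2.1) else 0 with hH
  have hpm : Measurable fun x : (ℝ × ℝ) × (ℝ × ℝ) => φ (postTrade γ x.1.1 x.1.2 x.2.1) := by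
    have := hc.measurable
    unfold postTrade
    fun_prop
  have hHm : Measurable H := by
    refine Measurable.ite (measurableSet_lt ?_ measurable_const) hpm measurable_const
    fun_prop
  have hHi : Integrable H X := by
    refine (integrable_const (1 : ℝ)).mono' hHm.aestronglyMeasurable
      (Eventually.of_forall fun x => ?_)
    simp only [hH]
    split_ifs
    · exact habs _
    · simp
  have hFi : Integrable (fun x : (ℝ × ℝ) × (ℝ × ℝ) => noDebt γ x.1.1 x.1.2 x.2.1 x.2.2 *
      (φ (postTrade γ x.1.1 x.1.2 x.2.1) - φ x.1.1)) X := by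
    refine (integrable_const (2 : ℝ)).mono' ((measurable_noDebt γ).mul (hpm.sub
      (hc.measurable.comp (by fun_prop)))).aestronglyMeasurable (Eventually.of_forall fun x => ?_)
    rw [norm_mul, Real.norm_eq_abs, Real.norm_eq_abs, abs_of_nonneg (noDebt_nonneg _ _ _ _ _)]
    have h1 := noDebt_le_one γ x.1.1 x.1.2 x.2.1 x.2.2
    have h2 := abs_sub (φ (postTrade γ x.1.1 x.1.2 x.2.1)) (φ x.1.1)
    have h3 := habs (postTrade γ x.1.1 x.1.2 x.2.1)
    have h4 := habs x.1.1
    calc _ ≤ 1 * (2 : ℝ) := mul_le_mul h1 (by linarith) (abs_nonneg _) zero_le_one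
      _ = 2 := one_mul _
  have hE : Integrable (fun y : ℝ × ℝ => 2 ^ q * (2 * |y.1| ^ q + |y.2| ^ q)) (μ.prod μ) :=
    (((hμq.comp_fst μ).const_mul 2).add (hμq.comp_snd μ)).const_mul _
  have hIE : ∫ y : ℝ × ℝ, 2 ^ q * (2 * |y.1| ^ q + |y.2| ^ q) ∂(μ.prod μ) =
      3 * 2 ^ q * ∫ x, |x| ^ q ∂μ := by
    rw [integral_const_mul, integral_add ((hμq.comp_fst μ).const_mul 2) (hμq.comp_snd μ),
      integral_const_mul, integral_fst_return (fun x => |x| ^ q),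
      integral_snd_return (fun x => |x| ^ q)]
    ring
  have hφX : Integrable (fun x : (ℝ × ℝ) × (ℝ × ℝ) => φ x.1.1) X :=
    (hφf.comp_fst f).comp_fst (μ.prod μ)
  have hEX : Integrable (fun x : (ℝ × ℝ) × (ℝ × ℝ) => 2 ^ q * (2 * |x.2.1| ^ q + |x.2.2| ^ q)) X :=
    hE.comp_snd (f.prod f)
  have hstep : boltzmannWeak γ μ f φ ≤ ∫ x, H x ∂X - ∫ w, φ w ∂f + 3 * 2 ^ q * ∫ x, |x| ^ q ∂μ := by
    have e1 : ∫ x : (ℝ × ℝ) × (ℝ × ℝ), φ x.1.1 ∂X = ∫ w, φ w ∂f := by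
      rw [hX, integral_fun_fst (fun y : ℝ × ℝ => φ y.1), integral_fst_return φ]; simp
    have e2 : ∫ x : (ℝ × ℝ) × (ℝ × ℝ), 2 ^ q * (2 * |x.2.1| ^ q + |x.2.2| ^ q) ∂X =
        3 * 2 ^ q * ∫ x, |x| ^ q ∂μ := by
      rw [hX, integral_fun_snd (fun y : ℝ × ℝ => 2 ^ q * (2 * |y.1| ^ q + |y.2| ^ q)), hIE]; simp
    rw [← e1, ← e2, ← integral_sub hHi hφX,
      ← integral_add (show Integrable (fun x => H x - φ x.1.1) X from hHi.sub hφX) hEX]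
    refine integral_mono_ae hFi ((hHi.sub hφX).add hEX) ?_
    filter_upwards [ae_nonneg_collision (μ := μ) hf0] with x hx
    exact h.trade_sub_le hγ hγ' hx.1 hx.2 hq x.2.1 x.2.2
  -- for fixed returns and fixed wealth of the partner the trade is an affine map
  have hinner : ∀ y : ℝ × ℝ, ∫ z : ℝ × ℝ, H (z, y) ∂(f.prod f) ≤
      K * (1 + γ - y.1 + 8 * (γ ^ 2 + y.1 ^ 2)) * (∫ w, φ w) + ε := by
    intro y
    by_cases hy : |y.1| < 1 / 2
    · have hyy := abs_lt.1 hy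
      have e1 : (fun z : ℝ × ℝ => H (z, y)) = fun z => φ ((1 - γ + y.1) * z.1 + γ * z.2) := by
        ext z
        simp only [hH, if_pos hy]
        congr 1
        unfold postTrade
        ring
      have e2 : Integrable (fun z : ℝ × ℝ => φ ((1 - γ + y.1) * z.1 + γ * z.2)) (f.prod f) :=
        (integrable_const (1 : ℝ)).mono' (by fun_prop : Continuous fun z : ℝ × ℝ =>
          φ ((1 - γ + y.1) * z.1 + γ * z.2)).aestronglyMeasurable
          (Eventually.of_forall fun z => habs _)
      rw [e1, integral_prod_symm _ e2]
      have e3 : ∀ v, ∫ w, φ ((1 - γ + y.1) * w + γ * v) ∂f ≤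
          K * ((1 - γ + y.1)⁻¹ * ∫ w, φ w) + ε := fun v =>
        integral_comp_affine_le hK hε hf hc h.compact h.mem_Icc (by linarith) _
      calc ∫ v, ∫ w, φ ((1 - γ + y.1) * w + γ * v) ∂f ∂f
          ≤ ∫ v, (K * ((1 - γ + y.1)⁻¹ * ∫ w, φ w) + ε) ∂f :=
            integral_mono e2.integral_prod_right (integrable_const _) e3
        _ = K * ((1 - γ + y.1)⁻¹ * ∫ w, φ w) + ε := by simp
        _ ≤ K * ((1 + γ - y.1 + 8 * (γ ^ 2 + y.1 ^ 2)) * ∫ w, φ w) + ε := by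
            have := inv_one_add_le hγ' hy
            gcongr
        _ = _ := by ring
    · have e1 : (fun z : ℝ × ℝ => H (z, y)) = fun z => 0 := by
        ext z
        simp only [hH, if_neg hy]
      have e2 : 0 ≤ 1 + γ - y.1 + 8 * (γ ^ 2 + y.1 ^ 2) := by
        nlinarith [sq_nonneg (y.1 - 1 / 2), sq_nonneg γ, sq_nonneg y.1]
      rw [e1, integral_zero]
      positivity
  have hout : ∫ x, H x ∂X ≤ K * (1 + γ + 8 * (γ ^ 2 + ∫ x, x ^ 2 ∂μ)) * (∫ w, φ w) + ε := by
    have hJ : Integrable (fun y : ℝ × ℝ => 1 + γ - y.1 + 8 * (γ ^ 2 + y.1 ^ 2)) (μ.prod μ) :=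
      ((integrable_const _).sub (hμid.comp_fst μ)).add
        (((integrable_const _).add (hμsq.comp_fst μ)).const_mul 8)
    have hIJ : ∫ y : ℝ × ℝ, (1 + γ - y.1 + 8 * (γ ^ 2 + y.1 ^ 2)) ∂(μ.prod μ) =
        1 + γ + 8 * (γ ^ 2 + ∫ x, x ^ 2 ∂μ) := by
      rw [integral_add (show Integrable (fun y : ℝ × ℝ => 1 + γ - y.1) (μ.prod μ) from
          (integrable_const _).sub (hμid.comp_fst μ))
        (((integrable_const _).fun_add (hμsq.comp_fst μ)).const_mul 8),
        integral_sub (integrable_const _) (hμid.comp_fst μ), integral_const_mul,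
        integral_add (integrable_const _) (hμsq.comp_fst μ), integral_fst_return (fun x => x),
        integral_fst_return (fun x => x ^ 2), hμ0]
      simp
    rw [hX, integral_prod_symm _ hHi]
    calc ∫ y, ∫ z, H (z, y) ∂(f.prod f) ∂(μ.prod μ)
        ≤ ∫ y : ℝ × ℝ, (K * (1 + γ - y.1 + 8 * (γ ^ 2 + y.1 ^ 2)) * (∫ w, φ w) + ε) ∂(μ.prod μ) :=
          integral_mono hHi.integral_prod_right
            (((hJ.const_mul K).mul_const _).add (integrable_const _)) hinner
      _ = _ := by
          rw [integral_add ((hJ.const_mul K).mul_const _) (integrable_const _),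
            integral_mul_const, integral_const_mul, hIJ]
          simp
  linarith

end

/-! ### Weak solutions at the kinetic level -/

theorem IsWealthDensity.measure_Iic {p : ℝ} {ν : ProbabilityMeasure ℝ} (h : IsWealthDensity p ν) :
    (ν : Measure ℝ) (Iic 0) = 0 := by
  rw [← Iio_union_right]
  exact measure_union_null h.support (h.hasDensity Real.volume_singleton)

theorem IsWealthDensity.ae_pos {p : ℝ} {ν : ProbabilityMeasure ℝ} (h : IsWealthDensity p ν) :
    ∀ᵐ w ∂(ν : Measure ℝ), 0 < w := by
  rw [ae_iff]
  simpa [Iic_def] using h.measure_Iic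

theorem integral_rpow_eq_abs {ν : Measure ℝ} (h : ν (Iio 0) = 0) (p : ℝ) :
    ∫ w, w ^ p ∂ν = ∫ w, |w| ^ p ∂ν := by
  refine integral_congr_ae ?_
  filter_upwards [ae_nonneg_of_measure_Iio h] with w hw
  simp only [abs_of_nonneg hw]

namespace IsWeakSolution

variable {p : ℝ} {A : Measure ℝ → (ℝ → ℝ) → ℝ} {f₀ : ProbabilityMeasure ℝ}
  {f : ℝ → ProbabilityMeasure ℝ}

theorem integral_zero (h : IsWeakSolution p A f₀ f) {φ : ℝ → ℝ} (hφ : IsTestFunction p φ) :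
    ∫ w, φ w ∂(f 0 : Measure ℝ) = ∫ w, φ w ∂(f₀ : Measure ℝ) := by
  have h1 := ((h.smooth φ hφ).continuousOn 0 self_mem_Ici).mono_left
    (nhdsWithin_mono 0 Ioi_subset_Ici_self)
  exact tendsto_nhds_unique h1 (h.initial φ hφ)

/-- The integrated form of the equation, after a linear change of the time scale. -/
theorem integral_eq (h : IsWeakSolution p A f₀ f) {φ : ℝ → ℝ} (hφ : IsTestFunction p φ) {c : ℝ}
    (hc : 0 < c) {τ : ℝ} (hτ : 0 ≤ τ) :
    IntervalIntegrable (fun r => A (f (r / c)) φ / c) volume 0 τ ∧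
      ∫ w, φ w ∂(f (τ / c) : Measure ℝ) =
        ∫ w, φ w ∂(f₀ : Measure ℝ) + ∫ r in (0 : ℝ)..τ, A (f (r / c)) φ / c := by
  set v : ℝ → ℝ := fun r => ∫ w, φ w ∂(f (r / c) : Measure ℝ) with hv
  have hsm : ContDiffOn ℝ 1 v (Ici 0) :=
    (h.smooth φ hφ).comp (contDiff_id.div_const c).contDiffOn
      fun x hx => div_nonneg (mem_Ici.1 hx) hc.le
  have hder : ∀ r, 0 < r → HasDerivAt v (A (f (r / c)) φ / c) r := fun r hr => by
    have := (h.equation φ hφ (r / c) (by positivity)).comp r ((hasDerivAt_id r).div_const c)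
    exact this.congr_deriv (by ring)
  have hint : IntervalIntegrable (fun r => A (f (r / c)) φ / c) volume 0 τ := by
    have h1 : IntervalIntegrable (derivWithin v (Ici 0)) volume 0 τ := by
      refine ContinuousOn.intervalIntegrable ?_
      rw [uIcc_of_le hτ]
      exact (hsm.continuousOn_derivWithin (uniqueDiffOn_Ici 0) le_rfl).mono Icc_subset_Ici_self
    refine h1.congr fun r hr => ?_
    rw [uIoc_of_le hτ] at hr
    exact (hder r hr.1).hasDerivWithinAt.derivWithin (uniqueDiffOn_Ici 0 r hr.1.le)
  refine ⟨hint, ?_⟩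
  rw [intervalIntegral.integral_eq_sub_of_hasDerivAt_of_le hτ
    (hsm.continuousOn.mono Icc_subset_Ici_self) (fun r hr => hder r hr.1) hint]
  simp only [hv, zero_div]
  rw [h.integral_zero hφ]
  ring

/-- Grönwall's lemma for the moment of order `p`. -/
theorem moment_le (h : IsWeakSolution p A f₀ f) (hp : 2 < p) (hf₀ : IsWealthDensity p f₀) {c : ℝ}
    (hc : ∀ t, 0 < t → A (f t) (fun w => w ^ p) ≤ c * ∫ w, |w| ^ p ∂(f t : Measure ℝ)) {t : ℝ}
    (ht : 0 ≤ t) :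
    ∫ w, |w| ^ p ∂(f t : Measure ℝ) ≤ Real.exp (c * t) * ∫ w, |w| ^ p ∂(f₀ : Measure ℝ) := by
  have hφ := isTestFunction_rpow hp
  set M := ∫ w, |w| ^ p ∂(f₀ : Measure ℝ) with hM
  have hexp : ∀ s, HasDerivAt (fun s => Real.exp (c * s) * M) (c * (Real.exp (c * s) * M)) s :=
    fun s => by
      have := (((hasDerivAt_id s).const_mul c).exp).mul_const M
      exact this.congr_deriv (by simp; ring)
  have := nonpos_of_deriv_le_mul (c := c) (T := t)
    (z := fun s => ∫ w, w ^ p ∂(f s : Measure ℝ) - Real.exp (c * s) * M)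
    (z' := fun s => A (f s) (fun w => w ^ p) - c * (Real.exp (c * s) * M))
    ((h.smooth _ hφ).continuousOn.sub (by fun_prop))
    (fun s hs => (h.equation _ hφ s hs).sub (hexp s))
    (fun s hs _ => by
      rw [integral_rpow_eq_abs (h.density s hs.le).support]
      linarith [hc s hs])
    (by
      rw [h.integral_zero hφ, integral_rpow_eq_abs hf₀.support]
      simp [hM]) ht le_rfl
  rw [integral_rpow_eq_abs (h.density t ht).support] at this
  linarith

end IsWeakSolution

/-- Quantitative absolute continuity along a solution of the Boltzmann equation: if the initial
density satisfies `f₀ A ≤ K |A| + ε`, so does the solution, with constants that deteriorate in a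
controlled way. The measures are compared with the sum of a multiple of Lebesgue measure and a
defect; the defect contracts by the factor `1 - exp (-T)` at each round of the argument. -/
theorem IsWeakSolution.measure_le {p q γ K ε T : ℝ} {μ : Measure ℝ} [IsProbabilityMeasure μ]
    {f₀ : ProbabilityMeasure ℝ} {f : ℝ → ProbabilityMeasure ℝ}
    (h : IsWeakSolution p (boltzmannWeak γ μ) f₀ f) (hp : 2 < p) (hq : 0 ≤ q) (hqp : q ≤ p)
    (hγ : 0 ≤ γ) (hγ' : γ ≤ 1 / 4)
    (hμ : Integrable (fun x => |x| ^ p) μ) (hμ0 : ∫ x, x ∂μ = 0) (hK : 0 ≤ K) (hε : 0 ≤ ε)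
    (hf₀ : ∀ A, MeasurableSet A →
      (f₀ : Measure ℝ) A ≤ ENNReal.ofReal K * volume A + ENNReal.ofReal ε)
    {t : ℝ} (ht : 0 ≤ t) (htT : t ≤ T) {A : Set ℝ} (hA : MeasurableSet A) :
    (f t : Measure ℝ) A ≤
      ENNReal.ofReal (K * Real.exp ((γ + 8 * (γ ^ 2 + ∫ x, x ^ 2 ∂μ)) * t)) * volume A
        + ENNReal.ofReal (ε + 3 * 2 ^ q * (∫ x, |x| ^ q ∂μ) * t) := by
  set c := γ + 8 * (γ ^ 2 + ∫ x, x ^ 2 ∂μ) with hc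
  set b := 3 * 2 ^ q * (∫ x, |x| ^ q ∂μ) with hb
  have hb0 : 0 ≤ b := by
    have : 0 ≤ ∫ x, |x| ^ q ∂μ := integral_nonneg fun x => by positivity
    positivity
  have hT : 0 ≤ T := ht.trans htT
  set θ := 1 - Real.exp (-T) with hθ
  have hθ0 : 0 ≤ θ := by
    have : Real.exp (-T) ≤ 1 := Real.exp_le_one_iff.2 (by linarith)
    linarith
  have hθ1 : θ < 1 := by linarith [Real.exp_pos (-T)]
  -- Defect `1` is trivial. If the defect is at most `S` on `[0, T]`, then the difference `z` between
  -- `∫ φ` and its barrier satisfies `z' ≤ -z`, thanks to the loss term, and the barrier may be taken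
  -- with the defect `S (1 - exp (-s))`.
  have key : ∀ n : ℕ, ∀ s, 0 ≤ s → s ≤ T → ∀ A, MeasurableSet A →
      (f s : Measure ℝ) A ≤ ENNReal.ofReal (K * Real.exp (c * s)) * volume A
        + ENNReal.ofReal (ε + b * s + θ ^ n) := by
    intro n
    induction n with
    | zero =>
      intro s hs _ A _
      refine (prob_le_one).trans (le_trans ?_ le_add_self)
      rw [← ENNReal.ofReal_one]
      refine ENNReal.ofReal_le_ofReal ?_
      rw [pow_zero]
      have := mul_nonneg hb0 hs
      linarith
    | succ n ih =>
      intro s hs hsT A hA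
      have hS0 : 0 ≤ θ ^ n := by positivity
      obtain ⟨D, hD⟩ : ∃ D : ℝ≥0, (D : ℝ) = K * Real.exp (c * s) :=
        ⟨⟨K * Real.exp (c * s), by positivity⟩, rfl⟩
      have hbump : ∀ φ, IsBump φ → ∫ w, φ w ∂(f s : Measure ℝ) ≤
          K * Real.exp (c * s) * (∫ w, φ w) + (ε + b * s + θ ^ (n + 1)) := by
        intro φ hφ
        have htest := hφ.nice.isTestFunction hp
        set I := ∫ w, φ w with hI
        have hbar : ∀ r, HasDerivAt
            (fun r => K * Real.exp (c * r) * I + (ε + b * r + θ ^ n * (1 - Real.exp (-r))))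
            (K * (c * Real.exp (c * r)) * I + (b + θ ^ n * Real.exp (-r))) r := fun r => by
          have e1 : HasDerivAt (fun r => Real.exp (c * r)) (Real.exp (c * r) * (c * 1)) r :=
            ((hasDerivAt_id r).const_mul c).exp
          have e2 : HasDerivAt (fun r => Real.exp (-r)) (Real.exp (-r) * -1) r :=
            (hasDerivAt_neg r).exp
          have e3 := ((e1.const_mul K).mul_const I).add
            ((((hasDerivAt_id r).const_mul b).const_add ε).add ((e2.const_sub 1).const_mul (θ ^ n)))
          exact e3.congr_deriv (by ring)
        have hz := nonpos_of_deriv_le_mul (c := -1) (T := T)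
          (z := fun r => ∫ w, φ w ∂(f r : Measure ℝ) -
            (K * Real.exp (c * r) * I + (ε + b * r + θ ^ n * (1 - Real.exp (-r)))))
          (z' := fun r => boltzmannWeak γ μ (f r) φ -
            (K * (c * Real.exp (c * r)) * I + (b + θ ^ n * Real.exp (-r))))
          ((h.smooth φ htest).continuousOn.sub (by fun_prop))
          (fun r hr => (h.equation φ htest r hr).sub (hbar r))
          (fun r hr hrT => by
            have := hφ.boltzmannWeak_le (f := (f r : Measure ℝ)) (ε := ε + b * r + θ ^ n) hp hq hqp
              hγ hγ' (h.density r hr.le).support hμ hμ0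
              (by positivity : 0 ≤ K * Real.exp (c * r)) (by positivity) (ih r hr.le hrT)
            rw [← hb, add_assoc 1 γ, ← hc] at this
            linarith)
          (by
            rw [h.integral_zero htest]
            have := integral_le_of_measure_le (f := (f₀ : Measure ℝ)) hK hε hf₀ hφ.nice.continuous
              (hφ.nice.continuous.integrable_of_hasCompactSupport hφ.compact) hφ.mem_Icc
            simp
            linarith)
          hs hsT
        have hle : θ ^ n * (1 - Real.exp (-s)) ≤ θ ^ (n + 1) := by
          rw [pow_succ]
          refine mul_le_mul_of_nonneg_left ?_ hS0
          have : Real.exp (-T) ≤ Real.exp (-s) := Real.exp_le_exp.2 (by linarith)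
          linarith
        linarith
      have hcmp := measure_le_of_forall_isBump (ν := (f s : Measure ℝ)) (ρ := D • volume)
        (h.density s hs).measure_Iic (ε := ENNReal.ofReal (ε + b * s + θ ^ (n + 1))) (by
          intro φ hφ
          have hbd := hbump φ hφ
          have hφ0 : ∀ x, 0 ≤ φ x := fun x => (hφ.mem_Icc x).1
          have hI0 : 0 ≤ ∫ x, φ x := integral_nonneg hφ0
          have hi1 : Integrable φ (f s : Measure ℝ) := (integrable_const (1 : ℝ)).mono'
            hφ.nice.continuous.aestronglyMeasurable (Eventually.of_forall fun x => by
              rw [Real.norm_eq_abs, abs_of_nonneg (hφ0 x)]; exact (hφ.mem_Icc x).2)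
          rw [lintegral_smul_measure,
            ← ofReal_integral_eq_lintegral_ofReal hi1 (Eventually.of_forall hφ0),
            ← ofReal_integral_eq_lintegral_ofReal
              (hφ.nice.continuous.integrable_of_hasCompactSupport hφ.compact)
              (Eventually.of_forall hφ0), ENNReal.smul_def, smul_eq_mul,
            ← ENNReal.ofReal_coe_nnreal, hD, ← ENNReal.ofReal_mul (by positivity),
            ← ENNReal.ofReal_add (by positivity) (by positivity)]
          exact ENNReal.ofReal_le_ofReal hbd) hA
      rw [Measure.smul_apply, ENNReal.smul_def, smul_eq_mul, ← ENNReal.ofReal_coe_nnreal, hD]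
        at hcmp
      exact hcmp
  have hlim : Tendsto (fun n : ℕ => ENNReal.ofReal (K * Real.exp (c * t)) * volume A
      + ENNReal.ofReal (ε + b * t + θ ^ n)) atTop
      (𝓝 (ENNReal.ofReal (K * Real.exp (c * t)) * volume A
        + ENNReal.ofReal (ε + b * t + 0))) := by
    refine Tendsto.add tendsto_const_nhds (ENNReal.tendsto_ofReal ?_)
    exact tendsto_const_nhds.add (tendsto_pow_atTop_nhds_zero_of_lt_one hθ0 hθ1)
  rw [add_zero] at hlim
  exact ge_of_tendsto' hlim fun n => key n t ht htT A hA

/-- An absolutely continuous finite measure has a bounded density up to a small mass. -/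
theorem exists_measure_le_of_absolutelyContinuous {ν : Measure ℝ} [IsProbabilityMeasure ν]
    (h : ν ≪ volume) {ε : ℝ} (hε : 0 < ε) :
    ∃ K : ℝ, 0 ≤ K ∧ ∀ A, MeasurableSet A →
      ν A ≤ ENNReal.ofReal K * volume A + ENNReal.ofReal ε := by
  have hi : Integrable (fun x => (ν.rnDeriv volume x).toReal) := Measure.integrable_toReal_rnDeriv
  obtain ⟨d, hd, hdA⟩ := exists_pos_setLIntegral_lt_of_measure_lt (μ := volume)
    (f := ν.rnDeriv volume) (Measure.lintegral_rnDeriv_lt_top ν volume).ne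
    (ε := ENNReal.ofReal ε) (by simpa using hε)
  have hd' : ∃ r : ℝ, 0 < r ∧ ENNReal.ofReal r ≤ d := by
    rcases eq_or_ne d ⊤ with rfl | hne
    · exact ⟨1, one_pos, le_top⟩
    · exact ⟨d.toReal, ENNReal.toReal_pos hd.ne' hne, ENNReal.ofReal_toReal_le⟩
  obtain ⟨r, hr, hrd⟩ := hd'
  refine ⟨r⁻¹, by positivity, fun A hA => ?_⟩
  by_cases hlt : volume A < d
  · have h1 := hdA A hlt
    rw [Measure.setLIntegral_rnDeriv h] at h1
    exact h1.le.trans le_add_self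
  · refine prob_le_one.trans (le_trans ?_ le_self_add)
    calc (1 : ENNReal) = ENNReal.ofReal r⁻¹ * ENNReal.ofReal r := by
          rw [← ENNReal.ofReal_mul (by positivity), inv_mul_cancel₀ hr.ne', ENNReal.ofReal_one]
      _ ≤ _ := by gcongr; exact hrd.trans (not_lt.1 hlt)

/-! ### Quasi-invariant scaling -/

/-- The Fokker-Planck operator in weak form on smooth functions, with the mean of the measure
itself in the drift. -/
noncomputable def meanFieldWeak (lam : ℝ) (ν : Measure ℝ) (φ : ℝ → ℝ) : ℝ :=
  (∫ w, w ∂ν) * (∫ w, deriv φ w ∂ν) - ∫ w, w * deriv φ w ∂ν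
    + lam / 2 * ∫ w, w ^ 2 * deriv (deriv φ) w ∂ν

/-- A sequence of curves of probability measures that solve the Fokker-Planck equation up to an
error that tends to zero, with locally uniform moment bounds and locally uniform quantitative
absolute continuity. -/
structure IsFokkerPlanckApprox (p lam : ℝ) (f₀ : ProbabilityMeasure ℝ)
    (g : ℕ → ℝ → ProbabilityMeasure ℝ) : Prop where
  support : ∀ n τ, 0 ≤ τ → (g n τ : Measure ℝ) (Iio 0) = 0
  moment : ∀ T, ∃ B, ∀ n τ, 0 ≤ τ → τ ≤ T → Integrable (fun w => |w| ^ p) (g n τ : Measure ℝ) ∧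
    ∫ w, |w| ^ p ∂(g n τ : Measure ℝ) ≤ B
  regular : ∀ T, ∀ ε > 0, ∃ K : ℝ, ∃ b : ℕ → ℝ, Tendsto b atTop (𝓝 0) ∧
    ∀ n τ, 0 ≤ τ → τ ≤ T → ∀ A, MeasurableSet A →
      (g n τ : Measure ℝ) A ≤ ENNReal.ofReal K * volume A + ENNReal.ofReal (ε + b n)
  equation : ∀ φ, IsNice φ → ∃ Q : ℕ → ℝ → ℝ,
    (∀ n τ, 0 ≤ τ → IntervalIntegrable (Q n) volume 0 τ ∧
      ∫ w, φ w ∂(g n τ : Measure ℝ) = ∫ w, φ w ∂(f₀ : Measure ℝ) + ∫ r in (0 : ℝ)..τ, Q n r) ∧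
    ∀ T, ∃ e : ℕ → ℝ, Tendsto e atTop (𝓝 0) ∧ ∀ n r, 0 ≤ r → r ≤ T →
      |Q n r - meanFieldWeak lam (g n r) φ| ≤ e n

/-- Solutions of the Boltzmann equation, on the time scale `τ = γ t`, form an approximate solution
of the Fokker-Planck equation. -/
theorem isFokkerPlanckApprox_of_boltzmann {p q lam : ℝ} (hq : 2 < q) (hq3 : q ≤ 3) (hqp : q ≤ p)
    (hlam : 0 ≤ lam) {γ : ℕ → ℝ} {μ : ℕ → Measure ℝ} [∀ n, IsProbabilityMeasure (μ n)]
    (hγ : ∀ n, 0 < γ n) (hγ' : ∀ n, γ n ≤ 1 / 4) (hγ0 : Tendsto γ atTop (𝓝 0))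
    (hμ : ∀ n, Integrable (fun x => |x| ^ p) (μ n)) (hμ0 : ∀ n, ∫ x, x ∂(μ n) = 0)
    (hμ2 : ∀ n, ∫ x, x ^ 2 ∂(μ n) = lam * γ n) {D : ℝ} (hμp : ∀ n, ∫ x, |x| ^ p ∂(μ n) ≤ D * γ n)
    (hμ1 : Tendsto (fun n => ∫ x, |x| ∂(μ n)) atTop (𝓝 0))
    (hμq : Tendsto (fun n => (∫ x, |x| ^ q ∂(μ n)) / γ n) atTop (𝓝 0))
    {f₀ : ProbabilityMeasure ℝ} (hf₀ : IsWealthDensity p f₀)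
    {f : ℕ → ℝ → ProbabilityMeasure ℝ}
    (hf : ∀ n, IsWeakSolution p (boltzmannWeak (γ n) (μ n)) f₀ (f n)) :
    IsFokkerPlanckApprox p lam f₀ (fun n τ => f n (τ / γ n)) := by
  have hp : 2 < p := hq.trans_le hqp
  have hdiv : ∀ n τ, 0 ≤ τ → 0 ≤ τ / γ n := fun n τ hτ => div_nonneg hτ (hγ n).le
  have hmom : ∀ T, ∃ B, ∀ n τ, 0 ≤ τ → τ ≤ T →
      Integrable (fun w => |w| ^ p) (f n (τ / γ n) : Measure ℝ) ∧
      ∫ w, |w| ^ p ∂(f n (τ / γ n) : Measure ℝ) ≤ B := by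
    intro T
    obtain ⟨C, hC0, hC⟩ := boltzmannWeak_rpow_le hp
    set M := ∫ w, |w| ^ p ∂(f₀ : Measure ℝ) with hM
    have hM0 : 0 ≤ M := integral_nonneg fun x => by positivity
    set c := C * (1 + 2 * lam + |D|) with hc
    have hc0 : 0 ≤ c := by positivity
    refine ⟨Real.exp (c * T) * M, fun n τ hτ hτT =>
      ⟨((hf n).density _ (hdiv n τ hτ)).moment, ?_⟩⟩
    have h1 : ∫ w, |w| ^ p ∂(f n (τ / γ n) : Measure ℝ) ≤
        Real.exp (c * γ n * (τ / γ n)) * M := by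
      refine (hf n).moment_le hp hf₀ (fun t ht => ?_) (hdiv n τ hτ)
      have hdt := (hf n).density t ht.le
      refine (hC (f n t) (μ n) (γ n) (hγ n).le (hγ' n) hdt.support hdt.moment (hμ n)
        (hμ0 n)).trans ?_
      have hI : 0 ≤ ∫ w, |w| ^ p ∂(f n t : Measure ℝ) := integral_nonneg fun x => by positivity
      have h2 : γ n + 2 * ∫ x, x ^ 2 ∂(μ n) + ∫ x, |x| ^ p ∂(μ n) ≤
          (1 + 2 * lam + |D|) * γ n := by
        rw [hμ2]
        have := mul_le_mul_of_nonneg_right (le_abs_self D) (hγ n).le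
        linarith [hμp n]
      calc _ ≤ C * ((1 + 2 * lam + |D|) * γ n * ∫ w, |w| ^ p ∂(f n t : Measure ℝ)) := by gcongr
        _ = _ := by rw [hc]; ring
    refine h1.trans ?_
    have h2 : c * γ n * (τ / γ n) = c * τ := by
      have := (hγ n).ne'
      field_simp
    rw [h2]
    gcongr
  refine ⟨fun n τ hτ => ((hf n).density _ (hdiv n τ hτ)).support, hmom, ?_, ?_⟩
  · intro T ε hε
    obtain ⟨K, hK0, hK⟩ := exists_measure_le_of_absolutelyContinuous hf₀.hasDensity hε
    refine ⟨K * Real.exp ((1 + 8 * (1 + lam)) * |T|),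
      fun n => 3 * 2 ^ q * ((∫ x, |x| ^ q ∂(μ n)) / γ n) * |T|, ?_, ?_⟩
    · simpa using (hμq.const_mul (3 * 2 ^ q)).mul_const |T|
    · intro n τ hτ hτT A hA
      have hTabs : τ ≤ |T| := hτT.trans (le_abs_self T)
      refine ((hf n).measure_le (T := τ / γ n) hp (by linarith) hqp (hγ n).le (hγ' n) (hμ n)
        (hμ0 n) hK0 hε.le hK (hdiv n τ hτ) le_rfl hA).trans ?_
      have hn := hγ n
      have hI : 0 ≤ ∫ x, |x| ^ q ∂(μ n) := integral_nonneg fun x => by positivity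
      rw [hμ2]
      refine add_le_add (mul_le_mul' (ENNReal.ofReal_le_ofReal
        (mul_le_mul_of_nonneg_left (Real.exp_le_exp.2 ?_) hK0)) le_rfl)
        (ENNReal.ofReal_le_ofReal (add_le_add le_rfl ?_))
      · have h1 : (γ n + 8 * (γ n ^ 2 + lam * γ n)) * (τ / γ n) = (1 + 8 * (γ n + lam)) * τ := by
          field_simp
        rw [h1]
        have := hγ' n
        gcongr
        linarith
      · have h1 : 3 * 2 ^ q * (∫ x, |x| ^ q ∂(μ n)) * (τ / γ n) =
            3 * 2 ^ q * ((∫ x, |x| ^ q ∂(μ n)) / γ n) * τ := by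
          field_simp
        rw [h1]
        exact mul_le_mul_of_nonneg_left hTabs (by positivity)
  · intro φ hφ
    refine ⟨fun n r => boltzmannWeak (γ n) (μ n) (f n (r / γ n)) φ / γ n, fun n τ hτ =>
      (hf n).integral_eq (hφ.isTestFunction hp) (hγ n) hτ, fun T => ?_⟩
    obtain ⟨B, hB⟩ := hmom T
    obtain ⟨C, hC0, hC⟩ := hφ.abs_boltzmannWeak_sub_le hq hq3 hqp
    refine ⟨fun n => C * ((γ n + ∫ x, |x| ∂(μ n) + 2 * ((∫ x, |x| ^ q ∂(μ n)) / γ n)) *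
      (1 + 2 * B)), ?_, fun n r hr hrT => ?_⟩
    · simpa using (((hγ0.add hμ1).add (hμq.const_mul 2)).mul_const (1 + 2 * B)).const_mul C
    · have hd := (hf n).density _ (hdiv n r hr)
      have h1 := hC (f n (r / γ n)) (μ n) (γ n) (hγ n).le (hγ' n) hd.support hd.moment (hμ n)
        (hμ0 n)
      have hn := hγ n
      have hI : 0 ≤ ∫ x, |x| ^ q ∂(μ n) := integral_nonneg fun x => by positivity
      have hI1 : 0 ≤ ∫ x, |x| ∂(μ n) := integral_nonneg fun x => by positivity
      have h2 : boltzmannWeak (γ n) (μ n) (f n (r / γ n)) φ / γ n -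
          meanFieldWeak lam (f n (r / γ n)) φ = (boltzmannWeak (γ n) (μ n) (f n (r / γ n)) φ -
          γ n * meanFieldWeak lam (f n (r / γ n)) φ) / γ n := by
        field_simp
      rw [h2, abs_div, abs_of_pos hn, div_le_iff₀ hn]
      have h3 : γ n * meanFieldWeak lam (f n (r / γ n)) φ =
          γ n * ((∫ w, w ∂(f n (r / γ n) : Measure ℝ)) *
            ∫ w, deriv φ w ∂(f n (r / γ n) : Measure ℝ) -
            ∫ w, w * deriv φ w ∂(f n (r / γ n) : Measure ℝ)) + 1 / 2 * (∫ x, x ^ 2 ∂(μ n)) *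
            ∫ w, w ^ 2 * deriv (deriv φ) w ∂(f n (r / γ n) : Measure ℝ) := by
        rw [hμ2]; unfold meanFieldWeak; ring
      rw [h3]
      refine h1.trans ?_
      have h4 := (hB n r hr hrT).2
      have h5 : γ n ^ 2 + γ n * ∫ x, |x| ∂(μ n) + 2 * ∫ x, |x| ^ q ∂(μ n) =
          (γ n + ∫ x, |x| ∂(μ n) + 2 * ((∫ x, |x| ^ q ∂(μ n)) / γ n)) * γ n := by
        field_simp
      rw [h5]
      calc C * ((γ n + ∫ x, |x| ∂(μ n) + 2 * ((∫ x, |x| ^ q ∂(μ n)) / γ n)) * γ n *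
            (1 + 2 * ∫ x, |x| ^ p ∂(f n (r / γ n) : Measure ℝ)))
          ≤ C * ((γ n + ∫ x, |x| ∂(μ n) + 2 * ((∫ x, |x| ^ q ∂(μ n)) / γ n)) * γ n *
            (1 + 2 * B)) := by gcongr
        _ = _ := by ring

/-! ### Compactness -/

/-- Bump functions on `(0, ∞)` determine the weak convergence to a probability measure that is
carried by `(0, ∞)`. -/
theorem tendsto_of_forall_isBump {ι : Type*} {l : Filter ι} [l.IsCountablyGenerated] [l.NeBot]
    {ν : ι → ProbabilityMeasure ℝ} {ν₀ : ProbabilityMeasure ℝ} (h0 : (ν₀ : Measure ℝ) (Iic 0) = 0)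
    (h : ∀ φ, IsBump φ → Tendsto (fun i => ∫ w, φ w ∂(ν i : Measure ℝ)) l
      (𝓝 (∫ w, φ w ∂(ν₀ : Measure ℝ)))) : Tendsto ν l (𝓝 ν₀) := by
  refine tendsto_of_forall_isOpen_le_liminf' fun G hG => ?_
  have hG' : (ν₀ : Measure ℝ) G ≤ (ν₀ : Measure ℝ) (G ∩ Ioi 0) := by
    calc (ν₀ : Measure ℝ) G ≤ (ν₀ : Measure ℝ) ((G ∩ Ioi 0) ∪ Iic 0) := measure_mono fun x hx => by
          by_cases h0 : 0 < x
          · exact Or.inl ⟨hx, h0⟩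
          · exact Or.inr (not_lt.1 h0)
      _ ≤ (ν₀ : Measure ℝ) (G ∩ Ioi 0) + (ν₀ : Measure ℝ) (Iic 0) := measure_union_le _ _
      _ = _ := by rw [h0, add_zero]
  refine hG'.trans (le_of_forall_lt fun r hr => ?_)
  obtain ⟨K, hKG, hK, hrK⟩ := (hG.measurableSet.inter measurableSet_Ioi).exists_lt_isCompact hr
  refine hrK.trans_le ?_
  obtain ⟨φ, hφ, h1, h2⟩ := exists_isBump hK hG (hKG.trans inter_subset_left)
    (hKG.trans inter_subset_right)
  have hφ0 : ∀ x, 0 ≤ φ x := fun x => (hφ.mem_Icc x).1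
  have hint : ∀ (μ : Measure ℝ) [IsProbabilityMeasure μ], Integrable φ μ := fun μ _ =>
    (integrable_const (1 : ℝ)).mono' hφ.nice.continuous.aestronglyMeasurable
      (Eventually.of_forall fun x => by
        rw [Real.norm_eq_abs, abs_of_nonneg (hφ0 x)]; exact (hφ.mem_Icc x).2)
  have hlow : (ν₀ : Measure ℝ) K ≤ ENNReal.ofReal (∫ w, φ w ∂(ν₀ : Measure ℝ)) := by
    rw [ofReal_integral_eq_lintegral_ofReal (hint _) (Eventually.of_forall hφ0),
      ← lintegral_indicator_one hK.measurableSet]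
    refine lintegral_mono fun x => ?_
    by_cases hx : x ∈ K
    · simp [hx, h1 x hx]
    · simp [hx]
  have hup : ∀ i, ENNReal.ofReal (∫ w, φ w ∂(ν i : Measure ℝ)) ≤ (ν i : Measure ℝ) G := fun i => by
    rw [ofReal_integral_eq_lintegral_ofReal (hint _) (Eventually.of_forall hφ0),
      ← lintegral_indicator_one hG.measurableSet]
    refine lintegral_mono fun x => ?_
    by_cases hx : x ∈ G
    · simp [hx, (hφ.mem_Icc x).2]
    · simp [hx, h2 x hx]
  have hlim := (ENNReal.tendsto_ofReal (h φ hφ)).liminf_eq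
  rw [← hlim] at hlow
  exact hlow.trans (liminf_le_liminf (Eventually.of_forall hup))

/-- Markov's inequality: bounded moments imply tightness. -/
theorem isTightMeasureSet_of_moment_bound {S : Set (Measure ℝ)} {p B : ℝ} (hp : 1 ≤ p)
    (hS : ∀ μ ∈ S, IsProbabilityMeasure μ ∧ Integrable (fun w => |w| ^ p) μ ∧
      ∫ w, |w| ^ p ∂μ ≤ B) : IsTightMeasureSet S := by
  rw [isTightMeasureSet_iff_exists_isCompact_measure_compl_le]
  intro ε hε
  obtain ⟨e, he, heε⟩ : ∃ e : ℝ, 0 < e ∧ ENNReal.ofReal e ≤ ε := by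
    rcases eq_or_ne ε ⊤ with rfl | hne
    · exact ⟨1, one_pos, le_top⟩
    · exact ⟨ε.toReal, ENNReal.toReal_pos hε.ne' hne, ENNReal.ofReal_toReal_le⟩
  set R := |B| / e + 1 with hR
  have hR1 : 1 ≤ R := by
    have : 0 ≤ |B| / e := by positivity
    linarith
  refine ⟨Icc (-R) R, isCompact_Icc, fun μ hμ => ?_⟩
  obtain ⟨hμ1, hμ2, hμ3⟩ := hS μ hμ
  have h1 := mul_meas_ge_le_integral_of_nonneg
    (Eventually.of_forall fun w => (by positivity : (0 : ℝ) ≤ |w| ^ p)) hμ2 R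
  have hsub : (Icc (-R) R)ᶜ ⊆ {w : ℝ | R ≤ |w| ^ p} := fun w hw => by
    have hw' : R < |w| := by
      by_contra hc
      exact hw (abs_le.1 (not_lt.1 hc))
    have : |w| ≤ |w| ^ p := by
      simpa using Real.rpow_le_rpow_of_exponent_le (by linarith : 1 ≤ |w|) hp
    exact hw'.le.trans this
  refine (measure_mono hsub).trans (le_trans ?_ heε)
  rw [← ofReal_measureReal]
  refine ENNReal.ofReal_le_ofReal ?_
  have h2 : R * e = |B| + e := by rw [hR]; field_simp
  have h3 := le_abs_self B
  by_contra hc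
  have : R * e < R * μ.real {w : ℝ | R ≤ |w| ^ p} :=
    mul_lt_mul_of_pos_left (not_le.1 hc) (by linarith)
  linarith

theorem abs_integral_le_of_moment {ν : Measure ℝ} [IsProbabilityMeasure ν] {p c : ℝ} {h : ℝ → ℝ}
    (hν : Integrable (fun w => |w| ^ p) ν) (hc : ∀ᵐ w ∂ν, |h w| ≤ c * (1 + |w| ^ p)) :
    |∫ w, h w ∂ν| ≤ c * (1 + ∫ w, |w| ^ p ∂ν) := by
  have hg : Integrable (fun w => c * (1 + |w| ^ p)) ν :=
    ((integrable_const (1 : ℝ)).add hν).const_mul c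
  refine (norm_integral_le_of_norm_le (f := h) hg hc).trans (le_of_eq ?_)
  rw [integral_const_mul, integral_add (integrable_const _) hν]
  simp

theorem abs_le_one_add_rpow {p : ℝ} (hp : 1 ≤ p) (w : ℝ) : |w| ≤ 1 + |w| ^ p := by
  simpa using rpow_le_one_add_rpow (abs_nonneg w) zero_le_one hp

theorem sq_le_one_add_rpow {p : ℝ} (hp : 2 ≤ p) (w : ℝ) : w ^ 2 ≤ 1 + |w| ^ p := by
  have := rpow_le_one_add_rpow (abs_nonneg w) zero_le_two hp
  rwa [Real.rpow_two, sq_abs] at this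

/-- Growth of a nice function and of the three integrands of the mean field operator. -/
theorem IsNice.exists_growth {φ : ℝ → ℝ} (h : IsNice φ) {p : ℝ} (hp : 2 < p) :
    ∃ D : ℝ, 0 ≤ D ∧ (∀ w, φ w ^ 2 ≤ D * (1 + |w| ^ p)) ∧ (∀ w, |deriv φ w| ≤ D) ∧
      (∀ w, deriv φ w ^ 2 ≤ D * (1 + |w| ^ p)) ∧
      (∀ w, (w * deriv φ w) ^ 2 ≤ D * (1 + |w| ^ p)) ∧
      (∀ w, (w ^ 2 * deriv (deriv φ) w) ^ 2 ≤ D * (1 + |w| ^ p)) ∧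
      (∀ w, |w * deriv φ w| ≤ D * (1 + |w| ^ p)) ∧
      ∀ w, |w ^ 2 * deriv (deriv φ) w| ≤ D := by
  obtain ⟨B, hB0, hB1, hB2, hBL, -⟩ := h.exists_bounds
  obtain ⟨E, hE⟩ := (h.hasCompactSupport_deriv_deriv.mul_left (f := fun w : ℝ => w ^ 2)
    ).exists_bound_of_continuous ((continuous_pow 2).mul h.smooth_deriv_deriv.continuous)
  have hE0 : 0 ≤ E := (norm_nonneg _).trans (hE 0)
  have hM : ∀ w : ℝ, 1 ≤ 1 + |w| ^ p := fun w => by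
    have : 0 ≤ |w| ^ p := by positivity
    linarith
  have hd1sq : ∀ w, deriv φ w ^ 2 ≤ B ^ 2 := fun w => sq_le_sq' (by
    have := (abs_le.1 (hB1 w)).1; linarith) (abs_le.1 (hB1 w)).2
  refine ⟨B ^ 2 + B + E + E ^ 2, by positivity, fun w => ?_, fun w => ?_, fun w => ?_,
    fun w => ?_, fun w => ?_, fun w => ?_, fun w => ?_⟩
  · have h1 := hBL w 0
    rw [h.map_zero, sub_zero, sub_zero] at h1
    have h2 : φ w ^ 2 ≤ B ^ 2 * w ^ 2 := by
      rw [← sq_abs, ← sq_abs w, ← mul_pow]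
      gcongr
    have h3 := sq_le_one_add_rpow hp.le w
    calc φ w ^ 2 ≤ B ^ 2 * (1 + |w| ^ p) := h2.trans (by gcongr)
      _ ≤ _ := mul_le_mul_of_nonneg_right (by nlinarith [sq_nonneg E]) (by linarith [hM w])
  · exact (hB1 w).trans (by nlinarith [sq_nonneg E, sq_nonneg B])
  · calc deriv φ w ^ 2 ≤ B ^ 2 * 1 := by rw [mul_one]; exact hd1sq w
      _ ≤ _ := mul_le_mul (by nlinarith [sq_nonneg E]) (hM w) zero_le_one (by positivity)
  · rw [mul_pow, mul_comm]
    exact mul_le_mul ((hd1sq w).trans (by nlinarith [sq_nonneg E])) (sq_le_one_add_rpow hp.le w)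
      (sq_nonneg w) (by positivity)
  · have h1 : (w ^ 2 * deriv (deriv φ) w) ^ 2 ≤ E ^ 2 := by
      rw [← sq_abs]
      exact pow_le_pow_left₀ (abs_nonneg _) (hE w) 2
    calc _ ≤ E ^ 2 * 1 := by rw [mul_one]; exact h1
      _ ≤ _ := mul_le_mul (by nlinarith [sq_nonneg B]) (hM w) zero_le_one (by positivity)
  · rw [abs_mul, mul_comm]
    exact mul_le_mul ((hB1 w).trans (by nlinarith [sq_nonneg E, sq_nonneg B]))
      (abs_le_one_add_rpow (by linarith) w) (abs_nonneg w) (by positivity)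
  · exact (hE w).trans (by nlinarith [sq_nonneg E, sq_nonneg B])

theorem IsNice.exists_abs_meanFieldWeak_le {φ : ℝ → ℝ} (h : IsNice φ) {p : ℝ} (hp : 2 < p)
    (lam B : ℝ) : ∃ C : ℝ, 0 ≤ C ∧ ∀ (ν : Measure ℝ) [IsProbabilityMeasure ν],
      Integrable (fun w => |w| ^ p) ν → ∫ w, |w| ^ p ∂ν ≤ B → |meanFieldWeak lam ν φ| ≤ C := by
  obtain ⟨D, hD0, -, h1, -, -, -, h4, h5⟩ := h.exists_growth hp
  refine ⟨(1 + |B|) * (D * (1 + |B|)) + D * (1 + |B|) + |lam / 2| * (D * (1 + |B|)),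
    by positivity, fun ν _ hν hB => ?_⟩
  have hB' : 1 + ∫ w, |w| ^ p ∂ν ≤ 1 + |B| := by linarith [le_abs_self B]
  have hM : ∀ w : ℝ, 1 ≤ 1 + |w| ^ p := fun w => by
    have : 0 ≤ |w| ^ p := by positivity
    linarith
  have e1 : |∫ w, w ∂ν| ≤ 1 + |B| := by
    have := abs_integral_le_of_moment (c := 1) (h := fun w => w) hν
      (Eventually.of_forall fun w => by rw [one_mul]; exact abs_le_one_add_rpow (by linarith) w)
    linarith
  have e2 : |∫ w, deriv φ w ∂ν| ≤ D * (1 + |B|) :=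
    (abs_integral_le_of_moment hν (Eventually.of_forall fun w =>
      (h1 w).trans (le_mul_of_one_le_right hD0 (hM w)))).trans (by gcongr)
  have e3 : |∫ w, w * deriv φ w ∂ν| ≤ D * (1 + |B|) :=
    (abs_integral_le_of_moment hν (Eventually.of_forall h4)).trans (by gcongr)
  have e4 : |∫ w, w ^ 2 * deriv (deriv φ) w ∂ν| ≤ D * (1 + |B|) :=
    (abs_integral_le_of_moment hν (Eventually.of_forall fun w =>
      (h5 w).trans (le_mul_of_one_le_right hD0 (hM w)))).trans (by gcongr)
  unfold meanFieldWeak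
  refine (abs_add_le _ _).trans (add_le_add ((abs_sub _ _).trans (add_le_add ?_ e3)) ?_)
  · rw [abs_mul]
    exact mul_le_mul e1 e2 (abs_nonneg _) (by positivity)
  · rw [abs_mul]
    exact mul_le_mul_of_nonneg_left e4 (abs_nonneg _)

theorem IsNice.tendsto_meanFieldWeak {φ : ℝ → ℝ} (h : IsNice φ) {p : ℝ} (hp : 2 < p) (lam : ℝ)
    {ι : Type*} {l : Filter ι} {ν : ι → ProbabilityMeasure ℝ} {ν₀ : ProbabilityMeasure ℝ}
    (hν : Tendsto ν l (𝓝 ν₀)) {B : ℝ}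
    (hi : ∀ᶠ i in l, Integrable (fun x => |x| ^ p) (ν i : Measure ℝ) ∧
      ∫ x, |x| ^ p ∂(ν i : Measure ℝ) ≤ B)
    (hi0 : Integrable (fun x => |x| ^ p) (ν₀ : Measure ℝ) ∧ ∫ x, |x| ^ p ∂(ν₀ : Measure ℝ) ≤ B) :
    Tendsto (fun i => meanFieldWeak lam (ν i) φ) l (𝓝 (meanFieldWeak lam ν₀ φ)) := by
  obtain ⟨D, hD0, -, -, h1, h2, h3, -, -⟩ := h.exists_growth hp
  have hc1 := h.smooth_deriv.continuous
  have hc2 := h.smooth_deriv_deriv.continuous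
  have t0 := tendsto_integral_of_moment_bound hν (h := fun w => w) (D := 1) continuous_id
    (fun w => by rw [one_mul]; exact sq_le_one_add_rpow hp.le w) hi hi0
  have t1 := tendsto_integral_of_moment_bound hν hc1 h1 hi hi0
  have t2 := tendsto_integral_of_moment_bound hν (continuous_id.mul hc1) h2 hi hi0
  have t3 := tendsto_integral_of_moment_bound hν ((continuous_pow 2).mul hc2) h3 hi hi0
  exact ((t0.mul t1).sub t2).add (t3.const_mul _)

namespace IsFokkerPlanckApprox

variable {p lam : ℝ} {f₀ : ProbabilityMeasure ℝ} {g : ℕ → ℝ → ProbabilityMeasure ℝ}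

theorem comp (h : IsFokkerPlanckApprox p lam f₀ g) {k : ℕ → ℕ} (hk : StrictMono k) :
    IsFokkerPlanckApprox p lam f₀ (fun n => g (k n)) := by
  refine ⟨fun n => h.support (k n), fun T => ?_, fun T ε hε => ?_, fun φ hφ => ?_⟩
  · obtain ⟨B, hB⟩ := h.moment T
    exact ⟨B, fun n => hB (k n)⟩
  · obtain ⟨K, b, hb, hK⟩ := h.regular T ε hε
    exact ⟨K, fun n => b (k n), hb.comp hk.tendsto_atTop, fun n => hK (k n)⟩
  · obtain ⟨Q, hQ, hQe⟩ := h.equation φ hφ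
    refine ⟨fun n => Q (k n), fun n => hQ (k n), fun T => ?_⟩
    obtain ⟨e, he, hle⟩ := hQe T
    exact ⟨fun n => e (k n), he.comp hk.tendsto_atTop, fun n => hle (k n)⟩

/-- Any weak limit at a fixed time is a wealth density. Quantitative absolute continuity passes to the
limit on open sets, by the portmanteau theorem, and null sets have small open neighbourhoods. -/
theorem isWealthDensity_of_tendsto (h : IsFokkerPlanckApprox p lam f₀ g) (hp : 2 < p) {τ : ℝ}
    (hτ : 0 ≤ τ) {ν : ProbabilityMeasure ℝ} (hν : Tendsto (fun n => g n τ) atTop (𝓝 ν)) :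
    IsWealthDensity p ν := by
  refine ⟨?_, ?_, ?_⟩
  · have := ProbabilityMeasure.le_liminf_measure_open_of_tendsto hν (isOpen_Iio (a := (0 : ℝ)))
    simpa [h.support _ τ hτ] using this
  · refine Measure.AbsolutelyContinuous.mk fun A _ hA0 => ?_
    refine le_antisymm (ENNReal.le_of_forall_pos_le_add fun ε hε _ => ?_) (zero_le)
    have hε' : (0 : ℝ) < ε / 2 := by
      have : (0 : ℝ) < ε := hε
      linarith
    obtain ⟨K, b, hb, hK⟩ := h.regular τ (ε / 2) hε'
    set η : ℝ := ε / 2 / (|K| + 1) with hη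
    have hη0 : 0 < η := by positivity
    obtain ⟨U, hAU, hU, hUlt⟩ := A.exists_isOpen_lt_add (μ := volume) (by rw [hA0]; simp)
      (ε := ENNReal.ofReal η) (by simpa using hη0)
    rw [hA0, zero_add] at hUlt
    have h1 := ProbabilityMeasure.le_liminf_measure_open_of_tendsto hν hU
    have h2 : Tendsto (fun n => ENNReal.ofReal K * volume U + ENNReal.ofReal (ε / 2 + b n)) atTop
        (𝓝 (ENNReal.ofReal K * volume U + ENNReal.ofReal (ε / 2 + 0))) :=
      tendsto_const_nhds.add (ENNReal.tendsto_ofReal (tendsto_const_nhds.add hb))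
    have h3 : (ν : Measure ℝ) U ≤ ENNReal.ofReal K * volume U + ENNReal.ofReal (ε / 2) := by
      rw [add_zero] at h2
      rw [← h2.liminf_eq]
      exact h1.trans (liminf_le_liminf (Eventually.of_forall fun n =>
        hK n τ hτ le_rfl U hU.measurableSet))
    calc (ν : Measure ℝ) A ≤ (ν : Measure ℝ) U := measure_mono hAU
      _ ≤ ENNReal.ofReal K * volume U + ENNReal.ofReal (ε / 2) := h3
      _ ≤ ENNReal.ofReal |K| * ENNReal.ofReal η + ENNReal.ofReal (ε / 2) := by
        gcongr
        exact le_abs_self K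
      _ = ENNReal.ofReal (|K| * η + ε / 2) := by
        rw [← ENNReal.ofReal_mul (abs_nonneg K), ← ENNReal.ofReal_add (by positivity) hε'.le]
      _ ≤ ENNReal.ofReal ε := by
        refine ENNReal.ofReal_le_ofReal ?_
        have : |K| * η ≤ ε / 2 := by
          rw [hη, mul_div_assoc', div_le_iff₀ (by positivity)]
          nlinarith [abs_nonneg K]
        linarith
      _ = 0 + ε := by rw [ENNReal.ofReal_coe_nnreal, zero_add]
  · obtain ⟨B, hB⟩ := h.moment τ
    exact (moment_le_of_tendsto hν (by linarith) fun n => hB n τ hτ le_rfl).1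

/-- Equicontinuity in time, tested on nice functions. -/
theorem exists_lipschitz (h : IsFokkerPlanckApprox p lam f₀ g) (hp : 2 < p) {φ : ℝ → ℝ}
    (hφ : IsNice φ) (T : ℝ) : ∃ L : ℝ, 0 ≤ L ∧ ∀ n s τ, 0 ≤ s → s ≤ T → 0 ≤ τ → τ ≤ T →
      |∫ w, φ w ∂(g n τ : Measure ℝ) - ∫ w, φ w ∂(g n s : Measure ℝ)| ≤ L * |τ - s| := by
  obtain ⟨Q, hQ, hQe⟩ := h.equation φ hφ
  obtain ⟨e, he, hle⟩ := hQe T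
  obtain ⟨B, hB⟩ := h.moment T
  obtain ⟨C, hC0, hC⟩ := hφ.exists_abs_meanFieldWeak_le hp lam B
  obtain ⟨E, hE⟩ := (Metric.isBounded_range_of_tendsto e he).exists_norm_le
  have hE' : ∀ n, |e n| ≤ E := fun n => hE _ (mem_range_self n)
  have hE0 : 0 ≤ E := (abs_nonneg _).trans (hE' 0)
  refine ⟨E + C, by positivity, fun n s τ hs hsT hτ hτT => ?_⟩
  have hQb : ∀ r, 0 ≤ r → r ≤ T → |Q n r| ≤ E + C := fun r hr hrT => by
    have h1 := hle n r hr hrT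
    have h2 := hC (g n r) (hB n r hr hrT).1 (hB n r hr hrT).2
    have h3 := abs_add_le (Q n r - meanFieldWeak lam (g n r) φ) (meanFieldWeak lam (g n r) φ)
    rw [sub_add_cancel] at h3
    linarith [le_abs_self (e n), hE' n]
  rw [(hQ n τ hτ).2, (hQ n s hs).2, add_sub_add_left_eq_sub,
    intervalIntegral.integral_interval_sub_left (hQ n τ hτ).1 (hQ n s hs).1]
  refine intervalIntegral.norm_integral_le_of_norm_le_const (f := Q n) (a := s) (b := τ)
    (C := E + C) fun r hr => ?_
  rcases le_total s τ with hst | hst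
  · rw [uIoc_of_le hst] at hr
    exact hQb r (hs.trans hr.1.le) (hr.2.trans hτT)
  · rw [uIoc_of_ge hst] at hr
    exact hQb r (hτ.trans hr.1.le) (hr.2.trans hsT)

theorem isCompact_closure (h : IsFokkerPlanckApprox p lam f₀ g) (hp : 2 < p) {τ : ℝ}
    (hτ : 0 ≤ τ) : IsCompact (closure (range fun n => g n τ)) := by
  obtain ⟨B, hB⟩ := h.moment τ
  refine isCompact_closure_of_isTightMeasureSet
    (isTightMeasureSet_of_moment_bound (p := p) (B := B) (by linarith) ?_)
  rintro _ ⟨_, ⟨n, rfl⟩, rfl⟩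
  exact ⟨inferInstance, hB n τ hτ le_rfl⟩

/-- Compactness: Prokhorov's theorem and a diagonal argument at rational times, equicontinuity at
all other times. -/
theorem exists_subseq (h : IsFokkerPlanckApprox p lam f₀ g) (hp : 2 < p) :
    ∃ (k : ℕ → ℕ) (G : ℝ → ProbabilityMeasure ℝ), StrictMono k ∧
      ∀ τ, 0 ≤ τ → Tendsto (fun j => g (k j) τ) atTop (𝓝 (G τ)) := by
  -- absolute values keep the rational times nonnegative
  have hcpt : IsCompact (Set.pi univ fun r : ℚ => closure (range fun n => g n |(r : ℝ)|)) :=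
    isCompact_univ_pi fun r => h.isCompact_closure hp (abs_nonneg _)
  obtain ⟨a, -, k, hk, hka⟩ := hcpt.tendsto_subseq (x := fun n (r : ℚ) => g n |(r : ℝ)|)
    fun n r _ => subset_closure (mem_range_self n)
  have hrat : ∀ r : ℚ, Tendsto (fun j => g (k j) |(r : ℝ)|) atTop (𝓝 (a r)) := fun r =>
    (tendsto_pi_nhds.1 hka) r
  have hk' := h.comp hk
  have hbump : ∀ τ, 0 ≤ τ → ∀ φ, IsBump φ →
      ∃ x, Tendsto (fun j => ∫ w, φ w ∂(g (k j) τ : Measure ℝ)) atTop (𝓝 x) := by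
    intro τ hτ φ hφ
    refine cauchySeq_tendsto_of_complete (Metric.cauchySeq_iff'.2 fun ε hε => ?_)
    obtain ⟨L, hL0, hL⟩ := hk'.exists_lipschitz hp hφ.nice (τ + 1)
    obtain ⟨r, hr1, hr2⟩ := exists_rat_btwn (show τ < τ + min 1 (ε / (4 * (L + 1))) by
      have : 0 < min 1 (ε / (4 * (L + 1))) := lt_min one_pos (by positivity)
      linarith)
    have hr0 : (0 : ℝ) ≤ r := hτ.trans hr1.le
    have hrT : (r : ℝ) ≤ τ + 1 := hr2.le.trans (by gcongr; exact min_le_left _ _)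
    have hrd : L * |τ - r| ≤ ε / 4 := by
      rw [abs_sub_comm, abs_of_nonneg (by linarith)]
      have h1 : (r : ℝ) - τ ≤ ε / (4 * (L + 1)) := by
        have := min_le_right 1 (ε / (4 * (L + 1)))
        linarith
      calc L * ((r : ℝ) - τ) ≤ (L + 1) * (ε / (4 * (L + 1))) := by
            refine mul_le_mul (by linarith) h1 (by linarith) (by linarith)
        _ = ε / 4 := by field_simp
    have hconv : Tendsto (fun j => ∫ w, φ w ∂(g (k j) r : Measure ℝ)) atTop
        (𝓝 (∫ w, φ w ∂(a r : Measure ℝ))) := by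
      have h1 := hrat r
      rw [abs_of_nonneg hr0] at h1
      exact (ProbabilityMeasure.tendsto_iff_forall_integral_tendsto.1 h1)
        (BoundedContinuousFunction.ofNormedAddCommGroup φ hφ.nice.continuous 1 fun x => by
          rw [Real.norm_eq_abs, abs_of_nonneg (hφ.mem_Icc x).1]; exact (hφ.mem_Icc x).2)
    obtain ⟨N, hN⟩ := (Metric.cauchySeq_iff'.1 hconv.cauchySeq) (ε / 4) (by linarith)
    refine ⟨N, fun n hn => ?_⟩
    have h1 := hN n hn
    rw [Real.dist_eq] at h1 ⊢
    have h2 := hL n r τ hr0 hrT hτ (by linarith)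
    have h3 := hL N r τ hr0 hrT hτ (by linarith)
    have h4 := abs_lt.1 h1
    have h5 := abs_le.1 h2
    have h6 := abs_le.1 h3
    rw [abs_lt]
    constructor <;> linarith [h4.1, h4.2, h5.1, h5.2, h6.1, h6.2]
  have hex : ∀ τ, ∃ ν : ProbabilityMeasure ℝ, 0 ≤ τ → Tendsto (fun j => g (k j) τ) atTop (𝓝 ν) := by
    intro τ
    by_cases hτ : 0 ≤ τ
    · obtain ⟨ν, -, s, hs, hν⟩ := (hk'.isCompact_closure hp hτ).tendsto_subseq
        (x := fun j => g (k j) τ) fun n => subset_closure (mem_range_self n)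
      refine ⟨ν, fun _ => tendsto_of_forall_isBump
        ((hk'.comp hs).isWealthDensity_of_tendsto hp hτ hν).measure_Iic fun φ hφ => ?_⟩
      obtain ⟨x, hx⟩ := hbump τ hτ φ hφ
      have h1 := (ProbabilityMeasure.tendsto_iff_forall_integral_tendsto.1 hν)
        (BoundedContinuousFunction.ofNormedAddCommGroup φ hφ.nice.continuous 1 fun x => by
          rw [Real.norm_eq_abs, abs_of_nonneg (hφ.mem_Icc x).1]; exact (hφ.mem_Icc x).2)
      have h2 := tendsto_nhds_unique h1 (hx.comp hs.tendsto_atTop)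
      rw [BoundedContinuousFunction.coe_ofNormedAddCommGroup] at h2
      rwa [h2]
    · exact ⟨f₀, fun h => absurd h hτ⟩
  choose G hG using hex
  exact ⟨k, G, hk, fun τ hτ => hG τ hτ⟩

end IsFokkerPlanckApprox

/-! ### The limit curve -/

/-- A weakly continuous curve of wealth densities that solves the Fokker-Planck equation with a
self-consistent mean, tested on nice functions and integrated in time. -/
structure IsMeanFieldCurve (p lam : ℝ) (f₀ : ProbabilityMeasure ℝ)
    (g : ℝ → ProbabilityMeasure ℝ) : Prop where
  density : ∀ τ, 0 ≤ τ → IsWealthDensity p (g τ)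
  moment : ∀ T, ∃ B, ∀ τ, 0 ≤ τ → τ ≤ T → ∫ w, |w| ^ p ∂(g τ : Measure ℝ) ≤ B
  continuous : ContinuousOn g (Ici 0)
  equation : ∀ φ, IsNice φ → ∀ τ, 0 ≤ τ →
    ∫ w, φ w ∂(g τ : Measure ℝ) = ∫ w, φ w ∂(f₀ : Measure ℝ)
      + ∫ r in (0 : ℝ)..τ, meanFieldWeak lam (g r) φ

/-- Every pointwise weak limit of an approximate solution solves the limit equation. -/
theorem IsFokkerPlanckApprox.isMeanFieldCurve {p lam : ℝ} {f₀ : ProbabilityMeasure ℝ}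
    {g : ℕ → ℝ → ProbabilityMeasure ℝ} (h : IsFokkerPlanckApprox p lam f₀ g) (hp : 2 < p)
    {G : ℝ → ProbabilityMeasure ℝ}
    (hG : ∀ τ, 0 ≤ τ → Tendsto (fun n => g n τ) atTop (𝓝 (G τ))) :
    IsMeanFieldCurve p lam f₀ G := by
  have hd : ∀ τ, 0 ≤ τ → IsWealthDensity p (G τ) := fun τ hτ =>
    h.isWealthDensity_of_tendsto hp hτ (hG τ hτ)
  have hm : ∀ T, ∃ B, (∀ n τ, 0 ≤ τ → τ ≤ T → Integrable (fun w => |w| ^ p) (g n τ : Measure ℝ) ∧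
      ∫ w, |w| ^ p ∂(g n τ : Measure ℝ) ≤ B) ∧ ∀ τ, 0 ≤ τ → τ ≤ T →
      Integrable (fun w => |w| ^ p) (G τ : Measure ℝ) ∧ ∫ w, |w| ^ p ∂(G τ : Measure ℝ) ≤ B := by
    intro T
    obtain ⟨B, hB⟩ := h.moment T
    exact ⟨B, hB, fun τ hτ hτT =>
      moment_le_of_tendsto (hG τ hτ) (by linarith) fun n => hB n τ hτ hτT⟩
  have hconv : ∀ φ, IsNice φ → ∀ τ, 0 ≤ τ → Tendsto (fun n => ∫ w, φ w ∂(g n τ : Measure ℝ)) atTop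
      (𝓝 (∫ w, φ w ∂(G τ : Measure ℝ))) := by
    intro φ hφ τ hτ
    obtain ⟨B, hB, hB'⟩ := hm τ
    obtain ⟨D, -, hD, -⟩ := hφ.exists_growth hp
    exact tendsto_integral_of_moment_bound (hG τ hτ) hφ.continuous hD
      (Eventually.of_forall fun n => hB n τ hτ le_rfl) (hB' τ hτ le_rfl)
  refine ⟨hd, fun T => ?_, fun τ hτ => ?_, fun φ hφ τ hτ => ?_⟩
  · obtain ⟨B, -, hB⟩ := hm T
    exact ⟨B, fun τ hτ hτT => (hB τ hτ hτT).2⟩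
  · have : (𝓝[Ici (0 : ℝ)] τ).NeBot := mem_closure_iff_nhdsWithin_neBot.1 (subset_closure hτ)
    refine tendsto_of_forall_isBump (hd τ hτ).measure_Iic fun φ hφ => ?_
    obtain ⟨L, hL0, hL⟩ := h.exists_lipschitz hp hφ.nice (τ + 1)
    have hLip : ∀ s, 0 ≤ s → s ≤ τ + 1 →
        |∫ w, φ w ∂(G s : Measure ℝ) - ∫ w, φ w ∂(G τ : Measure ℝ)| ≤ L * |s - τ| := by
      intro s hs hsT
      exact le_of_tendsto ((hconv φ hφ.nice s hs).sub (hconv φ hφ.nice τ hτ)).abs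
        (Eventually.of_forall fun n => hL n τ s hτ (by linarith) hs hsT)
    rw [tendsto_iff_dist_tendsto_zero]
    have hz : Tendsto (fun s => L * |s - τ|) (𝓝[Ici 0] τ) (𝓝 0) := by
      have : Continuous fun s => L * |s - τ| := by fun_prop
      have h1 := this.tendsto τ
      simp only [sub_self, abs_zero, mul_zero] at h1
      exact h1.mono_left nhdsWithin_le_nhds
    refine squeeze_zero' (Eventually.of_forall fun s => dist_nonneg) ?_ hz
    filter_upwards [self_mem_nhdsWithin,
      mem_nhdsWithin_of_mem_nhds (Iio_mem_nhds (show τ < τ + 1 by linarith))] with s hs hs1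
    rw [Real.dist_eq]
    exact hLip s hs (le_of_lt hs1)
  · obtain ⟨Q, hQ, hQe⟩ := h.equation φ hφ
    obtain ⟨e, he, hle⟩ := hQe τ
    obtain ⟨B, hB, hB'⟩ := hm τ
    obtain ⟨C, hC0, hC⟩ := hφ.exists_abs_meanFieldWeak_le hp lam B
    obtain ⟨E, hE⟩ := (Metric.isBounded_range_of_tendsto e he).exists_norm_le
    have hE' : ∀ n, |e n| ≤ E := fun n => hE _ (mem_range_self n)
    have hlim : Tendsto (fun n => ∫ r in (0 : ℝ)..τ, Q n r) atTop
        (𝓝 (∫ r in (0 : ℝ)..τ, meanFieldWeak lam (G r) φ)) := by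
      refine intervalIntegral.tendsto_integral_filter_of_dominated_convergence (fun _ => E + C)
        (Eventually.of_forall fun n => ?_) (Eventually.of_forall fun n =>
        Eventually.of_forall fun r hr => ?_) intervalIntegrable_const
        (Eventually.of_forall fun r hr => ?_)
      · rw [uIoc_of_le hτ]
        exact (hQ n τ hτ).1.1.aestronglyMeasurable
      · rw [uIoc_of_le hτ] at hr
        have h1 := hle n r hr.1.le hr.2
        have h2 := hC (g n r) (hB n r hr.1.le hr.2).1 (hB n r hr.1.le hr.2).2
        have h3 := abs_add_le (Q n r - meanFieldWeak lam (g n r) φ) (meanFieldWeak lam (g n r) φ)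
        rw [sub_add_cancel] at h3
        rw [Real.norm_eq_abs]
        linarith [le_abs_self (e n), hE' n]
      · rw [uIoc_of_le hτ] at hr
        have h1 := hφ.tendsto_meanFieldWeak hp lam (hG r hr.1.le)
          (Eventually.of_forall fun n => hB n r hr.1.le hr.2) (hB' r hr.1.le hr.2)
        have h2 : Tendsto (fun n => Q n r - meanFieldWeak lam (g n r) φ) atTop (𝓝 0) :=
          squeeze_zero_norm (fun n => hle n r hr.1.le hr.2) he
        simpa using h2.add h1
    refine tendsto_nhds_unique (hconv φ hφ τ hτ) ?_
    have h1 : (fun n => ∫ w, φ w ∂(g n τ : Measure ℝ)) =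
        fun n => ∫ w, φ w ∂(f₀ : Measure ℝ) + ∫ r in (0 : ℝ)..τ, Q n r :=
      funext fun n => (hQ n τ hτ).2
    rw [h1]
    exact tendsto_const_nhds.add hlim

/-! ### Stability of the limit equation -/

theorem ContDiff.integral_primitive {ψ : ℝ → ℝ} (hψ : ContDiff ℝ ∞ ψ) :
    ContDiff ℝ ∞ (fun x => ∫ t in (0 : ℝ)..x, ψ t) ∧
      deriv (fun x => ∫ t in (0 : ℝ)..x, ψ t) = ψ := by
  have hd : ∀ x, HasDerivAt (fun x => ∫ t in (0 : ℝ)..x, ψ t) (ψ x) x := fun x =>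
    (hψ.continuous.integral_hasStrictDerivAt 0 x).hasDerivAt
  have he : deriv (fun x => ∫ t in (0 : ℝ)..x, ψ t) = ψ := funext fun x => (hd x).deriv
  refine ⟨contDiff_infty_iff_deriv.2 ⟨fun x => (hd x).differentiableAt, ?_⟩, he⟩
  rwa [he]

theorem integral_primitive_eq_zero {ψ : ℝ → ℝ} {a : ℝ} (ha : 0 < a) (h0 : ∀ x ≤ a, ψ x = 0) {x : ℝ}
    (hx : x ≤ a) : ∫ t in (0 : ℝ)..x, ψ t = 0 := by
  refine intervalIntegral.integral_zero_ae (Eventually.of_forall fun t ht => h0 t ?_)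
  exact (uIoc_subset_uIcc ht).2.trans (max_le ha.le hx)

theorem isNice_primitive {ψ : ℝ → ℝ} (hψ : ContDiff ℝ ∞ ψ) {a b : ℝ} (ha : 0 < a)
    (h0 : ∀ x ≤ a, ψ x = 0) (hb : ∀ x ≥ b, deriv ψ x = 0) :
    IsNice (fun x => ∫ t in (0 : ℝ)..x, ψ t) :=
  ⟨hψ.integral_primitive.1, ⟨a, ha, fun _ hx => integral_primitive_eq_zero ha h0 hx⟩, b, by
    rwa [hψ.integral_primitive.2]⟩

namespace IsMeanFieldCurve

variable {p lam : ℝ} {f₀ : ProbabilityMeasure ℝ} {g : ℝ → ProbabilityMeasure ℝ}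

theorem continuousOn_meanFieldWeak (h : IsMeanFieldCurve p lam f₀ g) (hp : 2 < p) {φ : ℝ → ℝ}
    (hφ : IsNice φ) : ContinuousOn (fun r => meanFieldWeak lam (g r) φ) (Ici 0) := by
  intro τ hτ
  obtain ⟨B, hB⟩ := h.moment (τ + 1)
  refine hφ.tendsto_meanFieldWeak hp lam (h.continuous τ hτ) (B := B) ?_
    ⟨(h.density τ hτ).moment, hB τ hτ (by linarith)⟩
  filter_upwards [self_mem_nhdsWithin,
    mem_nhdsWithin_of_mem_nhds (Iio_mem_nhds (show τ < τ + 1 by linarith))] with s hs hs1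
  exact ⟨(h.density s hs).moment, hB s hs (le_of_lt hs1)⟩

/-- The limit equation is stable under pointwise convergence of the test functions and of their
first two derivatives on `(0, ∞)`, if the functions that enter the equation are dominated by a
multiple of `1 + |w| ^ p`. -/
theorem equation_of_tendsto (h : IsMeanFieldCurve p lam f₀ g) (hp : 2 < p)
    (hf₀ : IsWealthDensity p f₀) {φ : ℕ → ℝ → ℝ} (hφ : ∀ k, IsNice (φ k)) {d₀ d₁ d₂ : ℝ → ℝ} {C : ℝ}
    (hb₀ : ∀ k, ∀ w > 0, |φ k w| ≤ C * (1 + |w| ^ p))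
    (hb₁ : ∀ k, ∀ w > 0, |deriv (φ k) w| ≤ C * (1 + |w| ^ p))
    (hb₁' : ∀ k, ∀ w > 0, |w * deriv (φ k) w| ≤ C * (1 + |w| ^ p))
    (hb₂ : ∀ k, ∀ w > 0, |w ^ 2 * deriv (deriv (φ k)) w| ≤ C * (1 + |w| ^ p))
    (ht₀ : ∀ w > 0, Tendsto (fun k => φ k w) atTop (𝓝 (d₀ w)))
    (ht₁ : ∀ w > 0, Tendsto (fun k => deriv (φ k) w) atTop (𝓝 (d₁ w)))
    (ht₂ : ∀ w > 0, Tendsto (fun k => w ^ 2 * deriv (deriv (φ k)) w) atTop (𝓝 (w ^ 2 * d₂ w)))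
    {τ : ℝ} (hτ : 0 ≤ τ) {R : ℝ → ℝ}
    (hR : ∀ r, 0 ≤ r → R r = (∫ w, w ∂(g r : Measure ℝ)) * (∫ w, d₁ w ∂(g r : Measure ℝ))
      - ∫ w, w * d₁ w ∂(g r : Measure ℝ) + lam / 2 * ∫ w, w ^ 2 * d₂ w ∂(g r : Measure ℝ)) :
    IntervalIntegrable R volume 0 τ ∧
      ∫ w, d₀ w ∂(g τ : Measure ℝ) = ∫ w, d₀ w ∂(f₀ : Measure ℝ) + ∫ r in (0 : ℝ)..τ, R r := by
  obtain ⟨B, hB⟩ := h.moment τ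
  have hbd : ∀ ν : ProbabilityMeasure ℝ, IsWealthDensity p ν →
      Integrable (fun w => C * (1 + |w| ^ p)) (ν : Measure ℝ) := fun ν hν =>
    ((integrable_const (1 : ℝ)).add hν.moment).const_mul C
  have hlim : ∀ ν : ProbabilityMeasure ℝ, IsWealthDensity p ν → ∀ (u : ℕ → ℝ → ℝ) (v : ℝ → ℝ),
      (∀ k, Continuous (u k)) → (∀ k, ∀ w > 0, |u k w| ≤ C * (1 + |w| ^ p)) →
      (∀ w > 0, Tendsto (fun k => u k w) atTop (𝓝 (v w))) →
      Tendsto (fun k => ∫ w, u k w ∂(ν : Measure ℝ)) atTop (𝓝 (∫ w, v w ∂(ν : Measure ℝ))) := by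
    intro ν hν u v hu hub hut
    refine tendsto_integral_of_dominated_convergence _ (fun k => (hu k).aestronglyMeasurable)
      (hbd ν hν) (fun k => ?_) ?_
    · filter_upwards [hν.ae_pos] with w hw using hub k w hw
    · filter_upwards [hν.ae_pos] with w hw using hut w hw
  have hc0 : ∀ k, Continuous (φ k) := fun k => (hφ k).continuous
  have hc1 : ∀ k, Continuous (deriv (φ k)) := fun k => (hφ k).smooth_deriv.continuous
  have hc2 : ∀ k, Continuous (deriv (deriv (φ k))) := fun k =>
    (hφ k).smooth_deriv_deriv.continuous
  have hRlim : ∀ r, 0 ≤ r → Tendsto (fun k => meanFieldWeak lam (g r) (φ k)) atTop (𝓝 (R r)) := by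
    intro r hr
    have hd := h.density r hr
    rw [hR r hr]
    exact (((hlim _ hd _ _ hc1 hb₁ ht₁).const_mul _).sub
      (hlim _ hd _ (fun w => w * d₁ w) (fun k => continuous_id.mul (hc1 k)) hb₁'
        (fun w hw => (ht₁ w hw).const_mul w))).add
      ((hlim _ hd _ _ (fun k => (continuous_pow 2).mul (hc2 k)) hb₂ ht₂).const_mul _)
  have hC0 : 0 ≤ C := by
    have h1 := (abs_nonneg _).trans (hb₀ 0 1 one_pos)
    have : (0 : ℝ) < 1 + |1| ^ p := by positivity
    exact nonneg_of_mul_nonneg_left h1 this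
  -- a bound for the right-hand sides, uniform in time and along the sequence
  obtain ⟨E, hE⟩ : ∃ E : ℝ, ∀ k r, 0 ≤ r → r ≤ τ → |meanFieldWeak lam (g r) (φ k)| ≤ E := by
    refine ⟨(1 + |B|) * (C * (1 + |B|)) + C * (1 + |B|) + |lam / 2| * (C * (1 + |B|)),
      fun k r hr hrτ => ?_⟩
    have hd := h.density r hr
    have hB' : 1 + ∫ w, |w| ^ p ∂(g r : Measure ℝ) ≤ 1 + |B| := by
      linarith [le_abs_self B, hB r hr hrτ]
    have e1 : |∫ w, w ∂(g r : Measure ℝ)| ≤ 1 + |B| := by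
      have := abs_integral_le_of_moment (c := 1) (h := fun w => w) hd.moment
        (Eventually.of_forall fun w => by rw [one_mul]; exact abs_le_one_add_rpow (by linarith) w)
      linarith
    have key : ∀ u : ℝ → ℝ, (∀ w > 0, |u w| ≤ C * (1 + |w| ^ p)) →
        |∫ w, u w ∂(g r : Measure ℝ)| ≤ C * (1 + |B|) := by
      intro u hu
      refine (abs_integral_le_of_moment hd.moment ?_).trans (mul_le_mul_of_nonneg_left hB' hC0)
      filter_upwards [hd.ae_pos] with w hw using hu w hw
    unfold meanFieldWeak
    refine (abs_add_le _ _).trans (add_le_add ((abs_sub _ _).trans (add_le_add ?_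
      (key _ (hb₁' k)))) ?_)
    · rw [abs_mul]
      exact mul_le_mul e1 (key _ (hb₁ k)) (abs_nonneg _) (by positivity)
    · rw [abs_mul]
      exact mul_le_mul_of_nonneg_left (key _ (hb₂ k)) (abs_nonneg _)
  have hmeas : ∀ k, AEStronglyMeasurable (fun r => meanFieldWeak lam (g r) (φ k))
      (volume.restrict (uIoc 0 τ)) := fun k => by
    rw [uIoc_of_le hτ]
    exact ((h.continuousOn_meanFieldWeak hp (hφ k)).mono
      (Ioc_subset_Icc_self.trans Icc_subset_Ici_self)).aestronglyMeasurable measurableSet_Ioc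
  have hmem : ∀ r ∈ uIoc 0 τ, 0 ≤ r ∧ r ≤ τ := fun r hr => by
    rw [uIoc_of_le hτ] at hr
    exact ⟨hr.1.le, hr.2⟩
  refine ⟨?_, ?_⟩
  · refine (intervalIntegrable_const (c := E)).mono_fun'
      (aestronglyMeasurable_of_tendsto_ae atTop hmeas ?_) ?_
    · filter_upwards [ae_restrict_mem measurableSet_uIoc] with r hr using hRlim r (hmem r hr).1
    · filter_upwards [ae_restrict_mem measurableSet_uIoc] with r hr
      exact le_of_tendsto (hRlim r (hmem r hr).1).abs
        (Eventually.of_forall fun k => hE k r (hmem r hr).1 (hmem r hr).2)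
  · have hint : Tendsto (fun k => ∫ r in (0 : ℝ)..τ, meanFieldWeak lam (g r) (φ k)) atTop
        (𝓝 (∫ r in (0 : ℝ)..τ, R r)) :=
      intervalIntegral.tendsto_integral_filter_of_dominated_convergence (fun _ => E)
        (Eventually.of_forall hmeas)
        (Eventually.of_forall fun k => Eventually.of_forall fun r hr =>
          hE k r (hmem r hr).1 (hmem r hr).2) intervalIntegrable_const
        (Eventually.of_forall fun r hr => hRlim r (hmem r hr).1)
    refine tendsto_nhds_unique (hlim _ (h.density τ hτ) _ _ hc0 hb₀ ht₀) ?_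
    refine ((hlim _ hf₀ _ _ hc0 hb₀ ht₀).add hint).congr fun k => ?_
    exact (h.equation _ (hφ k) τ hτ).symm

end IsMeanFieldCurve

/-! ### Conservation of the mean -/

theorem exists_isNice_deriv_eq_one : ∃ φ, IsNice φ ∧ ∀ x ≥ 2, deriv φ x = 1 := by
  have hs : ContDiff ℝ ∞ fun x : ℝ => Real.smoothTransition (x - 1) :=
    Real.smoothTransition.contDiff.comp (contDiff_id.sub contDiff_const)
  refine ⟨_, isNice_primitive hs (a := 1) (b := 3) one_pos (fun x hx => ?_) (fun x hx => ?_),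
    fun x hx => ?_⟩
  · exact Real.smoothTransition.zero_of_nonpos (by linarith)
  · have : (fun x : ℝ => Real.smoothTransition (x - 1)) =ᶠ[𝓝 x] fun _ => 1 := by
      filter_upwards [Ioi_mem_nhds (show 2 < x by linarith)] with y hy
      exact Real.smoothTransition.one_of_one_le (by have : 2 < y := hy; linarith)
    rw [this.deriv_eq]
    simp
  · rw [hs.integral_primitive.2]
    exact Real.smoothTransition.one_of_one_le (by linarith)

/-- Conservation of the mean, from the test functions `φ (k w) / k`, which tend to `w`. -/
theorem IsMeanFieldCurve.integral_id {p lam : ℝ} {f₀ : ProbabilityMeasure ℝ}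
    {g : ℝ → ProbabilityMeasure ℝ} (h : IsMeanFieldCurve p lam f₀ g) (hp : 2 < p)
    (hf₀ : IsWealthDensity p f₀) {τ : ℝ} (hτ : 0 ≤ τ) :
    ∫ w, w ∂(g τ : Measure ℝ) = ∫ w, w ∂(f₀ : Measure ℝ) := by
  obtain ⟨φ, hφ, hφ1⟩ := exists_isNice_deriv_eq_one
  obtain ⟨D, hD0, -, hD1, -, -, -, -, hD2⟩ := hφ.exists_growth hp
  have hφ2 : ∀ x > 2, deriv (deriv φ) x = 0 := fun x hx => by
    have : deriv φ =ᶠ[𝓝 x] fun _ => 1 := by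
      filter_upwards [Ioi_mem_nhds hx] with y hy using hφ1 y (le_of_lt hy)
    rw [this.deriv_eq]
    simp
  have hlip : ∀ x, |φ x| ≤ D * |x| := fun x => by
    have := Convex.norm_image_sub_le_of_norm_hasDerivWithin_le (f := φ) (f' := deriv φ) (C := D)
      (fun y _ => (hφ.hasDerivAt y).hasDerivWithinAt) (fun y _ => hD1 y) convex_univ
      (mem_univ 0) (mem_univ x)
    rwa [hφ.map_zero, sub_zero, sub_zero] at this
  have hK : ∀ k : ℕ, (0 : ℝ) < k + 1 := fun k => by positivity
  have d1 : ∀ (k : ℕ) (w : ℝ), deriv (fun w => φ ((k + 1 : ℝ) * w) / (k + 1)) w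
      = deriv φ ((k + 1 : ℝ) * w) := fun k w => by
    have e := ((hφ.hasDerivAt ((k + 1 : ℝ) * w)).comp w
      ((hasDerivAt_id w).const_mul (k + 1 : ℝ))).div_const (k + 1 : ℝ)
    rw [mul_one, mul_div_cancel_right₀ _ (hK k).ne'] at e
    exact e.deriv
  have d2 : ∀ (k : ℕ) (w : ℝ), deriv (deriv fun w => φ ((k + 1 : ℝ) * w) / (k + 1)) w
      = deriv (deriv φ) ((k + 1 : ℝ) * w) * (k + 1) := fun k w => by
    have e := (hφ.hasDerivAt_deriv ((k + 1 : ℝ) * w)).comp w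
      ((hasDerivAt_id w).const_mul (k + 1 : ℝ))
    rw [mul_one] at e
    rw [funext (d1 k)]
    exact e.deriv
  have hnice : ∀ k : ℕ, IsNice (fun w => φ ((k + 1 : ℝ) * w) / (k + 1)) := fun k => by
    obtain ⟨a, ha, hφa⟩ := hφ.zero_near
    refine ⟨(hφ.smooth.comp (contDiff_const.mul contDiff_id)).div_const _,
      ⟨a / (k + 1), div_pos ha (hK k), fun x hx => ?_⟩, 3, fun x hx => ?_⟩
    · rw [le_div_iff₀ (hK k), mul_comm] at hx
      rw [hφa _ hx, zero_div]
    · rw [d2, hφ2, zero_mul]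
      have : (0 : ℝ) ≤ k := k.cast_nonneg
      nlinarith
  have hM : ∀ w : ℝ, 1 ≤ 1 + |w| ^ p := fun w => by
    have : 0 ≤ |w| ^ p := by positivity
    linarith
  have hfar : ∀ w > (0 : ℝ), ∀ᶠ k : ℕ in atTop, 2 < (k + 1 : ℝ) * w := fun w hw => by
    have : Tendsto (fun k : ℕ => (k + 1 : ℝ) * w) atTop atTop :=
      (tendsto_natCast_atTop_atTop.atTop_add tendsto_const_nhds).atTop_mul_const hw
    exact this.eventually_gt_atTop 2
  have hDw : ∀ w : ℝ, D * |w| ≤ D * (1 + |w| ^ p) := fun w =>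
    mul_le_mul_of_nonneg_left (abs_le_one_add_rpow (by linarith) w) hD0
  refine (h.equation_of_tendsto hp hf₀ hnice (d₀ := fun w => w) (d₁ := fun _ => 1)
    (d₂ := fun _ => 0) (C := D) (R := fun _ => 0) ?_ ?_ ?_ ?_ ?_ ?_ ?_ hτ ?_).2.trans ?_
  · intro k w _
    refine le_trans ?_ (hDw w)
    rw [abs_div, abs_of_pos (hK k), div_le_iff₀ (hK k)]
    refine (hlip _).trans (le_of_eq ?_)
    rw [abs_mul, abs_of_pos (hK k)]
    ring
  · intro k w _
    rw [d1]
    exact (hD1 _).trans (le_mul_of_one_le_right hD0 (hM w))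
  · intro k w _
    rw [d1, abs_mul, mul_comm]
    exact (mul_le_mul_of_nonneg_right (hD1 _) (abs_nonneg w)).trans (hDw w)
  · intro k w _
    rw [d2]
    refine le_trans ?_ (le_mul_of_one_le_right hD0 (hM w))
    have e : w ^ 2 * (deriv (deriv φ) ((k + 1 : ℝ) * w) * (k + 1))
        = ((k + 1 : ℝ) * w) ^ 2 * deriv (deriv φ) ((k + 1 : ℝ) * w) / (k + 1) := by
      field_simp
    rw [e, abs_div, abs_of_pos (hK k)]
    have : (0 : ℝ) ≤ k := k.cast_nonneg
    exact (div_le_self (abs_nonneg _) (by linarith)).trans (hD2 _)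
  · intro w hw
    -- `φ` has slope one beyond `2`, so `φ (k w) / k = w + (φ 2 - 2) / k` for large `k`
    have hφlin : ∀ x ≥ 2, φ x = x + (φ 2 - 2) := fun x hx => by
      have e := intervalIntegral.integral_eq_sub_of_hasDerivAt (a := 2) (b := x)
        (fun y _ => hφ.hasDerivAt y) (hφ.smooth_deriv.continuous.intervalIntegrable _ _)
      rw [intervalIntegral.integral_congr (g := fun _ => (1 : ℝ)) (fun y hy => by
        rw [uIcc_of_le hx] at hy
        exact hφ1 y hy.1), intervalIntegral.integral_const, smul_eq_mul, mul_one] at e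
      linarith
    have e1 : Tendsto (fun k : ℕ => w + (φ 2 - 2) * (1 / ((k : ℝ) + 1))) atTop
        (𝓝 (w + (φ 2 - 2) * 0)) :=
      tendsto_const_nhds.add (tendsto_one_div_add_atTop_nhds_zero_nat.const_mul _)
    rw [mul_zero, add_zero] at e1
    refine e1.congr' ?_
    filter_upwards [hfar w hw] with k hk
    rw [hφlin _ hk.le]
    have := hK k
    field_simp
  · intro w hw
    refine tendsto_const_nhds.congr' ?_
    filter_upwards [hfar w hw] with k hk
    rw [d1, hφ1 _ hk.le]
  · intro w hw
    refine tendsto_const_nhds.congr' ?_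
    filter_upwards [hfar w hw] with k hk
    rw [d2, hφ2 _ hk, zero_mul]
  · intro r _
    simp
  · simp

/-! ### The limit equation for all test functions -/

theorem IsTestFunction.integral_derivWithin {p : ℝ} (hp : 2 < p) {φ : ℝ → ℝ}
    (h : IsTestFunction p φ) {x : ℝ} (hx : 0 ≤ x) :
    ∫ t in (0 : ℝ)..x, derivWithin φ (Ici 0) t = φ x ∧
      ∫ t in (0 : ℝ)..x, iteratedDerivWithin 2 φ (Ici 0) t = derivWithin φ (Ici 0) x := by
  obtain ⟨hc, hd1, hd2, -⟩ := h.regularity hp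
  have hsub : uIcc 0 x ⊆ Ici 0 := by rw [uIcc_of_le hx]; exact Icc_subset_Ici_self
  have hsub' : Icc 0 x ⊆ Ici 0 := Icc_subset_Ici_self
  constructor
  · rw [intervalIntegral.integral_eq_sub_of_hasDerivAt_of_le hx (f := φ)
      (fun t ht => ((hd1 t (hsub' ht)).continuousWithinAt).mono hsub')
      (fun t ht => (hd1 t ht.1.le).hasDerivAt (Ici_mem_nhds ht.1))
      (ContinuousOn.intervalIntegrable fun t ht => ((hd2 t (hsub ht)).continuousWithinAt).mono hsub),
      h.1, sub_zero]
  · rw [intervalIntegral.integral_eq_sub_of_hasDerivAt_of_le hx (f := derivWithin φ (Ici 0))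
      (fun t ht => ((hd2 t (hsub' ht)).continuousWithinAt).mono hsub')
      (fun t ht => (hd2 t ht.1.le).hasDerivAt (Ici_mem_nhds ht.1))
      ((hc.mono hsub).intervalIntegrable), h.2.1, sub_zero]

/-- Two integrations of a bound on the second derivative. -/
theorem abs_double_primitive_le {p c : ℝ} (hp : 2 < p) (hc : 0 ≤ c) {u v z : ℝ → ℝ}
    (hz : ∀ x > 0, |z x| ≤ c * (1 + x ^ (p - 2)))
    (hv : ∀ x > 0, v x = ∫ t in (0 : ℝ)..x, z t) (hu : ∀ x > 0, u x = ∫ t in (0 : ℝ)..x, v t)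
    {w : ℝ} (hw : 0 < w) :
    |u w| ≤ 2 * c * (1 + |w| ^ p) ∧ |v w| ≤ 2 * c * (1 + |w| ^ p) ∧
      |w * v w| ≤ 2 * c * (1 + |w| ^ p) ∧ |w ^ 2 * z w| ≤ 2 * c * (1 + |w| ^ p) := by
  have hmono : ∀ x > 0, x ≤ w → c * (1 + x ^ (p - 2)) ≤ c * (1 + w ^ (p - 2)) := fun x hx hxw => by
    have : x ^ (p - 2) ≤ w ^ (p - 2) := Real.rpow_le_rpow hx.le hxw (by linarith)
    gcongr
  have hv' : ∀ x > 0, x ≤ w → |v x| ≤ c * (1 + w ^ (p - 2)) * w := fun x hx hxw => by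
    rw [hv x hx]
    refine (intervalIntegral.norm_integral_le_of_norm_le_const (f := z) (a := 0) (b := x)
      (C := c * (1 + w ^ (p - 2))) fun t ht => ?_).trans ?_
    · rw [uIoc_of_le hx.le] at ht
      exact (hz t ht.1).trans (hmono t ht.1 (ht.2.trans hxw))
    · rw [sub_zero, abs_of_pos hx]
      exact mul_le_mul_of_nonneg_left hxw (by positivity)
  have hu' : |u w| ≤ c * (1 + w ^ (p - 2)) * w * w := by
    rw [hu w hw]
    refine (intervalIntegral.norm_integral_le_of_norm_le_const (f := v) (a := 0) (b := w)
      (C := c * (1 + w ^ (p - 2)) * w) fun t ht => ?_).trans ?_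
    · rw [uIoc_of_le hw.le] at ht
      exact hv' t ht.1 ht.2
    · rw [sub_zero, abs_of_pos hw]
  have e1 : w ^ (p - 2) * w ^ 2 = w ^ p := by
    rw [← Real.rpow_two, ← Real.rpow_add hw]; congr 1; ring
  have e2 : w ^ (p - 2) * w = w ^ (p - 1) := by
    rw [← Real.rpow_add_one hw.ne']; congr 1; ring
  have h2 : w ^ 2 ≤ 1 + w ^ p := by
    have := sq_le_one_add_rpow hp.le w
    rwa [abs_of_pos hw] at this
  have h1 : w ≤ 1 + w ^ p := by
    have := abs_le_one_add_rpow (show 1 ≤ p by linarith) w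
    rwa [abs_of_pos hw] at this
  have h3 : w ^ (p - 1) ≤ 1 + w ^ p :=
    rpow_le_one_add_rpow hw.le (by linarith) (by linarith)
  have hwp : 0 ≤ w ^ p := by positivity
  have k2 : c * (1 + w ^ (p - 2)) * w * w ≤ 2 * c * (1 + w ^ p) := by
    have : c * (1 + w ^ (p - 2)) * w * w = c * (w ^ 2 + w ^ p) := by rw [← e1]; ring
    rw [this, mul_comm 2 c, mul_assoc]
    exact mul_le_mul_of_nonneg_left (by linarith) hc
  have k1 : c * (1 + w ^ (p - 2)) * w ≤ 2 * c * (1 + w ^ p) := by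
    have : c * (1 + w ^ (p - 2)) * w = c * (w + w ^ (p - 1)) := by rw [← e2]; ring
    rw [this, mul_comm 2 c, mul_assoc]
    exact mul_le_mul_of_nonneg_left (by linarith) hc
  rw [abs_of_pos hw]
  refine ⟨hu'.trans k2, (hv' w hw le_rfl).trans k1, ?_, ?_⟩
  · rw [abs_mul, abs_of_pos hw, mul_comm]
    exact (mul_le_mul_of_nonneg_right (hv' w hw le_rfl) hw.le).trans k2
  · rw [abs_mul, abs_of_pos (show 0 < w ^ 2 by positivity)]
    calc w ^ 2 * |z w| ≤ w ^ 2 * (c * (1 + w ^ (p - 2))) :=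
          mul_le_mul_of_nonneg_left (hz w hw) (by positivity)
      _ = c * (1 + w ^ (p - 2)) * w * w := by ring
      _ ≤ _ := k2

theorem IsTestFunction.exists_growth {p : ℝ} (hp : 2 < p) {φ : ℝ → ℝ} (h : IsTestFunction p φ) :
    ∃ C : ℝ, 0 ≤ C ∧ ∀ w > 0, |φ w| ≤ C * (1 + |w| ^ p) ∧
      |derivWithin φ (Ici 0) w| ≤ C * (1 + |w| ^ p) ∧
      |w * derivWithin φ (Ici 0) w| ≤ C * (1 + |w| ^ p) ∧
      |w ^ 2 * iteratedDerivWithin 2 φ (Ici 0) w| ≤ C * (1 + |w| ^ p) := by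
  obtain ⟨-, -, -, c, hc0, hc⟩ := h.regularity hp
  exact ⟨2 * c, by positivity, fun w hw => abs_double_primitive_le hp hc0
    (fun x hx => hc x (mem_Ici.2 (le_of_lt hx)))
    (fun x hx => (h.integral_derivWithin hp (le_of_lt hx)).2.symm)
    (fun x hx => (h.integral_derivWithin hp (le_of_lt hx)).1.symm) hw⟩

/-- Continuous functions on `[0, ∞)` are pointwise limits on `(0, ∞)` of smooth functions with
compact support in `(0, ∞)`, with control of the size. -/
theorem exists_smooth_approx {z : ℝ → ℝ} (hz : ContinuousOn z (Ici 0)) :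
    ∃ s : ℕ → ℝ → ℝ, (∀ k, ContDiff ℝ ∞ (s k)) ∧
      (∀ k, ∃ a > 0, ∃ b, (∀ x ≤ a, s k x = 0) ∧ ∀ x ≥ b, s k x = 0) ∧
      (∀ k, ∀ x > 0, |s k x| ≤ |z x| + 1) ∧ ∀ x > 0, Tendsto (fun k => s k x) atTop (𝓝 (z x)) := by
  have hK : ∀ k : ℕ, (0 : ℝ) < 1 / (k + 1) := fun k => by positivity
  have hex : ∀ k : ℕ, ∃ s : ℝ → ℝ, ContDiff ℝ ∞ s ∧
      (∃ a > 0, ∃ b, (∀ x ≤ a, s x = 0) ∧ ∀ x ≥ b, s x = 0) ∧ (∀ x > 0, |s x| ≤ |z x| + 1) ∧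
      ∀ x > 0, 1 / ((k : ℝ) + 1) ≤ x → x ≤ k → |s x - z x| ≤ 1 / (k + 1) := by
    intro k
    obtain ⟨χ, hχ, hχ1, -⟩ := exists_isBump (K := Icc (1 / ((k : ℝ) + 1)) k) (U := univ)
      isCompact_Icc isOpen_univ (subset_univ _) fun x hx => (hK k).trans_le hx.1
    have hcont : Continuous fun x => z (max x 0) :=
      hz.comp_continuous (by fun_prop) fun x => mem_Ici.2 (le_max_right _ _)
    obtain ⟨s, hs, hsd, hss⟩ := (show Continuous fun x => χ x * z (max x 0) from
      hχ.nice.continuous.mul hcont).exists_contDiff_approx ⊤ (ε := fun _ => 1 / ((k : ℝ) + 1))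
      continuous_const fun _ => hK k
    have hs0 : ∀ x, χ x = 0 → s x = 0 := fun x hx => by
      by_contra hne
      exact hss (a := x) hne (by simp only [hx, zero_mul])
    have hd : ∀ x > 0, |s x - χ x * z x| ≤ 1 / (k + 1) := fun x hx => by
      have e := hsd x
      rw [Real.dist_eq, max_eq_left (le_of_lt hx)] at e
      exact e.le
    obtain ⟨a, ha, hχa⟩ := hχ.nice.zero_near
    obtain ⟨b, hb⟩ := hχ.compact.isCompact.bddAbove
    refine ⟨s, hs, ⟨a, ha, b + 1, fun x hx => hs0 x (hχa x hx), fun x hx => hs0 x ?_⟩,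
      fun x hx => ?_, fun x hx hx1 hx2 => ?_⟩
    · refine image_eq_zero_of_notMem_tsupport fun hmem => ?_
      have := hb hmem
      linarith
    · have h1 := hd x hx
      have h2 : |χ x * z x| ≤ |z x| := by
        rw [abs_mul, abs_of_nonneg (hχ.mem_Icc x).1]
        exact mul_le_of_le_one_left (abs_nonneg _) (hχ.mem_Icc x).2
      have h3 : 1 / ((k : ℝ) + 1) ≤ 1 := by
        rw [div_le_one (by positivity)]
        linarith [k.cast_nonneg (α := ℝ)]
      have h4 := abs_add_le (s x - χ x * z x) (χ x * z x)
      rw [sub_add_cancel] at h4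
      linarith
    · have h1 := hd x hx
      rwa [hχ1 x ⟨hx1, hx2⟩, one_mul] at h1
  choose s hs hs0 hsb hst using hex
  refine ⟨s, hs, hs0, hsb, fun x hx => ?_⟩
  have h0 := tendsto_one_div_add_atTop_nhds_zero_nat (𝕜 := ℝ)
  rw [tendsto_iff_dist_tendsto_zero]
  refine squeeze_zero' (Eventually.of_forall fun k => dist_nonneg) ?_ h0
  filter_upwards [h0.eventually (ge_mem_nhds hx),
    tendsto_natCast_atTop_atTop.eventually_ge_atTop x] with k h1 h2
  exact hst k x hx h1 h2

/-- Test functions of the class `𝓕_p` are limits of nice functions, in the sense in which the limit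
equation is stable. -/
theorem IsTestFunction.exists_approx {p : ℝ} (hp : 2 < p) {φ : ℝ → ℝ} (h : IsTestFunction p φ) :
    ∃ (u : ℕ → ℝ → ℝ) (C : ℝ), (∀ k, IsNice (u k)) ∧
      (∀ k, ∀ w > 0, |u k w| ≤ C * (1 + |w| ^ p) ∧ |deriv (u k) w| ≤ C * (1 + |w| ^ p) ∧
        |w * deriv (u k) w| ≤ C * (1 + |w| ^ p) ∧
        |w ^ 2 * deriv (deriv (u k)) w| ≤ C * (1 + |w| ^ p)) ∧
      ∀ w > 0, Tendsto (fun k => u k w) atTop (𝓝 (φ w)) ∧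
        Tendsto (fun k => deriv (u k) w) atTop (𝓝 (derivWithin φ (Ici 0) w)) ∧
        Tendsto (fun k => deriv (deriv (u k)) w) atTop
          (𝓝 (iteratedDerivWithin 2 φ (Ici 0) w)) := by
  obtain ⟨hc, -, -, c, hc0, hcb⟩ := h.regularity hp
  obtain ⟨s, hs, hs0, hsb, hst⟩ := exists_smooth_approx hc
  have hbd : ∀ k, ∀ x > 0, |s k x| ≤ (c + 1) * (1 + x ^ (p - 2)) := fun k x hx => by
    have h1 := hsb k x hx
    have h2 := hcb x (mem_Ici.2 (le_of_lt hx))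
    have h3 : 0 ≤ x ^ (p - 2) := Real.rpow_nonneg (le_of_lt hx) _
    linarith
  have hv : ∀ k, ContDiff ℝ ∞ fun x => ∫ t in (0 : ℝ)..x, s k t := fun k =>
    (hs k).integral_primitive.1
  have hnice : ∀ k, IsNice fun x => ∫ r in (0 : ℝ)..x, ∫ t in (0 : ℝ)..r, s k t := fun k => by
    obtain ⟨a, ha, b, h0, h1⟩ := hs0 k
    refine isNice_primitive (hv k) ha (fun x hx => integral_primitive_eq_zero ha h0 hx) (b := b) ?_
    rwa [(hs k).integral_primitive.2]
  have hd1 : ∀ k, deriv (fun x => ∫ r in (0 : ℝ)..x, ∫ t in (0 : ℝ)..r, s k t)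
      = fun x => ∫ t in (0 : ℝ)..x, s k t := fun k => (hv k).integral_primitive.2
  have hd2 : ∀ k, deriv (deriv fun x => ∫ r in (0 : ℝ)..x, ∫ t in (0 : ℝ)..r, s k t) = s k :=
    fun k => by rw [hd1, (hs k).integral_primitive.2]
  have hB := fun (k : ℕ) (w : ℝ) (hw : 0 < w) => abs_double_primitive_le hp (by positivity : 0 ≤ c + 1)
    (z := s k) (v := fun x => ∫ t in (0 : ℝ)..x, s k t)
    (u := fun x => ∫ r in (0 : ℝ)..x, ∫ t in (0 : ℝ)..r, s k t) (hbd k) (fun _ _ => rfl)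
    (fun _ _ => rfl) (w := w) hw
  -- dominated convergence, first for the derivatives and then for the functions themselves
  have hprim : ∀ (a : ℕ → ℝ → ℝ) (b : ℝ → ℝ) (B x : ℝ), 0 < x → (∀ k, Continuous (a k)) →
      (∀ k, ∀ t > 0, t ≤ x → |a k t| ≤ B) → (∀ t > 0, Tendsto (fun k => a k t) atTop (𝓝 (b t))) →
      Tendsto (fun k => ∫ t in (0 : ℝ)..x, a k t) atTop (𝓝 (∫ t in (0 : ℝ)..x, b t)) := by
    intro a b B x hx ha hab hat
    refine intervalIntegral.tendsto_integral_filter_of_dominated_convergence (fun _ => B)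
      (Eventually.of_forall fun k => (ha k).aestronglyMeasurable)
      (Eventually.of_forall fun k => Eventually.of_forall fun t ht => ?_) intervalIntegrable_const
      (Eventually.of_forall fun t ht => ?_)
    · rw [uIoc_of_le hx.le] at ht
      exact hab k t ht.1 ht.2
    · rw [uIoc_of_le hx.le] at ht
      exact hat t ht.1
  have hrp : ∀ {t x r : ℝ}, 0 < t → t ≤ x → 0 ≤ r → t ^ r ≤ x ^ r := fun ht htx hr =>
    Real.rpow_le_rpow ht.le htx hr
  have ht1 : ∀ x > 0, Tendsto (fun k => ∫ t in (0 : ℝ)..x, s k t) atTop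
      (𝓝 (derivWithin φ (Ici 0) x)) := fun x hx => by
    rw [← (h.integral_derivWithin hp (le_of_lt hx)).2]
    refine hprim _ _ ((c + 1) * (1 + x ^ (p - 2))) x hx (fun k => (hs k).continuous)
      (fun k t ht htx => (hbd k t ht).trans (mul_le_mul_of_nonneg_left ?_ (by positivity))) hst
    have := hrp ht htx (show 0 ≤ p - 2 by linarith)
    linarith
  have ht0 : ∀ x > 0, Tendsto (fun k => ∫ r in (0 : ℝ)..x, ∫ t in (0 : ℝ)..r, s k t) atTop
      (𝓝 (φ x)) := fun x hx => by
    rw [← (h.integral_derivWithin hp (le_of_lt hx)).1]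
    refine hprim _ _ (2 * (c + 1) * (1 + x ^ p)) x hx (fun k => (hv k).continuous)
      (fun k t ht htx => (hB k t ht).2.1.trans (mul_le_mul_of_nonneg_left ?_ (by positivity))) ht1
    have := hrp ht htx (show 0 ≤ p by linarith)
    rw [abs_of_pos ht]
    linarith
  refine ⟨fun k x => ∫ r in (0 : ℝ)..x, ∫ t in (0 : ℝ)..r, s k t, 2 * (c + 1), hnice,
    fun k w hw => ?_, fun w hw => ?_⟩
  · rw [hd2, hd1]
    exact hB k w hw
  · refine ⟨ht0 w hw, (ht1 w hw).congr fun k => ?_, (hst w hw).congr fun k => ?_⟩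
    · rw [hd1]
    · rw [hd2]

namespace IsMeanFieldCurve

variable {p lam : ℝ} {f₀ : ProbabilityMeasure ℝ} {g : ℝ → ProbabilityMeasure ℝ}

theorem equation_testFunction (h : IsMeanFieldCurve p lam f₀ g) (hp : 2 < p)
    (hf₀ : IsWealthDensity p f₀) {φ : ℝ → ℝ} (hφ : IsTestFunction p φ) {τ : ℝ} (hτ : 0 ≤ τ) :
    IntervalIntegrable (fun r => fokkerPlanckWeak lam (∫ w, w ∂(f₀ : Measure ℝ)) (g r) φ)
        volume 0 τ ∧
      ∫ w, φ w ∂(g τ : Measure ℝ) = ∫ w, φ w ∂(f₀ : Measure ℝ)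
        + ∫ r in (0 : ℝ)..τ, fokkerPlanckWeak lam (∫ w, w ∂(f₀ : Measure ℝ)) (g r) φ := by
  obtain ⟨u, C, hu, hub, hut⟩ := hφ.exists_approx hp
  obtain ⟨D, -, hD⟩ := hφ.exists_growth hp
  refine h.equation_of_tendsto hp hf₀ hu (d₁ := derivWithin φ (Ici 0))
    (d₂ := iteratedDerivWithin 2 φ (Ici 0)) (C := C) (fun k w hw => (hub k w hw).1)
    (fun k w hw => (hub k w hw).2.1) (fun k w hw => (hub k w hw).2.2.1)
    (fun k w hw => (hub k w hw).2.2.2) (fun w hw => (hut w hw).1) (fun w hw => (hut w hw).2.1)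
    (fun w hw => (hut w hw).2.2.const_mul _) hτ fun r hr => ?_
  have hd := h.density r hr
  have hpos := hd.ae_pos
  have hint : ∀ (v : ℕ → ℝ → ℝ) (z : ℝ → ℝ), (∀ k, Continuous (v k)) →
      (∀ w > 0, Tendsto (fun k => v k w) atTop (𝓝 (z w))) →
      (∀ w > 0, |z w| ≤ D * (1 + |w| ^ p)) → Integrable z (g r : Measure ℝ) := by
    intro v z hv hvz hz
    refine (((integrable_const (1 : ℝ)).add hd.moment).const_mul D).mono'
      (aestronglyMeasurable_of_tendsto_ae atTop (fun k => (hv k).aestronglyMeasurable) ?_) ?_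
    · filter_upwards [hpos] with w hw using hvz w hw
    · filter_upwards [hpos] with w hw using hz w hw
  have hc1 : ∀ k, Continuous (deriv (u k)) := fun k => (hu k).smooth_deriv.continuous
  have hc2 : ∀ k, Continuous (deriv (deriv (u k))) := fun k => (hu k).smooth_deriv_deriv.continuous
  have i1 := hint _ _ hc1 (fun w hw => (hut w hw).2.1) fun w hw => (hD w hw).2.1
  have i2 := hint (fun k w => w * deriv (u k) w) (fun w => w * derivWithin φ (Ici 0) w)
    (fun k => continuous_id.mul (hc1 k)) (fun w hw => (hut w hw).2.1.const_mul w)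
    fun w hw => (hD w hw).2.2.1
  have i3 := hint (fun k w => w ^ 2 * deriv (deriv (u k)) w)
    (fun w => w ^ 2 * iteratedDerivWithin 2 φ (Ici 0) w)
    (fun k => (continuous_pow 2).mul (hc2 k)) (fun w hw => (hut w hw).2.2.const_mul (w ^ 2))
    fun w hw => (hD w hw).2.2.2
  rw [h.integral_id hp hf₀ hr, ← integral_const_mul, ← integral_const_mul,
    ← integral_sub (i1.const_mul _) i2,
    ← integral_add (show Integrable (fun w => _ - _) _ from (i1.const_mul _).sub i2)
      (i3.const_mul _)]
  unfold fokkerPlanckWeak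
  congr 1 with w
  ring

/-- Continuity in time of the moment of order `p`, from the equation for the test function
`w ^ p`. -/
theorem tendsto_moment (h : IsMeanFieldCurve p lam f₀ g) (hp : 2 < p) (hf₀ : IsWealthDensity p f₀)
    {τ : ℝ} (hτ : 0 ≤ τ) :
    Tendsto (fun r => ∫ w, |w| ^ p ∂(g r : Measure ℝ)) (𝓝[Ici 0] τ)
      (𝓝 (∫ w, |w| ^ p ∂(g τ : Measure ℝ))) := by
  have e : ∀ r, 0 ≤ r → ∫ w, |w| ^ p ∂(g r : Measure ℝ) = ∫ w, w ^ p ∂(f₀ : Measure ℝ)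
      + ∫ s in (0 : ℝ)..r, fokkerPlanckWeak lam (∫ w, w ∂(f₀ : Measure ℝ)) (g s)
        (fun w => w ^ p) := fun r hr => by
    rw [← integral_rpow_eq_abs (h.density r hr).support]
    exact (h.equation_testFunction hp hf₀ (isTestFunction_rpow hp) hr).2
  have hint := (h.equation_testFunction hp hf₀ (isTestFunction_rpow hp)
    (show 0 ≤ τ + 1 by linarith)).1
  have hc := intervalIntegral.continuousOn_primitive_interval (a := 0) (b := τ + 1)
    ((intervalIntegrable_iff_integrableOn_Icc_of_le (by linarith)).1 hint |>.mono_set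
      (by rw [uIcc_of_le (by linarith)]))
  rw [uIcc_of_le (by linarith)] at hc
  have hτm : τ ∈ Icc 0 (τ + 1) := ⟨hτ, by linarith⟩
  have hcτ := (hc τ hτm).const_add (∫ w, w ^ p ∂(f₀ : Measure ℝ))
  have hnhds : 𝓝[Ici 0] τ = 𝓝[Icc 0 (τ + 1)] τ := by
    rw [← Ici_inter_Iic]
    exact (nhdsWithin_inter_of_mem' (mem_nhdsWithin_of_mem_nhds
      (Iic_mem_nhds (by linarith)))).symm
  rw [hnhds, e τ hτ]
  refine Tendsto.congr' ?_ hcτ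
  filter_upwards [self_mem_nhdsWithin] with r hr using (e r hr.1).symm

theorem continuousOn_fokkerPlanckWeak (h : IsMeanFieldCurve p lam f₀ g) (hp : 2 < p)
    (hf₀ : IsWealthDensity p f₀) (m : ℝ) {φ : ℝ → ℝ} (hφ : IsTestFunction p φ) :
    ContinuousOn (fun r => fokkerPlanckWeak lam m (g r) φ) (Ici 0) := by
  obtain ⟨hc2, -, hd2, -⟩ := hφ.regularity hp
  obtain ⟨C, hC0, hC⟩ := hφ.exists_growth hp
  have hc1 : ContinuousOn (derivWithin φ (Ici 0)) (Ici 0) := fun x hx =>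
    (hd2 x hx).continuousWithinAt
  set G : ℝ → ℝ := fun w => (m - w) * derivWithin φ (Ici 0) w
    + lam / 2 * w ^ 2 * iteratedDerivWithin 2 φ (Ici 0) w with hG
  have hGc : ContinuousOn G (Ici 0) := by
    refine ((continuousOn_const.sub continuousOn_id).mul hc1).add
      ((continuousOn_const.mul (continuousOn_id.pow 2)).mul hc2)
  set c : ℝ := (|m| + 1 + |lam / 2|) * C with hc
  have hGpos : ∀ w > 0, |G w| ≤ c * (1 + |w| ^ p) := fun w hw => by
    obtain ⟨-, b1, b2, b3⟩ := hC w hw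
    have e : G w = m * derivWithin φ (Ici 0) w - w * derivWithin φ (Ici 0) w
      + lam / 2 * (w ^ 2 * iteratedDerivWithin 2 φ (Ici 0) w) := by rw [hG]; ring
    have t1 := mul_le_mul_of_nonneg_left b1 (abs_nonneg m)
    have t2 := mul_le_mul_of_nonneg_left b3 (abs_nonneg (lam / 2))
    rw [← abs_mul] at t1 t2
    rw [e]
    refine (abs_add_le _ _).trans ((add_le_add ((abs_sub _ _).trans (add_le_add t1 b2)) t2).trans
      (le_of_eq ?_))
    rw [hc]; ring
  -- the integrand, extended continuously to the line by its value at zero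
  have hext : Continuous fun w => G (max w 0) :=
    hGc.comp_continuous (by fun_prop) fun w => mem_Ici.2 (le_max_right _ _)
  have hG0 : G 0 = 0 := by rw [hG]; simp [hφ.2.1]
  have hle : ∀ w, |G (max w 0)| ≤ c * (1 + |w| ^ p) := fun w => by
    rcases lt_or_ge 0 w with hw | hw
    · rw [max_eq_left hw.le]; exact hGpos w hw
    · rw [max_eq_right hw, hG0, abs_zero]; positivity
  have heq : ∀ r, 0 ≤ r → fokkerPlanckWeak lam m (g r) φ = ∫ w, G (max w 0) ∂(g r : Measure ℝ) := by
    intro r hr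
    refine integral_congr_ae ?_
    filter_upwards [ae_nonneg_of_measure_Iio (h.density r hr).support] with w hw
    rw [max_eq_left hw]
  have hi : ∀ r, 0 ≤ r → Integrable (fun w => c * (1 + |w| ^ p)) (g r : Measure ℝ) := fun r hr =>
    ((integrable_const (1 : ℝ)).add (h.density r hr).moment).const_mul c
  have hval : ∀ r, 0 ≤ r → ∫ w, c * (1 + |w| ^ p) ∂(g r : Measure ℝ)
      = c * (1 + ∫ w, |w| ^ p ∂(g r : Measure ℝ)) := fun r hr => by
    rw [integral_const_mul, integral_add (integrable_const _) (h.density r hr).moment]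
    simp
  intro τ hτ
  have key := tendsto_integral_of_tendsto_dominating (h.continuous τ hτ) hext
    (ψ := fun w => c * (1 + |w| ^ p))
    (continuous_const.mul (continuous_const.add
      (continuous_abs.rpow_const fun x => Or.inr (by linarith)))) hle
    (by filter_upwards [self_mem_nhdsWithin] with r hr using hi r hr) (hi τ hτ) (by
      rw [hval τ hτ]
      refine Tendsto.congr' ?_ (((h.tendsto_moment hp hf₀ hτ).const_add 1).const_mul c)
      filter_upwards [self_mem_nhdsWithin] with r hr using (hval r hr).symm)
  rw [ContinuousWithinAt, heq τ hτ]
  refine Tendsto.congr' ?_ key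
  filter_upwards [self_mem_nhdsWithin] with r hr using (heq r hr).symm

theorem isWeakSolution (h : IsMeanFieldCurve p lam f₀ g) (hp : 2 < p)
    (hf₀ : IsWealthDensity p f₀) :
    IsWeakSolution p (fokkerPlanckWeak lam (∫ w, w ∂(f₀ : Measure ℝ))) f₀ g := by
  set m := ∫ w, w ∂(f₀ : Measure ℝ) with hm
  -- the solution formula, with the right-hand side extended continuously to negative times
  have key : ∀ φ, IsTestFunction p φ → ∃ H : ℝ → ℝ, ContDiff ℝ 1 H ∧
      H 0 = ∫ w, φ w ∂(f₀ : Measure ℝ) ∧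
      (∀ t, 0 ≤ t → ∫ w, φ w ∂(g t : Measure ℝ) = H t) ∧
      ∀ t, 0 ≤ t → HasDerivAt H (fokkerPlanckWeak lam m (g t) φ) t := by
    intro φ hφ
    have hc : Continuous fun r => fokkerPlanckWeak lam m (g (max r 0)) φ :=
      (h.continuousOn_fokkerPlanckWeak hp hf₀ m hφ).comp_continuous (f := fun r => max r 0)
        (by fun_prop) fun r => mem_Ici.2 (le_max_right _ _)
    have hd : ∀ t, HasDerivAt (fun t => ∫ w, φ w ∂(f₀ : Measure ℝ)
        + ∫ r in (0 : ℝ)..t, fokkerPlanckWeak lam m (g (max r 0)) φ)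
        (fokkerPlanckWeak lam m (g (max t 0)) φ) t := fun t =>
      ((hc.integral_hasStrictDerivAt 0 t).hasDerivAt).const_add _
    refine ⟨_, contDiff_one_iff_deriv.2 ⟨fun t => (hd t).differentiableAt, ?_⟩, ?_,
      fun t ht => ?_, fun t ht => ?_⟩
    · rwa [funext fun t => (hd t).deriv]
    · simp
    · rw [(h.equation_testFunction hp hf₀ hφ ht).2]
      congr 1
      refine intervalIntegral.integral_congr fun r hr => ?_
      rw [uIcc_of_le ht] at hr
      simp only [max_eq_left hr.1]
      rfl
    · have := hd t
      rwa [max_eq_left ht] at this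
  refine ⟨h.density, fun φ hφ => ?_, fun φ hφ t ht => ?_, fun φ hφ => ?_⟩
  · obtain ⟨H, hH, -, hHg, -⟩ := key φ hφ
    exact hH.contDiffOn.congr fun t ht => hHg t ht
  · obtain ⟨H, -, -, hHg, hHd⟩ := key φ hφ
    refine (hHd t ht.le).congr_of_eventuallyEq ?_
    filter_upwards [Ioi_mem_nhds ht] with s hs using hHg s (le_of_lt hs)
  · obtain ⟨H, hH, hH0, hHg, -⟩ := key φ hφ
    rw [← hH0]
    refine ((hH.continuous.tendsto 0).mono_left nhdsWithin_le_nhds).congr' ?_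
    filter_upwards [self_mem_nhdsWithin] with s hs using (hHg s (le_of_lt hs)).symm

end IsMeanFieldCurve

end SmoothTestFunctions

/-! ### The law of the market returns -/

theorem integral_abs_rpow_map_const_mul {Ω : Type*} [MeasurableSpace Ω] {P : Measure Ω}
    {Y : Ω → ℝ} (hY : AEMeasurable Y P) {s : ℝ} (hs : 0 < s) (r : ℝ) :
    ∫ x, |x| ^ r ∂(P.map fun ω => s * Y ω) = (s ^ 2) ^ (r / 2) * ∫ ω, |Y ω| ^ r ∂P := by
  rw [integral_map (hY.const_mul s)
    (by fun_prop : Measurable fun x : ℝ => |x| ^ r).aestronglyMeasurable, ← integral_const_mul]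
  congr 1 with ω
  rw [abs_mul, abs_of_pos hs, Real.mul_rpow hs.le (abs_nonneg _), ← Real.rpow_natCast s 2,
    ← Real.rpow_mul hs.le]
  congr 2
  push_cast
  ring

theorem tendsto_rpow_mul_zero {γ : ℕ → ℝ} {lam : ℝ} (hγ0 : Tendsto γ atTop (𝓝 0)) {r : ℝ}
    (hr : 0 < r) (c : ℝ) : Tendsto (fun n => (lam * γ n) ^ r * c) atTop (𝓝 0) := by
  have h1 := ((hγ0.const_mul lam).rpow_const (p := r) (Or.inr hr.le)).mul_const c
  rwa [mul_zero, Real.zero_rpow hr.ne', zero_mul] at h1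

/-! ### Convergence to the Fokker-Planck equation -/

/-- The Boltzmann solutions on the slow time scale approximately solve the Fokker-Planck equation,
once the trade coefficients are at most `1 / 4`. -/
theorem isFokkerPlanckApprox_of_scaled_noise {Ω : Type*} [MeasurableSpace Ω] (P : Measure Ω)
    [IsProbabilityMeasure P] {Y : Ω → ℝ} {p lam : ℝ} (hp : 2 < p) (hlam : 0 < lam)
    (hY : AEMeasurable Y P) (hYmean : ∫ ω, Y ω ∂P = 0) (hYsq : ∫ ω, Y ω ^ 2 ∂P = 1)
    (hYp : Integrable (fun ω => |Y ω| ^ p) P) {f₀ : ProbabilityMeasure ℝ}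
    (hf₀ : IsWealthDensity p f₀) {γ σ : ℕ → ℝ} (hγ : ∀ n, 0 < γ n) (hγ' : ∀ n, γ n ≤ 1 / 4)
    (hγ0 : Tendsto γ atTop (𝓝 0)) (hσ : ∀ n, 0 < σ n) (hσγ : ∀ n, σ n ^ 2 = lam * γ n)
    {f : ℕ → ℝ → ProbabilityMeasure ℝ}
    (hf : ∀ n, IsWeakSolution p (boltzmannWeak (γ n) (P.map (fun ω => σ n * Y ω))) f₀ (f n)) :
    IsFokkerPlanckApprox p lam f₀ (fun n τ => f n (τ / γ n)) := by
  have hae : ∀ n, AEMeasurable (fun ω => σ n * Y ω) P := fun n => hY.const_mul _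
  have hprob : ∀ n, IsProbabilityMeasure (P.map (fun ω => σ n * Y ω)) := fun n =>
    Measure.isProbabilityMeasure_map (hae n)
  have hmom : ∀ (n : ℕ) (r : ℝ), ∫ x, |x| ^ r ∂(P.map fun ω => σ n * Y ω)
      = (lam * γ n) ^ (r / 2) * ∫ ω, |Y ω| ^ r ∂P := fun n r => by
    rw [integral_abs_rpow_map_const_mul hY (hσ n), hσγ]
  -- the Taylor remainder has order `q = min p 3`: the moment of order `q` of the noise is finite, and
  -- it is of size `γ ^ (q / 2)`, hence negligible against `γ`
  have hmin : 2 < min p 3 := lt_min hp (by norm_num)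
  refine isFokkerPlanckApprox_of_boltzmann (q := min p 3) (D := lam ^ (p / 2) * ∫ ω, |Y ω| ^ p ∂P)
    hmin (min_le_right _ _) (min_le_left _ _) hlam.le hγ hγ' hγ0 (fun n => ?_) (fun n => ?_)
    (fun n => ?_) (fun n => ?_) ?_ ?_ hf₀ hf
  · rw [integrable_map_measure
      (by fun_prop : Measurable fun x : ℝ => |x| ^ p).aestronglyMeasurable (hae n)]
    refine (hYp.const_mul (σ n ^ p)).congr (Eventually.of_forall fun ω => ?_)
    simp only [Function.comp_apply, abs_mul, abs_of_pos (hσ n)]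
    rw [Real.mul_rpow (hσ n).le (abs_nonneg _)]
  · rw [integral_map (hae n) (f := fun x : ℝ => x)
      measurable_id.aestronglyMeasurable, integral_const_mul, hYmean,
      mul_zero]
  · rw [integral_map (hae n) (f := fun x : ℝ => x ^ 2)
      (measurable_id.pow_const 2).aestronglyMeasurable]
    simp only [mul_pow]
    rw [integral_const_mul, hYsq, mul_one, hσγ]
  · rw [hmom]
    have h1 : γ n ^ (p / 2) ≤ γ n := by
      have := Real.rpow_le_rpow_of_exponent_ge (hγ n) ((hγ' n).trans (by norm_num))
        (show 1 ≤ p / 2 by linarith)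
      rwa [Real.rpow_one] at this
    have h2 : 0 ≤ ∫ ω, |Y ω| ^ p ∂P := integral_nonneg fun ω => by positivity
    rw [Real.mul_rpow hlam.le (hγ n).le]
    calc lam ^ (p / 2) * γ n ^ (p / 2) * ∫ ω, |Y ω| ^ p ∂P
        ≤ lam ^ (p / 2) * γ n * ∫ ω, |Y ω| ^ p ∂P := by gcongr
      _ = _ := by ring
  · refine (tendsto_rpow_mul_zero (lam := lam) hγ0 (r := 1 / 2) (by norm_num)
      (∫ ω, |Y ω| ^ (1 : ℝ) ∂P)).congr fun n => ?_
    rw [← hmom n 1]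
    simp only [Real.rpow_one]
  · refine (tendsto_rpow_mul_zero (lam := lam) hγ0 (r := min p 3 / 2 - 1) (by linarith)
      (lam * ∫ ω, |Y ω| ^ min p 3 ∂P)).congr fun n => ?_
    have hne := (hγ n).ne'
    rw [hmom, Real.rpow_sub_one (mul_pos hlam (hγ n)).ne']
    field_simp

theorem mainTheorem1 {Ω : Type*} [MeasurableSpace Ω] (P : Measure Ω) [IsProbabilityMeasure P]
    (Y : Ω → ℝ) (δ α lam : ℝ) (hδ : 0 < δ) (hα : δ < α) (hlam : 0 < lam)
    (hYpdf : HasPDF Y P volume)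
    (hYsymm : IdentDistrib Y (fun ω => -Y ω) P P)
    (hYvar : variance Y P = 1)
    (hYmoment : Integrable (fun ω => |Y ω| ^ (2 + α)) P)
    (f₀ : ProbabilityMeasure ℝ) (hf₀ : IsWealthDensity (2 + δ) f₀)
    (γ σ : ℕ → ℝ) (hγ : ∀ n, γ n ∈ Ioo (0 : ℝ) 1) (hγ0 : Tendsto γ atTop (𝓝 0))
    (hσ : ∀ n, 0 < σ n) (hσγ : ∀ n, σ n ^ 2 = lam * γ n)
    (f : ℕ → ℝ → ProbabilityMeasure ℝ)
    (hf : ∀ n, IsWeakSolution (2 + δ)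
      (boltzmannWeak (γ n) (P.map (fun ω => σ n * Y ω))) f₀ (f n)) :
    ∃ (k : ℕ → ℕ) (g : ℝ → ProbabilityMeasure ℝ), StrictMono k ∧
      (∀ τ, 0 ≤ τ → Tendsto (fun j => f (k j) (τ / γ (k j))) atTop (𝓝 (g τ))) ∧
      IsWeakSolution (2 + δ)
        (fokkerPlanckWeak lam (∫ w, w ∂(f₀ : Measure ℝ))) f₀ g ∧
      (∀ τ, 0 ≤ τ → ∫ w, w ∂(g τ : Measure ℝ) = ∫ w, w ∂(f₀ : Measure ℝ)) := by
  have hp : 2 < 2 + δ := by linarith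
  have hY : AEMeasurable Y P := hYpdf.aemeasurable
  have hYmean : ∫ ω, Y ω ∂P = 0 := by
    have := hYsymm.integral_eq
    rw [integral_neg] at this
    linarith
  have hYsq : ∫ ω, Y ω ^ 2 ∂P = 1 := by
    rw [← variance_of_integral_eq_zero hY hYmean, hYvar]
  have hYp : Integrable (fun ω => |Y ω| ^ (2 + δ)) P := by
    refine ((integrable_const (1 : ℝ)).add hYmoment).mono'
      ((by fun_prop : Measurable fun x : ℝ => |x| ^ (2 + δ)).comp_aemeasurable
        hY).aestronglyMeasurable (Eventually.of_forall fun ω => ?_)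
    rw [Real.norm_eq_abs, abs_of_nonneg (by positivity)]
    exact rpow_le_one_add_rpow (abs_nonneg _) (by linarith) (by linarith)
  -- the estimates for a single trade need `γ ≤ 1 / 4`, so finitely many terms are dropped
  obtain ⟨N, hN⟩ := eventually_atTop.1
    (hγ0.eventually (ge_mem_nhds (show (0 : ℝ) < 1 / 4 by norm_num)))
  have happ := isFokkerPlanckApprox_of_scaled_noise P hp hlam hY hYmean hYsq hYp hf₀
    (γ := fun n => γ (n + N)) (σ := fun n => σ (n + N)) (f := fun n => f (n + N))
    (fun n => (hγ _).1) (fun n => hN _ (by omega)) ((tendsto_add_atTop_iff_nat N).2 hγ0)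
    (fun n => hσ _) (fun n => hσγ _) (fun n => hf _)
  obtain ⟨k, g, hk, hg⟩ := happ.exists_subseq hp
  have hcurve := (happ.comp hk).isMeanFieldCurve hp hg
  exact ⟨fun j => k j + N, g, hk.add_const N, hg, hcurve.isWeakSolution hp hf₀,
    fun τ hτ => hcurve.integral_id hp hf₀ hτ⟩
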